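/- **Conventions.** All gradings are by $\mathbb Z/2$ with parity $|\cdot|$, signs apply to homogeneous elements and formulas are extended additively. $K$ is a unital supercommutative superring containing $\frac12$, and $A$ is a unital supercommutative superring with a parity-preserving unital ring homomorphism $K\to A$. An $A$-supermodule is a graded $A$-bimodule $M$ with $am=(-1)^{|a||m|}ma$; for an additive endomorphism $g$ of $M$ and $a\in A$ put $(ag)(m)=a\,g(m)$ and $(ga)(m)=g(am)$. $A$- or $K$-linear means additive and compatible with the right action; $[f,g]=fg-(-1)^{|f||g|}gf$. All submodules and subalgebras are graded. An $A$-quadratic form on $M$ is an even, supersymmetric ($q(m,n)=(-1)^{|m||n|}q(n,m)$), $A$-bilinear map $q:M\times M\to A$. For $m,n\in M$ let $E_{m,n}(p)=m\,q(n,p)-(-1)^{|n||p|}q(m,p)\,n$, and let $\mathrm{eosp}(q)\subset \mathrm{End}_A M$ be the additive span of all $E_{m,n}$; it is a Lie superalgebra. For a Lie superalgebra $L$ over $K$, $\mathrm{Der}_K L$ is the sum of the spaces of even and of odd $K$-linear derivations (likewise $\mathrm{Der}_K A$), $\mathrm{ad}\,U=\{\mathrm{ad}\,x\mid x\in U\}$,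 and $\mathrm{ad}_{loc}L$ is the set of $d\in\mathrm{Der}_K L$ such that for each finite $F\subset L$ there is $z\in L$ with $d|_F=\mathrm{ad}\,z|_F$. $B=J\rtimes D$ means that $B$ is the direct sum of its ideal $J$ and its subalgebra $D$. **Setting.** For a set $I$ let $H(I;A)$ be the free $A$-supermodule with even basis $\{h_{i},h_{-i}\mid i\in I\}$ and form $q_I$ with $q_I(h_i,h_{-i})=q_I(h_{-i},h_i)=1$ and all other values on basis vectors $0$. Let $P$ be an $A$-supermodule with an $A$-quadratic form $q_P$, and let $M=H(I;A)\oplus P$, $q=q_I\oplus q_P$. Assume that $|I|\ge2$, or that $|I|\ge1$ and some $p\in P$ satisfies $\{a\in A\mid ap=0\}=0$. Let $q_\infty$ be the orthogonal sum of the form of $H(\{\infty\};A)$ and $q$; put $L=\mathrm{eosp}(q_\infty)$ and $E=\mathrm{eosp}(q)$. The map $(a,m,n,x)\mapsto E_{ah_\infty,h_{-\infty}}+E_{m,h_\infty}+E_{h_{-\infty},n}+x$ is an isomorphism of $A\oplus M\oplus M\oplus E$ onto $L$, and in these coordinates (for $a,m,n,x$ of one parity $\alpha$ and $a',m',n',x'$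 of one parity $\beta$, with $s=(-1)^{\alpha\beta}$) $$[(a,m,n,x),(a',m',n',x')]=\bigl(q(m,n')-q(n,m'),\ am'+xm'-ma'-s\,x'm,\ -an'+xn'+na'-s\,x'n,\ E_{m,n'}+E_{n,m'}+[x,x']\bigr).$$ Let $\mathcal S_E$ be the sum of the spaces of homogeneous $K$-linear endomorphisms $S$ of $M$ such that $[S,A\,\mathrm{Id}]\subset A\,\mathrm{Id}$, $[S,q(m,n)\mathrm{Id}]=\bigl(q(Sm,n)+(-1)^{|m||n|}q(Sn,m)\bigr)\mathrm{Id}$ for all homogeneous $m,n$, and $[S,E]\subset E$. For $S\in\mathcal S_E$ there is exactly one additive map $d_{S,0}:L\to L$ with $d_{S,0}(a,m,n,x)=([S,a\,\mathrm{Id}],Sm,Sn,[S,x])$, where $A\,\mathrm{Id}$ is identified with $A$. For $T\subset\mathcal S_E$ write $d_{T,0}=\{d_{S,0}\mid S\in T\}$. **Claim.** 1. $\mathrm{Der}_K L=\mathrm{ad}\,L+d_{\mathcal S_E,0}$ and $\mathrm{ad}\,L\cap d_{\mathcal S_E,0}=\mathrm{ad}\,E$. 2. If $\mathcal S_E=E\rtimes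 \mathcal S_0$, then $\mathrm{Der}_K L=\mathrm{ad}\,L\rtimes d_{\mathcal S_0,0}$. 3. Suppose moreover that $P=N\oplus R$, where $N$ and $R$ are free $A$-supermodules with homogeneous bases $\{n_i\}$ and $\{r_j\}$, $q_P(N,R)=0$, $q_P|_R=0$, and $q_P|_N$ is almost diagonalizable with respect to $\{n_i\}$: for each $i$ there is $\bar i$ such that $u_i=q_P(n_i,n_{\bar i})$ is invertible and $q_P(n_i,n_j)=0$ for $j\ne\bar i$. For $\Delta\in\mathrm{Der}_K A$ let $\Delta_M$ be the additive endomorphism of $M$ with $$\Delta_M(ah)=\Delta(a)h,\qquad \Delta_M(an_i)=\bigl(\tfrac12\Delta(u_i)u_i^{-1}a+\Delta(a)\bigr)n_i,\qquad \Delta_M(ar_j)=\Delta(a)r_j$$ for the basis vectors $h$ of $H(I;A)$, and let $(\mathrm{Der}_K A)_M=\{\Delta_M\mid\Delta\in \mathrm{Der}_K A\}$. Extend endomorphisms of $R$ by $0$ on $H(I;A)\oplus N$. Then $\mathrm{End}_A R$ and $(\mathrm{Der}_K A)_M$ are contained in $\mathcal S_E$ and meet in $0$, $$\mathrm{Der}_K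 L=\mathrm{ad}_{loc}L\rtimes\{d_{S,0}\mid S\in\mathrm{End}_A R\oplus(\mathrm{Der}_K A)_M\},$$ and $\Delta\mapsto d_{\Delta_M,0}$ is an isomorphism of Lie superalgebras over $K$ from $\mathrm{Der}_K A$ onto $d_{(\mathrm{Der}_K A)_M,0}$. If in addition $L$ is of finite rank (that is, $I$ and the bases of $N$ and $R$ are finite, or $L$ is finitely generated over $A$), then $$\mathrm{Der}_K L=\mathrm{ad}\,L\rtimes\{d_{S,0}\mid S\in\mathrm{End}_A R\oplus(\mathrm{Der}_K A)_M\}.$$ -/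

import Mathlib

noncomputable section

namespace SuperLie

/-! ## Gradings by the integers modulo two -/

/-- The sign `(-1) ^ α` of a parity `α`. -/
def sgn (α : ZMod 2) : ℤ := if α = 0 then 1 else -1

@[simp] theorem sgn_zero : sgn 0 = 1 := rfl

@[simp] theorem sgn_one : sgn 1 = -1 := rfl

theorem parity_cases (α : ZMod 2) : α = 0 ∨ α = 1 := by
  revert α
  decide

theorem sum_parity {M : Type*} [AddCommMonoid M] (f : ZMod 2 → M) : ∑ α, f α = f 0 + f 1 :=
  Fin.sum_univ_two f

@[simp] theorem parity_one_add_one : (1 : ZMod 2) + 1 = 0 := rfl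

section Part

variable {M : Type*} [AddCommGroup M] (ℳ : ZMod 2 → AddSubgroup M)

/-- The grading given by a pair of complementary projections. -/
@[reducible] def decompositionOfProj (π : ZMod 2 → M →+ M) (h_mem : ∀ α m, π α m ∈ ℳ α)
    (h_sum : ∀ m, π 0 m + π 1 m = m) (h_ne : ∀ α β m, m ∈ ℳ α → α ≠ β → π β m = 0) :
    DirectSum.Decomposition ℳ :=
  DirectSum.Decomposition.ofAddHom ℳ
    (∑ α, (DirectSum.of (fun i => ℳ i) α).comp ((π α).codRestrict (ℳ α) (h_mem α)))
    (by
      ext m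
      simp only [sum_parity, AddMonoidHom.comp_apply, AddMonoidHom.add_apply, map_add,
        DirectSum.coeAddMonoidHom_of, AddMonoidHom.id_apply]
      exact h_sum m)
    (by
      ext α m : 2
      have h1 : ∀ β, α ≠ β → (π β).codRestrict (ℳ β) (h_mem β) (m : M) = 0 := fun β hβ =>
        Subtype.ext (h_ne α β m m.2 hβ)
      have h2 : (π α).codRestrict (ℳ α) (h_mem α) (m : M) = m := by
        apply Subtype.ext
        have h := h_sum (m : M)
        rcases parity_cases α with rfl | rfl
        · rw [h_ne 0 1 m m.2 (by decide), add_zero] at h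
          exact h
        · rw [h_ne 1 0 m m.2 (by decide), zero_add] at h
          exact h
      simp only [AddMonoidHom.comp_apply, AddMonoidHom.finsetSum_apply,
        DirectSum.coeAddMonoidHom_of, AddMonoidHom.id_apply]
      rw [Finset.sum_eq_single α]
      · rw [h2]
      · intro β _ hβ
        rw [h1 β hβ.symm, map_zero]
      · simp)

variable [DirectSum.Decomposition ℳ]

/-- The homogeneous component of degree `α`. -/
def part (α : ZMod 2) : M →+ M where
  toFun m := DirectSum.decompose ℳ m α
  map_zero' := by simp
  map_add' x y := by simp

theorem part_mem (α : ZMod 2) (m : M) : part ℳ α m ∈ ℳ α := (DirectSum.decompose ℳ m α).2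

theorem part_same {α : ZMod 2} {m : M} (h : m ∈ ℳ α) : part ℳ α m = m :=
  DirectSum.decompose_of_mem_same ℳ h

theorem part_ne {α β : ZMod 2} {m : M} (h : m ∈ ℳ α) (hαβ : α ≠ β) : part ℳ β m = 0 :=
  DirectSum.decompose_of_mem_ne ℳ h hαβ

theorem part_add (m : M) : part ℳ 0 m + part ℳ 1 m = m := by
  classical
  have h := DirectSum.sum_support_decompose ℳ m
  rw [← sum_parity (fun α => part ℳ α m)]
  conv_rhs => rw [← h]
  symm
  apply Finset.sum_subset (Finset.subset_univ _)
  intro α _ hα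
  simpa using hα

theorem hom_induction {p : M → Prop} (h0 : ∀ α, ∀ m ∈ ℳ α, p m)
    (hadd : ∀ m n, p m → p n → p (m + n)) (m : M) : p m := by
  rw [← part_add ℳ m]
  exact hadd _ _ (h0 _ _ (part_mem ℳ 0 m)) (h0 _ _ (part_mem ℳ 1 m))

theorem hom_ext {N : Type*} [AddCommGroup N] {f g : M →+ N} (h : ∀ α, ∀ m ∈ ℳ α, f m = g m) :
    f = g := by
  ext m
  refine hom_induction ℳ (p := fun m => f m = g m) h ?_ m
  intro a b ha hb
  rw [map_add, map_add, ha, hb]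

end Part

/-! ## Endomorphisms of a graded group and their super bracket -/

section Endo

variable {M : Type*} [AddCommGroup M] (ℳ : ZMod 2 → AddSubgroup M)

theorem end_add_apply (f g : AddMonoid.End M) (m : M) : (f + g) m = f m + g m := rfl

theorem end_neg_apply (f : AddMonoid.End M) (m : M) : (-f) m = -f m := rfl

theorem end_sub_apply (f g : AddMonoid.End M) (m : M) : (f - g) m = f m - g m := rfl

theorem end_mul_apply (f g : AddMonoid.End M) (m : M) : (f * g) m = f (g m) := rfl

theorem end_zsmul_apply (c : ℤ) (f : AddMonoid.End M) (m : M) : (c • f) m = c • f m := rfl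

theorem end_ext {f g : AddMonoid.End M} (h : ∀ m, f m = g m) : f = g := AddMonoidHom.ext h

/-- The additive endomorphisms that are homogeneous of degree `α`. -/
def endGrading (α : ZMod 2) : AddSubgroup (AddMonoid.End M) where
  carrier := {f | ∀ γ, ∀ m ∈ ℳ γ, f m ∈ ℳ (γ + α)}
  zero_mem' := fun γ _ _ => (ℳ (γ + α)).zero_mem
  add_mem' := fun hf hg γ m hm => (ℳ (γ + α)).add_mem (hf γ m hm) (hg γ m hm)
  neg_mem' := fun hf γ m hm => (ℳ (γ + α)).neg_mem (hf γ m hm)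

variable [DirectSum.Decomposition ℳ]

/-- The homogeneous component of degree `α` of an additive endomorphism. -/
def endPart (α : ZMod 2) : AddMonoid.End M →+ AddMonoid.End M :=
  AddMonoidHom.mk' (fun f => AddMonoidHom.mk' (fun m => ∑ γ, part ℳ (γ + α) (f (part ℳ γ m)))
    (by
      intro m n
      simp only [map_add, Finset.sum_add_distrib])) (by
    intro f g
    apply end_ext
    intro m
    change ∑ γ, part ℳ (γ + α) ((f + g) (part ℳ γ m)) =
      ∑ γ, part ℳ (γ + α) (f (part ℳ γ m)) + ∑ γ, part ℳ (γ + α) (g (part ℳ γ m))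
    simp only [end_add_apply, map_add, Finset.sum_add_distrib])

/-- The super commutator of additive endomorphisms: for homogeneous `f` and `g` it is
`f g - (-1) ^ (|f| |g|) g f`. -/
def sbr : AddMonoid.End M →+ AddMonoid.End M →+ AddMonoid.End M :=
  AddMonoidHom.mk' (fun f => AddMonoidHom.mk' (fun g =>
      f * g - ∑ α, ∑ β, sgn (α * β) • (endPart ℳ β g * endPart ℳ α f))
    (by
      intro g h
      simp only [sum_parity, map_add, mul_add, add_mul, zsmul_add]
      abel))
    (by
      intro f g
      apply AddMonoidHom.ext
      intro h
      simp only [sum_parity, map_add, mul_add, add_mul, zsmul_add, AddMonoidHom.mk'_apply,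
        AddMonoidHom.add_apply]
      abel)

theorem endPart_apply (α : ZMod 2) (f : AddMonoid.End M) (m : M) :
    endPart ℳ α f m = part ℳ α (f (part ℳ 0 m)) + part ℳ (1 + α) (f (part ℳ 1 m)) := by
  have h : endPart ℳ α f m = ∑ γ, part ℳ (γ + α) (f (part ℳ γ m)) := rfl
  rw [h, sum_parity, zero_add]

theorem endPart_mem (α : ZMod 2) (f : AddMonoid.End M) : endPart ℳ α f ∈ endGrading ℳ α := by
  intro γ m hm
  rw [endPart_apply]
  have h10 : (1 : ZMod 2) ≠ 0 := by decide
  rcases parity_cases γ with rfl | rfl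
  · have h1 : part ℳ 1 m = 0 := part_ne ℳ hm h10.symm
    simp only [h1, map_zero, add_zero, zero_add]
    exact part_mem ℳ α _
  · have h1 : part ℳ 0 m = 0 := part_ne ℳ hm h10
    simp only [h1, map_zero, zero_add]
    exact part_mem ℳ (1 + α) _

theorem endPart_add (f : AddMonoid.End M) : endPart ℳ 0 f + endPart ℳ 1 f = f := by
  apply AddMonoidHom.ext
  intro m
  change endPart ℳ 0 f m + endPart ℳ 1 f m = f m
  rw [endPart_apply, endPart_apply]
  simp only [add_zero, parity_one_add_one]
  have h0 := part_add ℳ (f (part ℳ 0 m))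
  have h1 := part_add ℳ (f (part ℳ 1 m))
  have h2 : f m = f (part ℳ 0 m) + f (part ℳ 1 m) := by rw [← map_add, part_add]
  rw [h2]
  conv_rhs => rw [← h0, ← h1]
  abel

theorem endPart_same {α : ZMod 2} {f : AddMonoid.End M} (hf : f ∈ endGrading ℳ α) :
    endPart ℳ α f = f := by
  apply AddMonoidHom.ext
  intro m
  change endPart ℳ α f m = f m
  have h0 := hf 0 _ (part_mem ℳ 0 m)
  rw [zero_add] at h0
  rw [endPart_apply, part_same ℳ h0, part_same ℳ (hf 1 _ (part_mem ℳ 1 m)), ← map_add, part_add]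

theorem endPart_ne {α β : ZMod 2} {f : AddMonoid.End M} (hf : f ∈ endGrading ℳ α) (h : α ≠ β) :
    endPart ℳ β f = 0 := by
  apply AddMonoidHom.ext
  intro m
  change endPart ℳ β f m = 0
  have h0 := hf 0 _ (part_mem ℳ 0 m)
  rw [zero_add] at h0
  rw [endPart_apply, part_ne ℳ h0 h,
    part_ne ℳ (hf 1 _ (part_mem ℳ 1 m)) (fun e => h (add_left_cancel e)), add_zero]

theorem sbr_hom {α β : ZMod 2} {f g : AddMonoid.End M} (hf : f ∈ endGrading ℳ α)
    (hg : g ∈ endGrading ℳ β) : sbr ℳ f g = f * g - sgn (α * β) • (g * f) := by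
  have h : sbr ℳ f g
      = f * g - ∑ α, ∑ β, sgn (α * β) • (endPart ℳ β g * endPart ℳ α f) := rfl
  rw [h, Finset.sum_eq_single α, Finset.sum_eq_single β, endPart_same ℳ hf, endPart_same ℳ hg]
  · intro b _ hb
    rw [endPart_ne ℳ hg hb.symm, zero_mul, zsmul_zero]
  · simp
  · intro a _ ha
    apply Finset.sum_eq_zero
    intro b _
    rw [endPart_ne ℳ hf ha.symm, mul_zero, zsmul_zero]
  · simp

/-- The grading of a graded subgroup of endomorphisms. -/
def subGrading (L : AddSubgroup (AddMonoid.End M)) (α : ZMod 2) : AddSubgroup L :=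
  (endGrading ℳ α).addSubgroupOf L

/-- A subgroup of endomorphisms that is closed under taking homogeneous components is graded. -/
@[reducible] def subDecomposition (L : AddSubgroup (AddMonoid.End M))
    (hL : ∀ α, ∀ f ∈ L, endPart ℳ α f ∈ L) : DirectSum.Decomposition (subGrading ℳ L) :=
  decompositionOfProj (subGrading ℳ L)
    (fun α => ((endPart ℳ α).comp L.subtype).codRestrict L (fun x => hL α x x.2))
    (fun α _ => endPart_mem ℳ α _) (fun _ => Subtype.ext (endPart_add ℳ _))
    (fun _ _ _ hf h => Subtype.ext (endPart_ne ℳ hf h))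

/-- `D` is a subalgebra of the Lie superalgebra of endomorphisms of `M`: a graded submodule closed
under the super bracket. Here `lam` is the left action of the scalars on `M`, so that
`lam c * f` is the endomorphism `c f`. -/
structure IsSubalgebra {C : Type*} (lam : C → AddMonoid.End M) (D : AddSubgroup (AddMonoid.End M)) :
    Prop where
  part_mem : ∀ α, ∀ f ∈ D, endPart ℳ α f ∈ D
  smul_mem : ∀ c, ∀ f ∈ D, lam c * f ∈ D
  bracket_mem : ∀ f ∈ D, ∀ g ∈ D, sbr ℳ f g ∈ D

/-- `B` is the semidirect product of its ideal `J` and its subalgebra `D`: the sum `J + D` is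
direct and equals `B`. -/
structure IsSemidirect {C : Type*} (lam : C → AddMonoid.End M)
    (B J D : AddSubgroup (AddMonoid.End M)) : Prop where
  isSubalgebra_total : IsSubalgebra ℳ lam B
  isSubalgebra_left : IsSubalgebra ℳ lam J
  isSubalgebra_right : IsSubalgebra ℳ lam D
  ideal : ∀ f ∈ B, ∀ g ∈ J, sbr ℳ f g ∈ J
  inf_eq : J ⊓ D = ⊥
  sup_eq : J ⊔ D = B

/-- An isomorphism of Lie superalgebras over `C` between two subalgebras of endomorphisms. -/
structure IsLieIso {C V : Type*} [AddCommGroup V] (𝒱 : ZMod 2 → AddSubgroup V)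
    [DirectSum.Decomposition 𝒱] (lam : C → AddMonoid.End M) (mu : C → AddMonoid.End V)
    (B : AddSubgroup (AddMonoid.End M)) (D : AddSubgroup (AddMonoid.End V)) (φ : B →+ D) :
    Prop where
  bijective : Function.Bijective φ
  even : ∀ α, ∀ f : B, (f : AddMonoid.End M) ∈ endGrading ℳ α →
    (φ f : AddMonoid.End V) ∈ endGrading 𝒱 α
  map_smul : ∀ c, ∀ f g : B, (g : AddMonoid.End M) = lam c * f →
    (φ g : AddMonoid.End V) = mu c * φ f
  map_bracket : ∀ f g h : B, (h : AddMonoid.End M) = sbr ℳ f g →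
    (φ h : AddMonoid.End V) = sbr 𝒱 (φ f : AddMonoid.End V) (φ g)

end Endo

/-! ## Derivations of a superalgebra -/

section Derivations

variable {C V : Type*} [AddCommGroup V] (𝒱 : ZMod 2 → AddSubgroup V) (rho : C → AddMonoid.End V)
  (mul : V →+ V →+ V)

/-- The derivations of degree `α` of the superalgebra `V` with multiplication `mul`. Linearity is
linearity for the right action `rho` of the scalars. -/
def derPiece (α : ZMod 2) : AddSubgroup (AddMonoid.End V) where
  carrier := {d | d ∈ endGrading 𝒱 α ∧ (∀ c v, d (rho c v) = rho c (d v)) ∧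
    ∀ β, ∀ x ∈ 𝒱 β, ∀ y, d (mul x y) = mul (d x) y + sgn (α * β) • mul x (d y)}
  zero_mem' := by
    refine ⟨(endGrading 𝒱 α).zero_mem, fun c v => ?_, fun β x _ y => ?_⟩ <;>
      simp only [AddMonoid.End.zero_apply, map_zero, AddMonoidHom.zero_apply, smul_zero, add_zero]
  add_mem' := by
    rintro d e ⟨hd, hd1, hd2⟩ ⟨he, he1, he2⟩
    refine ⟨add_mem hd he, fun c v => ?_, fun β x hx y => ?_⟩
    · simp only [end_add_apply, map_add, hd1, he1]
    · simp only [end_add_apply, map_add, hd2 β x hx, he2 β x hx, AddMonoidHom.add_apply,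
        smul_add]
      abel
  neg_mem' := by
    rintro d ⟨hd, hd1, hd2⟩
    refine ⟨neg_mem hd, fun c v => ?_, fun β x hx y => ?_⟩
    · simp only [end_neg_apply, map_neg, hd1]
    · simp only [end_neg_apply, map_neg, hd2 β x hx, AddMonoidHom.neg_apply, smul_neg]
      abel

/-- All derivations: the sum of the even and the odd ones. -/
def der : AddSubgroup (AddMonoid.End V) := derPiece 𝒱 rho mul 0 ⊔ derPiece 𝒱 rho mul 1

/-- The inner derivations `x ↦ (y ↦ x y)` for `x` in `U`. -/
def adOf (U : AddSubgroup V) : AddSubgroup (AddMonoid.End V) :=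
  U.map (mul : V →+ AddMonoid.End V)

/-- The locally inner derivations: on each finite set they agree with an inner derivation. -/
def adLoc : AddSubgroup (AddMonoid.End V) where
  carrier := {d | d ∈ der 𝒱 rho mul ∧ ∀ F : Finset V, ∃ z, ∀ x ∈ F, d x = mul z x}
  zero_mem' := ⟨zero_mem _, fun F => ⟨0, fun x _ => by simp⟩⟩
  add_mem' := by
    rintro d e ⟨hd, hd1⟩ ⟨he, he1⟩
    refine ⟨add_mem hd he, fun F => ?_⟩
    obtain ⟨z, hz⟩ := hd1 F
    obtain ⟨w, hw⟩ := he1 F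
    refine ⟨z + w, fun x hx => ?_⟩
    simp only [end_add_apply, map_add, AddMonoidHom.add_apply, hz x hx, hw x hx]
  neg_mem' := by
    rintro d ⟨hd, hd1⟩
    refine ⟨neg_mem hd, fun F => ?_⟩
    obtain ⟨z, hz⟩ := hd1 F
    refine ⟨-z, fun x hx => ?_⟩
    rw [map_neg, AddMonoidHom.neg_apply, ← hz x hx]
    rfl

end Derivations

/-! ## Superrings, supermodules, quadratic forms -/

open MulOpposite

/-- Supercommutativity of a graded ring. -/
class IsSupercommutative {A : Type*} [Ring A] (𝒜 : ZMod 2 → AddSubgroup A) : Prop where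
  mul_comm : ∀ {α β : ZMod 2} {a b : A}, a ∈ 𝒜 α → b ∈ 𝒜 β → a * b = sgn (α * β) • (b * a)

/-- For a supercommutative superring `A`, the structure of a superextension of the superring `K`
is given by its structure homomorphism `c ↦ c 1`, a ring homomorphism preserving parities. -/
def IsSuperextension {K A : Type*} [Ring K] [Ring A] (𝒦 : ZMod 2 → AddSubgroup K)
    (𝒜 : ZMod 2 → AddSubgroup A) [IsSupercommutative 𝒜] (f : K →+* A) : Prop :=
  ∀ α, ∀ c ∈ 𝒦 α, f c ∈ 𝒜 α

/-- A supermodule: a bimodule with a compatible grading such that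
`a m = (-1) ^ (|a| |m|) m a`. The right action is written `op a • m`. -/
class IsSupermodule {A M : Type*} [Ring A] [AddCommGroup M] [Module A M] [Module Aᵐᵒᵖ M]
    (𝒜 : ZMod 2 → AddSubgroup A) (ℳ : ZMod 2 → AddSubgroup M) : Prop where
  smul_mem : ∀ {α β : ZMod 2} {a : A} {m : M}, a ∈ 𝒜 α → m ∈ ℳ β → a • m ∈ ℳ (α + β)
  smul_eq : ∀ {α β : ZMod 2} {a : A} {m : M}, a ∈ 𝒜 α → m ∈ ℳ β →
    a • m = sgn (α * β) • (op a • m)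

/-- A quadratic form on a supermodule: an even, supersymmetric, bilinear form. -/
structure QuadForm {A M : Type*} [Ring A] [AddCommGroup M] [Module A M] [Module Aᵐᵒᵖ M]
    (𝒜 : ZMod 2 → AddSubgroup A) (ℳ : ZMod 2 → AddSubgroup M) where
  form : M →+ M →+ A
  balanced : ∀ (m n : M) (a : A), form (op a • m) n = form m (a • n)
  linear : ∀ (m n : M) (a : A), form m (op a • n) = form m n * a
  degree : ∀ {α β : ZMod 2} {m n : M}, m ∈ ℳ α → n ∈ ℳ β → form m n ∈ 𝒜 (α + β)
  symm : ∀ {α β : ZMod 2} {m n : M}, m ∈ ℳ α → n ∈ ℳ β → form m n = sgn (α * β) • form n m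

/-- Left multiplication by a scalar, as an endomorphism (the endomorphism `a Id`). -/
def mulL {A : Type*} (M : Type*) [Ring A] [AddCommGroup M] [Module A M] (a : A) :
    AddMonoid.End M := Module.toAddMonoidEnd A M a

/-- Right multiplication by a scalar, as an additive endomorphism. -/
def mulR {A : Type*} (M : Type*) [Ring A] [AddCommGroup M] [Module Aᵐᵒᵖ M] (a : A) :
    AddMonoid.End M := Module.toAddMonoidEnd Aᵐᵒᵖ M (op a)

/-! ### The hyperbolic superspace and orthogonal sums -/

section Hyperbolic

variable {A : Type*} [Ring A] (𝒜 : ZMod 2 → AddSubgroup A)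

/-- The hyperbolic superspace `H(I; A)`: the free module on the basis of the `h i = inl i` and the
`h (-i) = inr i`. -/
abbrev Hyp (I A : Type*) [Ring A] : Type _ := (I ⊕ I) →₀ A

/-- The grading of `H(I; A)` for which all basis vectors are even. -/
def hypGrading (I : Type*) (α : ZMod 2) : AddSubgroup (Hyp I A) where
  carrier := {x | ∀ s, x s ∈ 𝒜 α}
  zero_mem' := fun _ => (𝒜 α).zero_mem
  add_mem' := fun hx hy s => (𝒜 α).add_mem (hx s) (hy s)
  neg_mem' := fun hx s => (𝒜 α).neg_mem (hx s)

instance (I : Type*) [DirectSum.Decomposition 𝒜] :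
    DirectSum.Decomposition (hypGrading 𝒜 I) :=
  decompositionOfProj _ (fun α => Finsupp.mapRange.addMonoidHom (part 𝒜 α))
    (fun α x s => by simpa using part_mem 𝒜 α (x s))
    (fun x => by ext s; simpa using part_add 𝒜 (x s))
    (fun α β x hx h => by ext s; simpa using part_ne 𝒜 (hx s) h)

instance (I : Type*) [GradedRing 𝒜] [IsSupercommutative 𝒜] :
    IsSupermodule 𝒜 (hypGrading 𝒜 I) where
  smul_mem := fun ha hm s => by
    simpa using SetLike.GradedMul.mul_mem ha (hm s)
  smul_eq := fun ha hm => by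
    ext s
    simpa using IsSupercommutative.mul_comm ha (hm s)

/-- The form `q_I` on `H(I; A)`: it pairs `h i` with `h (-i)`. -/
def hypForm (I : Type*) [GradedRing 𝒜] [IsSupercommutative 𝒜] :
    QuadForm 𝒜 (hypGrading 𝒜 I) where
  form := AddMonoidHom.mk' (fun x => AddMonoidHom.mk' (fun y => x.sum fun s a => a * y s.swap)
      (by
        intro y z
        simp only [Finsupp.add_apply, mul_add, Finsupp.sum_add]))
    (by
      intro x y
      apply AddMonoidHom.ext
      intro z
      classical
      simp only [AddMonoidHom.mk'_apply, AddMonoidHom.add_apply]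
      exact Finsupp.sum_add_index' (by simp) (by simp [add_mul]))
  balanced := fun x y a => by
    simp only [AddMonoidHom.mk'_apply]
    rw [Finsupp.sum_smul_index' (by simp)]
    simp [mul_assoc]
  linear := fun x y a => by
    simp [Finsupp.sum_mul, mul_assoc]
  degree := fun hm hn => by
    simp only [AddMonoidHom.mk'_apply]
    exact sum_mem fun s _ => SetLike.GradedMul.mul_mem (hm s) (hn _)
  symm := fun {α β x y} hx hy => by
    classical
    simp only [AddMonoidHom.mk'_apply]
    have key : ∀ (x y : Hyp I A), (x.sum fun s a => a * y s.swap)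
        = ∑ s ∈ x.support ∪ y.support.image Sum.swap, x s * y s.swap := by
      intro x y
      apply Finset.sum_subset Finset.subset_union_left
      intro s _ hs
      simp only [Finsupp.notMem_support_iff.mp hs, zero_mul]
    rw [key x y, key y x, Finset.smul_sum]
    refine Finset.sum_nbij' Sum.swap Sum.swap ?_ ?_ ?_ ?_ ?_
    · intro s hs
      simp only [Finset.mem_union, Finset.mem_image] at hs ⊢
      rcases hs with h | ⟨t, ht, rfl⟩
      · exact Or.inr ⟨s, h, rfl⟩
      · exact Or.inl (by simpa using ht)
    · intro s hs
      simp only [Finset.mem_union, Finset.mem_image] at hs ⊢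
      rcases hs with h | ⟨t, ht, rfl⟩
      · exact Or.inr ⟨s, h, rfl⟩
      · exact Or.inl (by simpa using ht)
    · intro s _; simp
    · intro s _; simp
    · intro s _
      rw [Sum.swap_swap]
      exact IsSupercommutative.mul_comm (hx s) (hy _)

end Hyperbolic

section Orthogonal

variable {A M N : Type*} [Ring A] [AddCommGroup M] [Module A M] [Module Aᵐᵒᵖ M]
  [AddCommGroup N] [Module A N] [Module Aᵐᵒᵖ N] {𝒜 : ZMod 2 → AddSubgroup A}
  {ℳ : ZMod 2 → AddSubgroup M} {𝒩 : ZMod 2 → AddSubgroup N}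

/-- The grading of a direct sum. -/
def prodGrading (ℳ : ZMod 2 → AddSubgroup M) (𝒩 : ZMod 2 → AddSubgroup N) (α : ZMod 2) :
    AddSubgroup (M × N) := (ℳ α).prod (𝒩 α)

instance [DirectSum.Decomposition ℳ] [DirectSum.Decomposition 𝒩] :
    DirectSum.Decomposition (prodGrading ℳ 𝒩) :=
  decompositionOfProj _ (fun α => (part ℳ α).prodMap (part 𝒩 α))
    (fun α x => ⟨part_mem ℳ α x.1, part_mem 𝒩 α x.2⟩)
    (fun x => Prod.ext (part_add ℳ x.1) (part_add 𝒩 x.2))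
    (fun _ _ _ hx h => Prod.ext (part_ne ℳ hx.1 h) (part_ne 𝒩 hx.2 h))

instance [IsSupermodule 𝒜 ℳ] [IsSupermodule 𝒜 𝒩] : IsSupermodule 𝒜 (prodGrading ℳ 𝒩) where
  smul_mem := fun ha hm =>
    ⟨IsSupermodule.smul_mem ha hm.1, IsSupermodule.smul_mem ha hm.2⟩
  smul_eq := fun ha hm =>
    Prod.ext (IsSupermodule.smul_eq ha hm.1) (IsSupermodule.smul_eq ha hm.2)

/-- The orthogonal sum of two quadratic forms. -/
def orthSum (q : QuadForm 𝒜 ℳ) (r : QuadForm 𝒜 𝒩) : QuadForm 𝒜 (prodGrading ℳ 𝒩) where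
  form := AddMonoidHom.mk' (fun x => AddMonoidHom.mk' (fun y => q.form x.1 y.1 + r.form x.2 y.2)
      (by intro y z; simp only [Prod.fst_add, Prod.snd_add, map_add]; abel))
    (by
      intro x y
      apply AddMonoidHom.ext
      intro z
      simp only [AddMonoidHom.mk'_apply, AddMonoidHom.add_apply, Prod.fst_add, Prod.snd_add,
        map_add]
      abel)
  balanced := fun x y a => by simp [q.balanced, r.balanced]
  linear := fun x y a => by simp [q.linear, r.linear, add_mul]
  degree := fun hm hn => add_mem (q.degree hm.1 hn.1) (r.degree hm.2 hn.2)
  symm := fun hm hn => by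
    simp only [AddMonoidHom.mk'_apply, smul_add]
    rw [q.symm hm.1 hn.1, r.symm hm.2 hn.2]

end Orthogonal

/-! ## Orthosymplectic superalgebras -/

section Orthosymplectic

variable {A M : Type*} [Ring A] [AddCommGroup M] [Module A M] [Module Aᵐᵒᵖ M]
  {𝒜 : ZMod 2 → AddSubgroup A} {ℳ : ZMod 2 → AddSubgroup M} [DirectSum.Decomposition ℳ]

/-- The endomorphism `E m n`, which for homogeneous `n` and `p` is given by
`E m n p = m q(n, p) - (-1) ^ (|n| |p|) q(m, p) n`. -/
def opE (q : QuadForm 𝒜 ℳ) (m n : M) : AddMonoid.End M :=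
  AddMonoidHom.mk' (fun p => op (q.form n p) • m -
      ∑ β, ∑ γ, sgn (β * γ) • (q.form m (part ℳ γ p) • part ℳ β n))
    (by
      intro p r
      simp only [sum_parity, map_add, op_add, add_smul, smul_add]
      abel)

/-- The elementary orthosymplectic Lie superalgebra: the additive span of all `E m n`. -/
def eosp (q : QuadForm 𝒜 ℳ) : AddSubgroup (AddMonoid.End M) :=
  AddSubgroup.closure {x | ∃ m n, x = opE q m n}

theorem opE_hom (q : QuadForm 𝒜 ℳ) (m : M) {n p : M} {β γ : ZMod 2} (hn : n ∈ ℳ β)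
    (hp : p ∈ ℳ γ) : opE q m n p = op (q.form n p) • m - sgn (β * γ) • (q.form m p • n) := by
  have h : opE q m n p = op (q.form n p) • m -
      ∑ β, ∑ γ, sgn (β * γ) • (q.form m (part ℳ γ p) • part ℳ β n) := rfl
  rw [h, Finset.sum_eq_single β, Finset.sum_eq_single γ, part_same ℳ hn, part_same ℳ hp]
  · intro c _ hc
    rw [part_ne ℳ hp hc.symm, map_zero, zero_smul, smul_zero]
  · simp
  · intro b _ hb
    apply Finset.sum_eq_zero
    intro c _
    rw [part_ne ℳ hn hb.symm, smul_zero, smul_zero]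
  · simp

theorem opE_add_left (q : QuadForm 𝒜 ℳ) (m r n : M) :
    opE q (m + r) n = opE q m n + opE q r n := by
  apply end_ext
  intro p
  change op (q.form n p) • (m + r) -
      ∑ β, ∑ γ, sgn (β * γ) • (q.form (m + r) (part ℳ γ p) • part ℳ β n)
    = op (q.form n p) • m - ∑ β, ∑ γ, sgn (β * γ) • (q.form m (part ℳ γ p) • part ℳ β n)
      + (op (q.form n p) • r - ∑ β, ∑ γ, sgn (β * γ) • (q.form r (part ℳ γ p) • part ℳ β n))
  simp only [map_add, AddMonoidHom.add_apply, smul_add, add_smul, Finset.sum_add_distrib]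
  abel

theorem opE_add_right (q : QuadForm 𝒜 ℳ) (m n r : M) :
    opE q m (n + r) = opE q m n + opE q m r := by
  apply end_ext
  intro p
  change op (q.form (n + r) p) • m -
      ∑ β, ∑ γ, sgn (β * γ) • (q.form m (part ℳ γ p) • part ℳ β (n + r))
    = op (q.form n p) • m - ∑ β, ∑ γ, sgn (β * γ) • (q.form m (part ℳ γ p) • part ℳ β n)
      + (op (q.form r p) • m - ∑ β, ∑ γ, sgn (β * γ) • (q.form m (part ℳ γ p) • part ℳ β r))
  simp only [map_add, AddMonoidHom.add_apply, op_add, smul_add, add_smul, Finset.sum_add_distrib]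
  abel

theorem opE_mem (q : QuadForm 𝒜 ℳ) (m n : M) : opE q m n ∈ eosp q :=
  AddSubgroup.subset_closure ⟨m, n, rfl⟩

/-- To check an additive statement on `eosp q`, it suffices to consider homogeneous `E m n`. -/
theorem eosp_induction (q : QuadForm 𝒜 ℳ) {p : AddMonoid.End M → Prop}
    (h0 : p 0) (hadd : ∀ x y, p x → p y → p (x + y)) (hneg : ∀ x, p x → p (-x))
    (hE : ∀ α β, ∀ m ∈ ℳ α, ∀ n ∈ ℳ β, p (opE q m n)) {x : AddMonoid.End M}
    (hx : x ∈ eosp q) : p x := by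
  refine AddSubgroup.closure_induction (p := fun x _ => p x) ?_ h0
    (fun x y _ _ => hadd x y) (fun x _ => hneg x) hx
  rintro _ ⟨m, n, rfl⟩
  refine hom_induction ℳ (p := fun m => p (opE q m n)) ?_ ?_ m
  · intro α m hm
    refine hom_induction ℳ (p := fun n => p (opE q m n)) ?_ ?_ n
    · intro β n hn
      exact hE α β m hm n hn
    · intro n r hn hr
      rw [opE_add_right]
      exact hadd _ _ hn hr
  · intro m r hm hr
    rw [opE_add_left]
    exact hadd _ _ hm hr

/-! ### Closure properties of `eosp q` -/

theorem sgn_add (α β : ZMod 2) : sgn (α + β) = sgn α * sgn β := by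
  rcases parity_cases α with rfl | rfl <;> rcases parity_cases β with rfl | rfl <;> simp

variable [GradedRing 𝒜] [IsSupercommutative 𝒜] [SMulCommClass A Aᵐᵒᵖ M] [IsSupermodule 𝒜 ℳ]

theorem opE_apply (q : QuadForm 𝒜 ℳ) {m n : M} {α β : ZMod 2} (hm : m ∈ ℳ α) (hn : n ∈ ℳ β)
    (p : M) : opE q m n p = op (q.form n p) • m - sgn (α * β) • (op (q.form m p) • n) := by
  refine hom_induction ℳ (p := fun p => opE q m n p
    = op (q.form n p) • m - sgn (α * β) • (op (q.form m p) • n)) ?_ ?_ p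
  · intro γ p hp
    rw [opE_hom q m hn hp, IsSupermodule.smul_eq (q.degree hm hp) hn]
    rcases parity_cases α with rfl | rfl <;> rcases parity_cases β with rfl | rfl <;>
      rcases parity_cases γ with rfl | rfl <;> simp
  · intro p r hp hr
    simp only [map_add, hp, hr, op_add, add_smul, smul_add]
    abel

theorem opE_linear (q : QuadForm 𝒜 ℳ) {m n : M} {α β : ZMod 2} (hm : m ∈ ℳ α) (hn : n ∈ ℳ β)
    (a : A) (p : M) : opE q m n (op a • p) = op a • opE q m n p := by
  rw [opE_apply q hm hn, opE_apply q hm hn, q.linear, q.linear, smul_sub, op_mul, op_mul,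
    mul_smul, mul_smul, smul_comm (op a) (sgn (α * β))]

theorem op_smul_mem {α β : ZMod 2} {a : A} {m : M} (ha : a ∈ 𝒜 α) (hm : m ∈ ℳ β) :
    op a • m ∈ ℳ (α + β) := by
  have h := IsSupermodule.smul_mem (𝒜 := 𝒜) (ℳ := ℳ) ha hm
  rw [IsSupermodule.smul_eq (𝒜 := 𝒜) (ℳ := ℳ) ha hm] at h
  rcases parity_cases (α * β) with h1 | h1
  · simpa [h1] using h
  · simpa [h1] using h

theorem opE_mem_grading (q : QuadForm 𝒜 ℳ) {m n : M} {α β : ZMod 2} (hm : m ∈ ℳ α)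
    (hn : n ∈ ℳ β) : opE q m n ∈ endGrading ℳ (α + β) := by
  intro γ p hp
  rw [opE_apply q hm hn]
  have h1 := op_smul_mem (q.degree hn hp) hm
  have h2 := op_smul_mem (q.degree hm hp) hn
  have e1 : β + γ + α = γ + (α + β) := by ring
  have e2 : α + γ + β = γ + (α + β) := by ring
  rw [e1] at h1
  rw [e2] at h2
  exact sub_mem h1 (zsmul_mem h2 _)

theorem endPart_mem_eosp (q : QuadForm 𝒜 ℳ) (α : ZMod 2) {x : AddMonoid.End M}
    (hx : x ∈ eosp q) : endPart ℳ α x ∈ eosp q := by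
  refine eosp_induction q (p := fun x => endPart ℳ α x ∈ eosp q) ?_ ?_ ?_ ?_ hx
  · rw [map_zero]
    exact zero_mem _
  · intro x y hx hy
    rw [map_add]
    exact add_mem hx hy
  · intro x hx
    rw [map_neg]
    exact neg_mem hx
  · intro β γ m hm n hn
    have h := opE_mem_grading q hm hn
    by_cases hα : β + γ = α
    · subst hα
      rw [endPart_same ℳ h]
      exact opE_mem q m n
    · rw [endPart_ne ℳ h hα]
      exact zero_mem _

theorem opE_skew (q : QuadForm 𝒜 ℳ) {m n p : M} {α β γ : ZMod 2} (hm : m ∈ ℳ α)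
    (hn : n ∈ ℳ β) (hp : p ∈ ℳ γ) (r : M) :
    q.form (opE q m n p) r = -(sgn ((α + β) * γ) • q.form p (opE q m n r)) := by
  refine hom_induction ℳ (p := fun r => q.form (opE q m n p) r
    = -(sgn ((α + β) * γ) • q.form p (opE q m n r))) ?_ ?_ r
  · intro ε r hr
    rw [opE_apply q hm hn, opE_apply q hm hn, map_sub, map_sub, map_zsmul, map_zsmul,
      AddMonoidHom.sub_apply, AddMonoidHom.smul_apply, q.balanced, q.balanced,
      IsSupermodule.smul_eq (q.degree hn hp) hr, IsSupermodule.smul_eq (q.degree hm hp) hr,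
      map_zsmul, map_zsmul, q.linear, q.linear, q.linear, q.linear, q.symm hp hm, q.symm hp hn,
      smul_mul_assoc, smul_mul_assoc,
      IsSupercommutative.mul_comm (q.degree hm hp) (q.degree hn hr),
      IsSupercommutative.mul_comm (q.degree hn hp) (q.degree hm hr)]
    rcases parity_cases α with rfl | rfl <;> rcases parity_cases β with rfl | rfl <;>
      rcases parity_cases γ with rfl | rfl <;> rcases parity_cases ε with rfl | rfl <;>
      simp <;> abel
  · intro r s hr hs
    rw [map_add, hr, hs, map_add, map_add, smul_add]
    abel

theorem sbr_opE (q : QuadForm 𝒜 ℳ) {x : AddMonoid.End M} {δ : ZMod 2}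
    (hx : x ∈ endGrading ℳ δ) (hx1 : ∀ (a : A) m, x (op a • m) = op a • x m)
    (hx2 : ∀ γ, ∀ p ∈ ℳ γ, ∀ r, q.form (x p) r = -(sgn (δ * γ) • q.form p (x r)))
    {m n : M} {α β : ZMod 2} (hm : m ∈ ℳ α) (hn : n ∈ ℳ β) :
    sbr ℳ x (opE q m n) = opE q (x m) n + sgn (δ * α) • opE q m (x n) := by
  rw [sbr_hom ℳ hx (opE_mem_grading q hm hn)]
  apply end_ext
  intro p
  rw [end_sub_apply, end_add_apply, end_zsmul_apply, end_zsmul_apply, end_mul_apply, end_mul_apply,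
    opE_apply q hm hn, opE_apply q hm hn, opE_apply q (hx α m hm) hn, opE_apply q hm (hx β n hn),
    hx2 α m hm, hx2 β n hn, map_sub, map_zsmul, hx1, hx1]
  rcases parity_cases α with rfl | rfl <;> rcases parity_cases β with rfl | rfl <;>
    rcases parity_cases δ with rfl | rfl <;> simp <;> abel

theorem sbr_mem_eosp (q : QuadForm 𝒜 ℳ) {x y : AddMonoid.End M} (hx : x ∈ eosp q)
    (hy : y ∈ eosp q) : sbr ℳ x y ∈ eosp q := by
  refine eosp_induction q (p := fun x => sbr ℳ x y ∈ eosp q) ?_ ?_ ?_ ?_ hx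
  · rw [map_zero]
    exact zero_mem _
  · intro x y hx hy
    rw [map_add]
    exact add_mem hx hy
  · intro x hx
    rw [map_neg]
    exact neg_mem hx
  · intro γ δ p hp r hr
    refine eosp_induction q (p := fun y => sbr ℳ (opE q p r) y ∈ eosp q) ?_ ?_ ?_ ?_ hy
    · rw [map_zero]
      exact zero_mem _
    · intro x y hx hy
      rw [map_add]
      exact add_mem hx hy
    · intro x hx
      rw [map_neg]
      exact neg_mem hx
    · intro α β m hm n hn
      rw [sbr_opE q (opE_mem_grading q hp hr) (opE_linear q hp hr)
        (fun ε s hs t => opE_skew q hp hr hs t) hm hn]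
      exact add_mem (opE_mem q _ _) (zsmul_mem (opE_mem q _ _) _)

theorem mulL_mul_mem_eosp (q : QuadForm 𝒜 ℳ) (a : A) {x : AddMonoid.End M} (hx : x ∈ eosp q) :
    mulL M a * x ∈ eosp q := by
  refine eosp_induction q (p := fun x => mulL M a * x ∈ eosp q) ?_ ?_ ?_ ?_ hx
  · rw [mul_zero]
    exact zero_mem _
  · intro x y hx hy
    rw [mul_add]
    exact add_mem hx hy
  · intro x hx
    rw [mul_neg]
    exact neg_mem hx
  · intro α β m hm n hn
    refine hom_induction 𝒜 (p := fun a => mulL M a * opE q m n ∈ eosp q) ?_ ?_ a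
    · intro γ a ha
      have h : mulL M a * opE q m n = opE q (a • m) n := by
        apply end_ext
        intro p
        change a • opE q m n p = _
        refine hom_induction ℳ (p := fun p => a • opE q m n p = opE q (a • m) n p) ?_ ?_ p
        · intro δ p hp
          rw [opE_hom q _ hn hp, opE_hom q _ hn hp, smul_sub, smul_comm a (op _),
            smul_comm a (sgn _)]
          congr 2
          rw [← mul_smul, IsSupermodule.smul_eq ha hm, map_zsmul, AddMonoidHom.smul_apply,
            q.balanced, IsSupermodule.smul_eq ha hp, map_zsmul, q.linear,
            IsSupercommutative.mul_comm ha (q.degree hm hp), smul_smul]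
          congr 2
          rcases parity_cases α with rfl | rfl <;> rcases parity_cases γ with rfl | rfl <;>
            rcases parity_cases δ with rfl | rfl <;> simp
        · intro p r hp hr
          rw [map_add, map_add, smul_add, hp, hr]
      rw [h]
      exact opE_mem q _ _
    · intro a b ha hb
      have h : mulL M (a + b) = mulL M a + mulL M b := map_add (Module.toAddMonoidEnd A M) a b
      rw [h, add_mul]
      exact add_mem ha hb

theorem mul_mulL_mem_eosp (q : QuadForm 𝒜 ℳ) (a : A) {x : AddMonoid.End M} (hx : x ∈ eosp q) :
    x * mulL M a ∈ eosp q := by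
  refine eosp_induction q (p := fun x => x * mulL M a ∈ eosp q) ?_ ?_ ?_ ?_ hx
  · rw [zero_mul]
    exact zero_mem _
  · intro x y hx hy
    rw [add_mul]
    exact add_mem hx hy
  · intro x hx
    rw [neg_mul]
    exact neg_mem hx
  · intro α β m hm n hn
    refine hom_induction 𝒜 (p := fun a => opE q m n * mulL M a ∈ eosp q) ?_ ?_ a
    · intro γ a ha
      have h : opE q m n * mulL M a = sgn (γ * (α + β)) • (mulL M a * opE q m n) := by
        apply end_ext
        intro p
        change opE q m n (a • p) = sgn (γ * (α + β)) • (a • opE q m n p)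
        refine hom_induction ℳ
          (p := fun p => opE q m n (a • p) = sgn (γ * (α + β)) • (a • opE q m n p)) ?_ ?_ p
        · intro δ p hp
          rw [IsSupermodule.smul_eq ha hp, map_zsmul, opE_linear q hm hn,
            IsSupermodule.smul_eq ha (opE_mem_grading q hm hn δ p hp), smul_smul]
          congr 1
          rcases parity_cases α with rfl | rfl <;> rcases parity_cases β with rfl | rfl <;>
            rcases parity_cases γ with rfl | rfl <;> rcases parity_cases δ with rfl | rfl <;> simp
        · intro p r hp hr
          rw [map_add, smul_add, smul_add, map_add, hp, hr, smul_add]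
      rw [h]
      exact zsmul_mem (mulL_mul_mem_eosp q a (opE_mem q m n)) _
    · intro a b ha hb
      have h : mulL M (a + b) = mulL M a + mulL M b := map_add (Module.toAddMonoidEnd A M) a b
      rw [h, mul_add]
      exact add_mem ha hb

/-! ### `eosp q` as a Lie superalgebra -/

/-- The grading of the Lie superalgebra `eosp q`. -/
def eospGrading (q : QuadForm 𝒜 ℳ) : ZMod 2 → AddSubgroup (eosp q) := subGrading ℳ (eosp q)

instance (q : QuadForm 𝒜 ℳ) : DirectSum.Decomposition (eospGrading q) :=
  subDecomposition ℳ (eosp q) (fun α _ hx => endPart_mem_eosp q α hx)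

/-- The bracket of `eosp q`; `eospBr q x` is the endomorphism `ad x`. -/
def eospBr (q : QuadForm 𝒜 ℳ) : eosp q →+ eosp q →+ eosp q :=
  AddMonoidHom.mk' (fun x =>
      ((sbr ℳ (x : AddMonoid.End M)).comp (eosp q).subtype).codRestrict (eosp q)
        (fun y => sbr_mem_eosp q x.2 y.2))
    (by
      intro x y
      apply AddMonoidHom.ext
      intro z
      apply Subtype.ext
      change sbr ℳ ((x : AddMonoid.End M) + y) z = sbr ℳ (x : AddMonoid.End M) z + sbr ℳ y z
      rw [map_add, AddMonoidHom.add_apply])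

/-- The left action of scalars on `eosp q`: `(a x) (m) = a x(m)`. -/
def eospL (q : QuadForm 𝒜 ℳ) (a : A) : AddMonoid.End (eosp q) :=
  ((AddMonoidHom.mulLeft (mulL M a)).comp (eosp q).subtype).codRestrict (eosp q)
    (fun x => mulL_mul_mem_eosp q a x.2)

/-- The right action of scalars on `eosp q`: `(x a) (m) = x (a m)`. -/
def eospR (q : QuadForm 𝒜 ℳ) (a : A) : AddMonoid.End (eosp q) :=
  ((AddMonoidHom.mulRight (mulL M a)).comp (eosp q).subtype).codRestrict (eosp q)
    (fun x => mul_mulL_mem_eosp q a x.2)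


end Orthosymplectic

/-! ## The 3-grading of `eosp q_∞` and its outer derivations -/

section Infinity

variable {K A M : Type*} [Ring K] [Ring A] [AddCommGroup M] [Module A M] [Module Aᵐᵒᵖ M]
  {𝒜 : ZMod 2 → AddSubgroup A} {ℳ : ZMod 2 → AddSubgroup M} [GradedRing 𝒜]
  [IsSupercommutative 𝒜] [DirectSum.Decomposition ℳ]

/-- The form `q_∞`: the orthogonal sum of a hyperbolic superplane and `q`. -/
def qInf (q : QuadForm 𝒜 ℳ) : QuadForm 𝒜 (prodGrading (hypGrading 𝒜 Unit) ℳ) :=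
  orthSum (hypForm 𝒜 Unit) q

/-- The endomorphism of `H({∞}; A) ⊕ M` with coordinates `(a, m, n, x)`. With `h` and `h'` the basis
of `H({∞}; A)`, it is `E (a h) h' + E m h + E h' n + x`, that is, it maps `h b + h' c + p` to
`h (a b - q(m, p)) + h' (q(n, p) - a c) + (m c - n b + x p)`. -/
def coord (q : QuadForm 𝒜 ℳ) :
    A × M × M × AddMonoid.End M →+ AddMonoid.End (Hyp Unit A × M) :=
  AddMonoidHom.mk' (fun t => AddMonoidHom.mk' (fun v : Hyp Unit A × M =>
      ((Finsupp.single (Sum.inl ()) (t.1 * v.1 (Sum.inl ()) - q.form t.2.1 v.2) +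
        Finsupp.single (Sum.inr ()) (q.form t.2.2.1 v.2 - t.1 * v.1 (Sum.inr ())),
      op (v.1 (Sum.inr ())) • t.2.1 - op (v.1 (Sum.inl ())) • t.2.2.1 + t.2.2.2 v.2) :
        Hyp Unit A × M))
    (by
      intro v w
      refine Prod.ext ?_ ?_
      · simp only [Prod.fst_add, Prod.snd_add, Finsupp.add_apply, mul_add, map_add,
          Finsupp.single_add, Finsupp.single_sub]
        abel
      · simp only [Prod.fst_add, Prod.snd_add, Finsupp.add_apply, map_add, op_add, add_smul]
        abel))
    (by
      intro t s
      apply end_ext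
      intro v
      refine Prod.ext ?_ ?_
      · change Finsupp.single (Sum.inl ())
            ((t.1 + s.1) * v.1 (Sum.inl ()) - q.form (t.2.1 + s.2.1) v.2) +
          Finsupp.single (Sum.inr ())
            (q.form (t.2.2.1 + s.2.2.1) v.2 - (t.1 + s.1) * v.1 (Sum.inr ())) =
          Finsupp.single (Sum.inl ()) (t.1 * v.1 (Sum.inl ()) - q.form t.2.1 v.2) +
            Finsupp.single (Sum.inr ()) (q.form t.2.2.1 v.2 - t.1 * v.1 (Sum.inr ())) +
          (Finsupp.single (Sum.inl ()) (s.1 * v.1 (Sum.inl ()) - q.form s.2.1 v.2) +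
            Finsupp.single (Sum.inr ()) (q.form s.2.2.1 v.2 - s.1 * v.1 (Sum.inr ())))
        simp only [add_mul, map_add, AddMonoidHom.add_apply, Finsupp.single_add,
          Finsupp.single_sub]
        abel
      · change op (v.1 (Sum.inr ())) • (t.2.1 + s.2.1) -
            op (v.1 (Sum.inl ())) • (t.2.2.1 + s.2.2.1) + (t.2.2.2 v.2 + s.2.2.2 v.2) =
          op (v.1 (Sum.inr ())) • t.2.1 - op (v.1 (Sum.inl ())) • t.2.2.1 + t.2.2.2 v.2 +
          (op (v.1 (Sum.inr ())) • s.2.1 - op (v.1 (Sum.inl ())) • s.2.2.1 + s.2.2.2 v.2)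
        simp only [smul_add]
        abel)

/-- The endomorphisms `S` of `M` of degree `α`, linear over `K` (acting through `f`), with
`[S, A Id] ⊆ A Id`, `[S, q(m, n) Id] = (q(S m, n) + (-1) ^ (|m| |n|) q(S n, m)) Id` and
`[S, E] ⊆ E`. -/
def sPiece (f : K →+* A) (q : QuadForm 𝒜 ℳ) (E : AddSubgroup (AddMonoid.End M)) (α : ZMod 2) :
    AddSubgroup (AddMonoid.End M) where
  carrier := {S | S ∈ endGrading ℳ α ∧ (∀ c m, S (op (f c) • m) = op (f c) • S m) ∧
    (∀ a : A, ∃ b : A, sbr ℳ S (mulL M a) = mulL M b) ∧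
    (∀ β γ, ∀ m ∈ ℳ β, ∀ n ∈ ℳ γ, sbr ℳ S (mulL M (q.form m n)) =
      mulL M (q.form (S m) n + sgn (β * γ) • q.form (S n) m)) ∧
    ∀ x ∈ E, sbr ℳ S x ∈ E}
  zero_mem' := by
    have h0 : mulL M (0 : A) = 0 := map_zero (Module.toAddMonoidEnd A M)
    refine ⟨zero_mem _, fun c m => ?_, fun a => ⟨0, ?_⟩, fun β γ m _ n _ => ?_, fun x _ => ?_⟩
    · simp
    · rw [h0, map_zero, AddMonoidHom.zero_apply]
    · simp [h0]
    · rw [map_zero, AddMonoidHom.zero_apply]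
      exact zero_mem _
  add_mem' := by
    have ha : ∀ a b : A, mulL M (a + b) = mulL M a + mulL M b :=
      map_add (Module.toAddMonoidEnd A M)
    rintro S T ⟨hS, hS1, hS2, hS3, hS4⟩ ⟨hT, hT1, hT2, hT3, hT4⟩
    refine ⟨add_mem hS hT, fun c m => ?_, fun a => ?_, fun β γ m hm n hn => ?_, fun x hx => ?_⟩
    · rw [end_add_apply, end_add_apply, hS1, hT1, smul_add]
    · obtain ⟨b, hb⟩ := hS2 a
      obtain ⟨c, hc⟩ := hT2 a
      exact ⟨b + c, by rw [map_add, AddMonoidHom.add_apply, hb, hc, ha]⟩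
    · rw [map_add, AddMonoidHom.add_apply, hS3 β γ m hm n hn, hT3 β γ m hm n hn, ← ha]
      congr 1
      simp only [end_add_apply, map_add, AddMonoidHom.add_apply, smul_add]
      abel
    · rw [map_add, AddMonoidHom.add_apply]
      exact add_mem (hS4 x hx) (hT4 x hx)
  neg_mem' := by
    have ha : ∀ a : A, mulL M (-a) = -mulL M a := map_neg (Module.toAddMonoidEnd A M)
    rintro S ⟨hS, hS1, hS2, hS3, hS4⟩
    refine ⟨neg_mem hS, fun c m => ?_, fun a => ?_, fun β γ m hm n hn => ?_, fun x hx => ?_⟩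
    · rw [end_neg_apply, end_neg_apply, hS1, smul_neg]
    · obtain ⟨b, hb⟩ := hS2 a
      exact ⟨-b, by rw [map_neg, AddMonoidHom.neg_apply, hb, ha]⟩
    · rw [map_neg, AddMonoidHom.neg_apply, hS3 β γ m hm n hn, ← ha]
      congr 1
      simp only [end_neg_apply, map_neg, AddMonoidHom.neg_apply, smul_neg]
      abel
    · rw [map_neg, AddMonoidHom.neg_apply]
      exact neg_mem (hS4 x hx)

/-- The Lie superalgebra `S_E`: the sum of its even and its odd part. -/
def sE (f : K →+* A) (q : QuadForm 𝒜 ℳ) (E : AddSubgroup (AddMonoid.End M)) :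
    AddSubgroup (AddMonoid.End M) := sPiece f q E 0 ⊔ sPiece f q E 1

variable [SMulCommClass A Aᵐᵒᵖ M] [IsSupermodule 𝒜 ℳ]

/-- `d` is the endomorphism `d_{S,0}` of `eosp q_∞`, which in coordinates is given by
`(a, m, n, x) ↦ ([S, a Id], S m, S n, [S, x])`, where `[S, a Id] = b Id` is identified with `b`. -/
def IsOuter (q : QuadForm 𝒜 ℳ) (S : AddMonoid.End M) (d : AddMonoid.End (eosp (qInf q))) : Prop :=
  ∀ (a : A) (m n : M), ∀ x ∈ eosp q, ∀ y : eosp (qInf q),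
    (y : AddMonoid.End (Hyp Unit A × M)) = coord q (a, m, n, x) →
    ∃ b : A, sbr ℳ S (mulL M a) = mulL M b ∧
      (d y : AddMonoid.End (Hyp Unit A × M)) = coord q (b, S m, S n, sbr ℳ S x)

/-- The group of all `d_{S,0}` with `S` in `T`. -/
def outer (q : QuadForm 𝒜 ℳ) (T : AddSubgroup (AddMonoid.End M)) :
    AddSubgroup (AddMonoid.End (eosp (qInf q))) where
  carrier := {d | ∃ S ∈ T, IsOuter q S d}
  zero_mem' := by
    refine ⟨0, zero_mem _, fun a m n x _ y _ => ⟨0, ?_, ?_⟩⟩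
    · rw [map_zero, AddMonoidHom.zero_apply]
      exact (map_zero (Module.toAddMonoidEnd A M)).symm
    · have h : ((0, 0, 0, 0) : A × M × M × AddMonoid.End M) = 0 := rfl
      rw [map_zero, AddMonoidHom.zero_apply, AddMonoid.End.zero_apply, AddMonoid.End.zero_apply,
        AddMonoid.End.zero_apply, h, map_zero]
      rfl
  add_mem' := by
    rintro d e ⟨S, hS, hd⟩ ⟨T, hT, he⟩
    refine ⟨S + T, add_mem hS hT, fun a m n x hx y hy => ?_⟩
    obtain ⟨b, hb, hb1⟩ := hd a m n x hx y hy
    obtain ⟨c, hc, hc1⟩ := he a m n x hx y hy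
    refine ⟨b + c, ?_, ?_⟩
    · rw [map_add, AddMonoidHom.add_apply, hb, hc]
      exact (map_add (Module.toAddMonoidEnd A M) b c).symm
    · rw [end_add_apply, AddSubgroup.coe_add, hb1, hc1, ← map_add, map_add (sbr ℳ) S T]
      rfl
  neg_mem' := by
    rintro d ⟨S, hS, hd⟩
    refine ⟨-S, neg_mem hS, fun a m n x hx y hy => ?_⟩
    obtain ⟨b, hb, hb1⟩ := hd a m n x hx y hy
    refine ⟨-b, ?_, ?_⟩
    · rw [map_neg, AddMonoidHom.neg_apply, hb]
      exact (map_neg (Module.toAddMonoidEnd A M) b).symm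
    · rw [end_neg_apply, AddSubgroup.coe_neg, hb1, ← map_neg, map_neg (sbr ℳ) S]
      rfl

/-- The copy of `E = eosp q` in `eosp q_∞`: the elements with coordinates `(0, 0, 0, x)`. -/
def eospIn (q : QuadForm 𝒜 ℳ) : AddSubgroup (eosp (qInf q)) where
  carrier := {y | ∃ x ∈ eosp q, (y : AddMonoid.End (Hyp Unit A × M)) = coord q (0, 0, 0, x)}
  zero_mem' := ⟨0, zero_mem _, (map_zero (coord q)).symm⟩
  add_mem' := by
    rintro y z ⟨x, hx, hy⟩ ⟨w, hw, hz⟩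
    refine ⟨x + w, add_mem hx hw, ?_⟩
    rw [AddSubgroup.coe_add, hy, hz, ← map_add]
    simp
  neg_mem' := by
    rintro y ⟨x, hx, hy⟩
    refine ⟨-x, neg_mem hx, ?_⟩
    rw [AddSubgroup.coe_neg, hy, ← map_neg]
    simp

/-- The `K`-derivations of the Lie superalgebra `eosp q`, where `K` acts through `f`. -/
def derEosp (f : K →+* A) (q : QuadForm 𝒜 ℳ) : AddSubgroup (AddMonoid.End (eosp q)) :=
  der (eospGrading q) (fun c => eospR q (f c)) (eospBr q)

/-- The locally inner `K`-derivations of `eosp q`. -/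
def adLocEosp (f : K →+* A) (q : QuadForm 𝒜 ℳ) : AddSubgroup (AddMonoid.End (eosp q)) :=
  adLoc (eospGrading q) (fun c => eospR q (f c)) (eospBr q)

end Infinity

/-- The `K`-derivations of the superring `A`, where `K` acts through `f`. -/
def derRing {K A : Type*} [Ring K] [Ring A] (𝒜 : ZMod 2 → AddSubgroup A) (f : K →+* A) :
    AddSubgroup (AddMonoid.End A) :=
  der 𝒜 (fun c => mulR A (f c)) AddMonoidHom.mul

/-! ## Almost diagonalizable forms -/

section AlmostDiagonalizable

variable {A P ι κ : Type*} [Ring A] [AddCommGroup P] [Module A P] [Module Aᵐᵒᵖ P]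

/-- The form `q` is almost diagonal on the family `n`, with associated index map `bar`. -/
def IsAlmostDiagonal {𝒜 : ZMod 2 → AddSubgroup A} {𝒢 : ZMod 2 → AddSubgroup P}
    (q : QuadForm 𝒜 𝒢) (n : ι → P) (bar : ι → ι) : Prop :=
  ∀ i, IsUnit (q.form (n i) (n (bar i))) ∧ ∀ j, j ≠ bar i → q.form (n i) (n j) = 0

/-- The coefficients `1/2 Δ(u i) (u i)⁻¹` for `inl i`, and zero for `inr j`. -/
def extendCoeff (u : ι → A) (Δ : AddMonoid.End A) : ι ⊕ κ → A :=
  Sum.elim (fun i => Ring.inverse 2 * Δ (u i) * Ring.inverse (u i)) (fun _ => 0)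

/-- The extension of an additive endomorphism `Δ` of `A` to `H(I; A) ⊕ P`, where `P` is free with
basis `n i = b (inl i)`, `r j = b (inr j)` and `u i` is the invertible value `q(n i, n (bar i))`. It
maps `a h` to `Δ(a) h` for the basis vectors `h` of `H(I; A)`, it maps `a n i` to
`(1/2 Δ(u i) (u i)⁻¹ a + Δ(a)) n i`, and `a r j` to `Δ(a) r j`. -/
def extend (I : Type*) (b : Module.Basis (ι ⊕ κ) A P) (u : ι → A) :
    AddMonoid.End A →+ AddMonoid.End (Hyp I A × P) :=
  AddMonoidHom.mk' (fun Δ : AddMonoid.End A => AddMonoidHom.mk' (fun v : Hyp I A × P =>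
      ((Finsupp.mapRange Δ (map_zero Δ) v.1, (b.repr v.2).sum fun s a =>
        (extendCoeff u Δ s * a + Δ a) • b s) : Hyp I A × P))
    (by
      intro v w
      classical
      refine Prod.ext ?_ ?_
      · ext s
        simp
      · simp only [Prod.snd_add, map_add]
        refine Finsupp.sum_add_index' (by simp) ?_
        intro s a c
        rw [mul_add, map_add, ← add_smul]
        congr 1
        abel))
    (by
      intro Δ Γ
      apply end_ext
      intro v
      refine Prod.ext ?_ ?_
      · ext s
        change Finsupp.mapRange (Δ + Γ) (map_zero (Δ + Γ)) v.1 s =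
          Finsupp.mapRange Δ (map_zero Δ) v.1 s + Finsupp.mapRange Γ (map_zero Γ) v.1 s
        rw [Finsupp.mapRange_apply, Finsupp.mapRange_apply, Finsupp.mapRange_apply, end_add_apply]
      · change ((b.repr v.2).sum fun s a => (extendCoeff u (Δ + Γ) s * a + (Δ + Γ) a) • b s) =
          ((b.repr v.2).sum fun s a => (extendCoeff u Δ s * a + Δ a) • b s) +
          ((b.repr v.2).sum fun s a => (extendCoeff u Γ s * a + Γ a) • b s)
        rw [← Finsupp.sum_add]
        apply Finsupp.sum_congr
        intro s _
        rw [← add_smul, end_add_apply]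
        congr 1
        rcases s with i | j
        · simp only [extendCoeff, Sum.elim_inl, end_add_apply, mul_add, add_mul]
          abel
        · simp [extendCoeff])

/-- The `A`-linear endomorphisms of the submodule `R` of `P`, extended by zero on `H(I; A) ⊕ N`. -/
def endOn (I : Type*) (N R : Submodule A P) : AddSubgroup (AddMonoid.End (Hyp I A × P)) where
  carrier := {S | (∀ (a : A) m, S (op a • m) = op a • S m) ∧
    (∀ h, ∀ p ∈ N, S (h, p) = 0) ∧ ∀ p ∈ R, ∃ r ∈ R, S (0, p) = (0, r)}
  zero_mem' := ⟨fun a m => by simp, fun h p _ => by simp, fun p _ => ⟨0, zero_mem _, rfl⟩⟩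
  add_mem' := by
    rintro S T ⟨hS, hS1, hS2⟩ ⟨hT, hT1, hT2⟩
    refine ⟨fun a m => ?_, fun h p hp => ?_, fun p hp => ?_⟩
    · rw [end_add_apply, end_add_apply, hS, hT, smul_add]
    · rw [end_add_apply, hS1 h p hp, hT1 h p hp, add_zero]
    · obtain ⟨r, hr, hr1⟩ := hS2 p hp
      obtain ⟨s, hs, hs1⟩ := hT2 p hp
      exact ⟨r + s, add_mem hr hs, by rw [end_add_apply, hr1, hs1]; simp⟩
  neg_mem' := by
    rintro S ⟨hS, hS1, hS2⟩
    refine ⟨fun a m => ?_, fun h p hp => ?_, fun p hp => ?_⟩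
    · rw [end_neg_apply, end_neg_apply, hS, smul_neg]
    · rw [end_neg_apply, hS1 h p hp, neg_zero]
    · obtain ⟨r, hr, hr1⟩ := hS2 p hp
      exact ⟨-r, neg_mem hr, by rw [end_neg_apply, hr1]; simp⟩

end AlmostDiagonalizable

end SuperLie

end

open SuperLie

/-!
The coordinates `(a, m, n, x)` make `L = eosp q_∞` a `3`-graded Lie superalgebra: the two copies of `M`
have degrees `1` and `-1`, and `A ⊕ eosp q` has degree `0` (`mem_eosp_qInf`, `sbr_coord`). The grading
is the eigenspace decomposition of `ad ζ` for `ζ = (1, 0, 0, 0)` (`gradingElement`).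

*Derivations.* The maps in `S_E` are the `K`-linear maps of `M` lying over a derivation of `A` and
compatible with `q` (`IsLift`, `mem_sPiece_iff`), and for these `d_{S,0}` is a derivation. Conversely
let `d` be a homogeneous derivation of `L`. The components of `d ζ` of degree `±1` can be removed by
subtracting an inner derivation. Then `d` kills `ζ` and preserves the `3`-grading
(`derPiece_of_map_gradingElement`), so that it restricts to endomorphisms `S` and `T` of the two copies
of `M`. The derivation property on products with `eosp q` shows that `S - T` commutes with `eosp q` up to
scalars, and Schur's lemma (`IsLarge.schur`) that it is a scalar `l`. After subtracting the inner
derivation of `(l/2, 0, 0, 0)` the two restrictions coincide, and `d` becomes some `d_{S,0}`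
(`exists_isOuter_sub_of_preserves`). This gives `Der L = ad L + d_{S_E,0}` (`derEosp_eq`). An inner
derivation of the form `d_{S,0}` also kills `ζ`, so it comes from `A ⊕ eosp q`, and acting in the same
way on both copies of `M` it comes from `eosp q` (`ad_inf_outer`). Complements of `eosp q` in `S_E`
therefore yield complements of `ad L` (`isSemidirect_of_complement`).

*The free case.* Suppose that `M` has a homogeneous basis adapted to `q` (`IsAdapted`). A derivation of
`A` extends to `M`, with coefficients that are half the logarithmic derivatives of the units `u_i`, as
compatibility with `q` requires (`isLift_extension`). A homogeneous element of `S_E` is the sum of such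
an extension, an endomorphism of the radical, and a linear skew map vanishing on the radical
(`exists_decomposition`). The last one agrees with an element of `eosp q` on each finite set
(`IsAdapted.exists_mem_eosp`), so it induces a locally inner derivation (`mem_adLoc_of_agree`), and an
inner one if the basis is finite. On the other hand elements of `eosp q` are linear and vanish on the
radical, so that a sum of an extended derivation and an endomorphism of the radical that agrees with
elements of `eosp q` on finite sets is zero (`eq_zero_of_agree`). If `L` is generated over `A` by
finitely many elements, locally inner derivations are inner because derivations that agree on the
generators and are `A`-linear coincide (`adLoc_le_ad_of_finite`).
-/

noncomputable section

set_option linter.unusedSectionVars false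

namespace SuperLie

open MulOpposite

/-! ### Homogeneous endomorphisms and the super bracket -/

section GradedEndomorphisms

variable {V : Type*} [AddCommGroup V] (𝒱 : ZMod 2 → AddSubgroup V)

theorem mul_mem_endGrading {α β : ZMod 2} {f g : AddMonoid.End V} (hf : f ∈ endGrading 𝒱 α)
    (hg : g ∈ endGrading 𝒱 β) : f * g ∈ endGrading 𝒱 (α + β) := by
  intro γ m hm
  have h := hf _ _ (hg γ m hm)
  rwa [add_assoc, add_comm β α] at h

variable [DirectSum.Decomposition 𝒱]

theorem sbr_apply_hom {α β : ZMod 2} {f g : AddMonoid.End V} (hf : f ∈ endGrading 𝒱 α)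
    (hg : g ∈ endGrading 𝒱 β) (v : V) :
    sbr 𝒱 f g v = f (g v) - sgn (α * β) • g (f v) := by
  rw [sbr_hom 𝒱 hf hg]
  rfl

theorem sbr_mem_endGrading {α β : ZMod 2} {f g : AddMonoid.End V} (hf : f ∈ endGrading 𝒱 α)
    (hg : g ∈ endGrading 𝒱 β) : sbr 𝒱 f g ∈ endGrading 𝒱 (α + β) := by
  rw [sbr_hom 𝒱 hf hg]
  refine sub_mem (mul_mem_endGrading 𝒱 hf hg) (zsmul_mem ?_ _)
  rw [add_comm]
  exact mul_mem_endGrading 𝒱 hg hf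

theorem sbr_jacobi {α β γ : ZMod 2} {f g h : AddMonoid.End V} (hf : f ∈ endGrading 𝒱 α)
    (hg : g ∈ endGrading 𝒱 β) (hh : h ∈ endGrading 𝒱 γ) :
    sbr 𝒱 f (sbr 𝒱 g h) = sbr 𝒱 (sbr 𝒱 f g) h + sgn (α * β) • sbr 𝒱 g (sbr 𝒱 f h) := by
  rw [sbr_hom 𝒱 hf (sbr_mem_endGrading 𝒱 hg hh), sbr_hom 𝒱 (sbr_mem_endGrading 𝒱 hf hg) hh,
    sbr_hom 𝒱 hg (sbr_mem_endGrading 𝒱 hf hh), sbr_hom 𝒱 hf hg, sbr_hom 𝒱 hg hh,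
    sbr_hom 𝒱 hf hh]
  rcases parity_cases α with rfl | rfl <;> rcases parity_cases β with rfl | rfl <;>
    rcases parity_cases γ with rfl | rfl <;> simp <;> noncomm_ring

/-- An additive group of endomorphisms that is spanned by homogeneous elements consists of the
endomorphisms whose homogeneous components belong to it. -/
theorem mem_sup_pieces {D : ZMod 2 → AddSubgroup (AddMonoid.End V)}
    (hD : ∀ α, D α ≤ endGrading 𝒱 α) {d : AddMonoid.End V} :
    d ∈ D 0 ⊔ D 1 ↔ ∀ α, endPart 𝒱 α d ∈ D α := by
  constructor
  · intro h
    obtain ⟨x, hx, y, hy, rfl⟩ := AddSubgroup.mem_sup.mp h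
    intro α
    rw [map_add]
    rcases parity_cases α with rfl | rfl
    · rw [endPart_same 𝒱 (hD 0 hx), endPart_ne 𝒱 (hD 1 hy) (by decide), add_zero]
      exact hx
    · rw [endPart_ne 𝒱 (hD 0 hx) (by decide), endPart_same 𝒱 (hD 1 hy), zero_add]
      exact hy
  · intro h
    rw [← endPart_add 𝒱 d]
    exact AddSubgroup.add_mem_sup (h 0) (h 1)

theorem mem_sup_of_mem_piece {D : ZMod 2 → AddSubgroup (AddMonoid.End V)} {α : ZMod 2}
    {d : AddMonoid.End V} (h : d ∈ D α) : d ∈ D 0 ⊔ D 1 := by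
  rcases parity_cases α with rfl | rfl
  · exact AddSubgroup.mem_sup_left h
  · exact AddSubgroup.mem_sup_right h

/-- To check that brackets of elements of graded subgroups lie in a subgroup, it suffices to
consider homogeneous elements. -/
theorem sbr_mem_of_hom {B C D : AddSubgroup (AddMonoid.End V)}
    (hB : ∀ α, ∀ f ∈ B, endPart 𝒱 α f ∈ B) (hC : ∀ α, ∀ f ∈ C, endPart 𝒱 α f ∈ C)
    (h : ∀ α β, ∀ f ∈ B, f ∈ endGrading 𝒱 α → ∀ g ∈ C, g ∈ endGrading 𝒱 β → sbr 𝒱 f g ∈ D) :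
    ∀ f ∈ B, ∀ g ∈ C, sbr 𝒱 f g ∈ D := by
  intro f hf g hg
  rw [← endPart_add 𝒱 f, ← endPart_add 𝒱 g]
  simp only [map_add, AddMonoidHom.add_apply]
  have key : ∀ α β, sbr 𝒱 (endPart 𝒱 α f) (endPart 𝒱 β g) ∈ D := fun α β =>
    h α β _ (hB α f hf) (endPart_mem 𝒱 α f) _ (hC β g hg) (endPart_mem 𝒱 β g)
  exact add_mem (add_mem (key 0 0) (key 1 0)) (add_mem (key 0 1) (key 1 1))

theorem endPart_apply_hom {α γ : ZMod 2} {f : AddMonoid.End V} {v : V} (hv : v ∈ 𝒱 γ) :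
    endPart 𝒱 α f v = part 𝒱 (γ + α) (f v) := by
  rw [endPart_apply]
  rcases parity_cases γ with rfl | rfl
  · rw [part_same 𝒱 hv, part_ne 𝒱 hv (by decide), map_zero, map_zero, add_zero, zero_add]
  · rw [part_same 𝒱 hv, part_ne 𝒱 hv (by decide), map_zero, map_zero, zero_add]

end GradedEndomorphisms

/-! ### Derivations of superalgebras -/

section DerivationLemmas

variable {C V : Type*} [AddCommGroup V] (𝒱 : ZMod 2 → AddSubgroup V) (rho : C → AddMonoid.End V)
  (mul : V →+ V →+ V) [DirectSum.Decomposition 𝒱]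

theorem sbr_mem_derPiece {α β : ZMod 2} {d e : AddMonoid.End V}
    (hd : d ∈ derPiece 𝒱 rho mul α) (he : e ∈ derPiece 𝒱 rho mul β) :
    sbr 𝒱 d e ∈ derPiece 𝒱 rho mul (α + β) := by
  refine ⟨sbr_mem_endGrading 𝒱 hd.1 he.1, fun c v => ?_, fun γ x hx y => ?_⟩
  · rw [sbr_apply_hom 𝒱 hd.1 he.1, sbr_apply_hom 𝒱 hd.1 he.1, he.2.1, hd.2.1, hd.2.1, he.2.1,
      map_sub, map_zsmul]
  · simp only [sbr_apply_hom 𝒱 hd.1 he.1]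
    rw [he.2.2 γ x hx, hd.2.2 γ x hx]
    simp only [map_add, map_zsmul, map_sub, AddMonoidHom.sub_apply, AddMonoidHom.smul_apply]
    rw [hd.2.2 _ _ (he.1 γ x hx), hd.2.2 γ x hx, he.2.2 _ _ (hd.1 γ x hx), he.2.2 γ x hx]
    rcases parity_cases α with rfl | rfl <;> rcases parity_cases β with rfl | rfl <;>
      rcases parity_cases γ with rfl | rfl <;> simp <;> abel

theorem mem_der_iff {d : AddMonoid.End V} :
    d ∈ der 𝒱 rho mul ↔ ∀ α, endPart 𝒱 α d ∈ derPiece 𝒱 rho mul α :=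
  mem_sup_pieces 𝒱 (D := derPiece 𝒱 rho mul) (fun _ _ h => And.left h)

theorem mem_derPiece_of_mem_der {α : ZMod 2} {d : AddMonoid.End V} (hd : d ∈ der 𝒱 rho mul)
    (h : d ∈ endGrading 𝒱 α) : d ∈ derPiece 𝒱 rho mul α := by
  rw [← endPart_same 𝒱 h]
  exact (mem_der_iff 𝒱 rho mul).mp hd α

theorem endPart_mem_der (α : ZMod 2) {d : AddMonoid.End V} (hd : d ∈ der 𝒱 rho mul) :
    endPart 𝒱 α d ∈ der 𝒱 rho mul :=
  mem_sup_of_mem_piece ((mem_der_iff 𝒱 rho mul).mp hd α)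

theorem sbr_mem_der {d e : AddMonoid.End V} (hd : d ∈ der 𝒱 rho mul) (he : e ∈ der 𝒱 rho mul) :
    sbr 𝒱 d e ∈ der 𝒱 rho mul := by
  refine sbr_mem_of_hom 𝒱 (fun α f hf => endPart_mem_der 𝒱 rho mul α hf)
    (fun α f hf => endPart_mem_der 𝒱 rho mul α hf) ?_ d hd e he
  intro α β f hf hfα g hg hgβ
  exact mem_sup_of_mem_piece (sbr_mem_derPiece 𝒱 rho mul
    (mem_derPiece_of_mem_der 𝒱 rho mul hf hfα) (mem_derPiece_of_mem_der 𝒱 rho mul hg hgβ))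

/-- The bracket of a derivation with an inner derivation is inner, provided that the product
respects parities. -/
theorem sbr_derPiece_mul (hmul : ∀ α β, ∀ x ∈ 𝒱 α, ∀ y ∈ 𝒱 β, mul x y ∈ 𝒱 (α + β)) {α β : ZMod 2}
    {d : AddMonoid.End V} (hd : d ∈ derPiece 𝒱 rho mul α) {z : V} (hz : z ∈ 𝒱 β) :
    sbr 𝒱 d (mul z : AddMonoid.End V) = (mul (d z) : AddMonoid.End V) := by
  have hmz : (mul z : AddMonoid.End V) ∈ endGrading 𝒱 β := by
    intro γ m hm
    rw [add_comm]
    exact hmul _ _ z hz m hm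
  apply end_ext
  intro v
  rw [sbr_apply_hom 𝒱 hd.1 hmz]
  exact sub_eq_of_eq_add (hd.2.2 β z hz v)

end DerivationLemmas

/-! ### Supermodules and quadratic forms -/

theorem sgn_mul_self (α : ZMod 2) : sgn α * sgn α = 1 := by
  rcases parity_cases α with rfl | rfl <;> simp

theorem sgn_smul_sgn_smul {G : Type*} [AddCommGroup G] (α : ZMod 2) (m : G) :
    sgn α • (sgn α • m) = m := by
  rw [smul_smul, sgn_mul_self, one_smul]

section ScalarMultiplication

variable {A M : Type*} [Ring A] [AddCommGroup M] [Module A M]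

@[simp] theorem mulL_apply (a : A) (m : M) : mulL M a m = a • m := rfl

theorem mulL_add (a b : A) : mulL M (a + b) = mulL M a + mulL M b :=
  map_add (Module.toAddMonoidEnd A M) a b

theorem mulL_neg (a : A) : mulL M (-a) = -mulL M a :=
  map_neg (Module.toAddMonoidEnd A M) a

theorem mulL_mul (a b : A) : mulL M (a * b) = mulL M a * mulL M b :=
  map_mul (Module.toAddMonoidEnd A M) a b

theorem mulL_zero : mulL M (0 : A) = 0 := map_zero (Module.toAddMonoidEnd A M)

theorem eq_zero_of_eq_neg (h2 : IsUnit (2 : A)) {m : M} (h : m = -m) : m = 0 := by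
  have h1 : (2 : A) • m = 0 := by
    rw [two_smul]
    nth_rewrite 1 [h]
    exact neg_add_cancel m
  exact (h2.smul_eq_zero).mp h1

end ScalarMultiplication

section FormCalculus

variable {A M : Type*} [Ring A] [AddCommGroup M] [Module A M] [Module Aᵐᵒᵖ M]
  {𝒜 : ZMod 2 → AddSubgroup A} {ℳ : ZMod 2 → AddSubgroup M}

theorem op_smul_zsmul (a : A) (c : ℤ) (m : M) : op a • (c • m) = c • (op a • m) :=
  smul_comm _ _ _

variable [IsSupermodule 𝒜 ℳ]

theorem op_smul_eq {α β : ZMod 2} {a : A} {m : M} (ha : a ∈ 𝒜 α) (hm : m ∈ ℳ β) :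
    op a • m = sgn (α * β) • (a • m) := by
  rw [IsSupermodule.smul_eq (𝒜 := 𝒜) (ℳ := ℳ) ha hm, smul_smul, sgn_mul_self, one_smul]

theorem mulL_mem_endGrading (ℳ : ZMod 2 → AddSubgroup M) [IsSupermodule 𝒜 ℳ] {α : ZMod 2} {a : A}
    (ha : a ∈ 𝒜 α) : mulL M a ∈ endGrading ℳ α := by
  intro γ m hm
  have h := IsSupermodule.smul_mem (𝒜 := 𝒜) (ℳ := ℳ) ha hm
  rwa [add_comm] at h

variable [DirectSum.Decomposition ℳ] [GradedRing 𝒜] [IsSupercommutative 𝒜]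

include 𝒜 in
theorem smul_eq_op_smul {m : M} (hm : m ∈ ℳ 0) (a : A) : a • m = op a • m := by
  refine hom_induction 𝒜 (p := fun a => a • m = op a • m) ?_ ?_ a
  · intro α a ha
    rw [IsSupermodule.smul_eq (𝒜 := 𝒜) (ℳ := ℳ) ha hm]
    simp
  · intro a b ha hb
    rw [add_smul, op_add, add_smul, ha, hb]

variable (q : QuadForm 𝒜 ℳ)

theorem form_smul_left (a : A) (m n : M) : q.form (a • m) n = a * q.form m n := by
  refine hom_induction 𝒜 (p := fun a => q.form (a • m) n = a * q.form m n) ?_ ?_ a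
  · intro α a ha
    refine hom_induction ℳ (p := fun m => q.form (a • m) n = a * q.form m n) ?_ ?_ m
    · intro β m hm
      refine hom_induction ℳ (p := fun n => q.form (a • m) n = a * q.form m n) ?_ ?_ n
      · intro γ n hn
        rw [IsSupermodule.smul_eq (𝒜 := 𝒜) (ℳ := ℳ) ha hm, map_zsmul, AddMonoidHom.smul_apply,
          q.balanced, IsSupermodule.smul_eq (𝒜 := 𝒜) (ℳ := ℳ) ha hn, map_zsmul, q.linear,
          IsSupercommutative.mul_comm ha (q.degree hm hn)]
        rcases parity_cases α with rfl | rfl <;> rcases parity_cases β with rfl | rfl <;>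
          rcases parity_cases γ with rfl | rfl <;> simp
      · intro n r hn hr
        rw [map_add, hn, hr, map_add, mul_add]
    · intro m r hm hr
      rw [smul_add, map_add, map_add, AddMonoidHom.add_apply, AddMonoidHom.add_apply, hm, hr,
        mul_add]
  · intro a b ha hb
    rw [add_smul, map_add, AddMonoidHom.add_apply, ha, hb, add_mul]

/-- A right linear homogeneous endomorphism commutes with left multiplications up to sign. -/
theorem map_smul_of_linear {x : AddMonoid.End M} {δ : ZMod 2} (hx : x ∈ endGrading ℳ δ)
    (hx1 : ∀ (a : A) m, x (op a • m) = op a • x m) {α : ZMod 2} {a : A} (ha : a ∈ 𝒜 α) (m : M) :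
    x (a • m) = sgn (δ * α) • (a • x m) := by
  refine hom_induction ℳ (p := fun m => x (a • m) = sgn (δ * α) • (a • x m)) ?_ ?_ m
  · intro β m hm
    rw [IsSupermodule.smul_eq (𝒜 := 𝒜) (ℳ := ℳ) ha hm, map_zsmul, hx1,
      IsSupermodule.smul_eq (𝒜 := 𝒜) (ℳ := ℳ) ha (hx β m hm)]
    rcases parity_cases α with rfl | rfl <;> rcases parity_cases β with rfl | rfl <;>
      rcases parity_cases δ with rfl | rfl <;> simp
  · intro m n hm hn
    rw [smul_add, map_add, hm, hn, map_add, smul_add, smul_add]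

variable [SMulCommClass A Aᵐᵒᵖ M]

theorem opE_linear_all (m n : M) (a : A) (p : M) :
    opE q m n (op a • p) = op a • opE q m n p := by
  refine hom_induction ℳ (p := fun m => opE q m n (op a • p) = op a • opE q m n p) ?_ ?_ m
  · intro α m hm
    refine hom_induction ℳ (p := fun n => opE q m n (op a • p) = op a • opE q m n p) ?_ ?_ n
    · intro β n hn
      exact opE_linear q hm hn a p
    · intro n r hn hr
      rw [opE_add_right, end_add_apply, end_add_apply, hn, hr, smul_add]
  · intro n r hn hr
    rw [opE_add_left, end_add_apply, end_add_apply, hn, hr, smul_add]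

theorem eosp_linear {x : AddMonoid.End M} (hx : x ∈ eosp q) (a : A) (m : M) :
    x (op a • m) = op a • x m := by
  refine eosp_induction q (p := fun x => x (op a • m) = op a • x m) ?_ ?_ ?_ ?_ hx
  · simp
  · intro x y hx hy
    rw [end_add_apply, end_add_apply, hx, hy, smul_add]
  · intro x hx
    rw [end_neg_apply, end_neg_apply, hx, smul_neg]
  · intro α β m hm n hn
    exact opE_linear_all q m n a _

theorem eosp_skew {x : AddMonoid.End M} (hx : x ∈ eosp q) {δ : ZMod 2} (hxδ : x ∈ endGrading ℳ δ)
    {γ : ZMod 2} {p : M} (hp : p ∈ ℳ γ) (r : M) :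
    q.form (x p) r = -(sgn (δ * γ) • q.form p (x r)) := by
  rw [← endPart_same ℳ hxδ]
  refine eosp_induction q (p := fun x => q.form (endPart ℳ δ x p) r
    = -(sgn (δ * γ) • q.form p (endPart ℳ δ x r))) ?_ ?_ ?_ ?_ hx
  · simp
  · intro x y hx hy
    simp only [map_add, end_add_apply, AddMonoidHom.add_apply, hx, hy, smul_add]
    abel
  · intro x hx
    simp only [map_neg, end_neg_apply, AddMonoidHom.neg_apply, hx, smul_neg]
  · intro α β m hm n hn
    by_cases h : α + β = δ
    · subst h
      rw [endPart_same ℳ (opE_mem_grading q hm hn)]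
      exact opE_skew q hm hn hp r
    · rw [endPart_ne ℳ (opE_mem_grading q hm hn) h]
      simp

end FormCalculus

/-! ### Coordinates on `eosp q_∞` -/

section Coordinates

variable {A M : Type*} [Ring A] [AddCommGroup M] [Module A M] [Module Aᵐᵒᵖ M]
  {𝒜 : ZMod 2 → AddSubgroup A} {ℳ : ZMod 2 → AddSubgroup M} [GradedRing 𝒜]
  [IsSupercommutative 𝒜] [DirectSum.Decomposition ℳ]

/-- The grading of `H({∞}; A) ⊕ M`. -/
abbrev infGrading (𝒜 : ZMod 2 → AddSubgroup A) (ℳ : ZMod 2 → AddSubgroup M) :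
    ZMod 2 → AddSubgroup (Hyp Unit A × M) := prodGrading (hypGrading 𝒜 Unit) ℳ

theorem hypUnit_ext {v w : Hyp Unit A × M} (h1 : v.1 (Sum.inl ()) = w.1 (Sum.inl ()))
    (h2 : v.1 (Sum.inr ()) = w.1 (Sum.inr ())) (h3 : v.2 = w.2) : v = w := by
  refine Prod.ext (Finsupp.ext ?_) h3
  rintro (⟨⟩ | ⟨⟩)
  · exact h1
  · exact h2

variable (q : QuadForm 𝒜 ℳ) (t : A × M × M × AddMonoid.End M) (v : Hyp Unit A × M)

theorem coord_inl : (coord q t v).1 (Sum.inl ()) = t.1 * v.1 (Sum.inl ()) - q.form t.2.1 v.2 := by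
  change (Finsupp.single (Sum.inl ()) _ + Finsupp.single (Sum.inr ()) _ : Hyp Unit A) _ = _
  simp

theorem coord_inr :
    (coord q t v).1 (Sum.inr ()) = q.form t.2.2.1 v.2 - t.1 * v.1 (Sum.inr ()) := by
  change (Finsupp.single (Sum.inl ()) _ + Finsupp.single (Sum.inr ()) _ : Hyp Unit A) _ = _
  simp

theorem coord_snd : (coord q t v).2 =
    op (v.1 (Sum.inr ())) • t.2.1 - op (v.1 (Sum.inl ())) • t.2.2.1 + t.2.2.2 v.2 := rfl

theorem qInf_form (w : Hyp Unit A × M) : (qInf q).form v w =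
    v.1 (Sum.inl ()) * w.1 (Sum.inr ()) + v.1 (Sum.inr ()) * w.1 (Sum.inl ()) +
      q.form v.2 w.2 := by
  change (v.1.sum fun s a => a * w.1 s.swap) + q.form v.2 w.2 = _
  rw [Finsupp.sum_fintype _ _ (by simp)]
  simp

theorem coord_injective : Function.Injective (coord q) := by
  rintro ⟨a, m, n, x⟩ ⟨a', m', n', x'⟩ h
  have h1 := DFunLike.congr_fun h ((Finsupp.single (Sum.inl ()) 1, 0) : Hyp Unit A × M)
  have h2 := DFunLike.congr_fun h ((Finsupp.single (Sum.inr ()) 1, 0) : Hyp Unit A × M)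
  have e1 : a = a' := by
    have h3 := congrArg (fun w : Hyp Unit A × M => w.1 (Sum.inl ())) h1
    simpa [coord_inl] using h3
  have e2 : m = m' := by
    have h3 := congrArg (fun w : Hyp Unit A × M => w.2) h2
    simpa [coord_snd] using h3
  have e3 : n = n' := by
    have h3 := congrArg (fun w : Hyp Unit A × M => w.2) h1
    simpa [coord_snd] using h3
  have e4 : x = x' := by
    apply end_ext
    intro p
    have h3 := congrArg (fun w : Hyp Unit A × M => w.2)
      (DFunLike.congr_fun h ((0, p) : Hyp Unit A × M))
    simpa [coord_snd] using h3
  rw [e1, e2, e3, e4]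

variable [SMulCommClass A Aᵐᵒᵖ M] [IsSupermodule 𝒜 ℳ]

theorem coord_mem_endGrading {α : ZMod 2} {a : A} {m n : M} {x : AddMonoid.End M} (ha : a ∈ 𝒜 α)
    (hm : m ∈ ℳ α) (hn : n ∈ ℳ α) (hx : x ∈ endGrading ℳ α) :
    coord q (a, m, n, x) ∈ endGrading (infGrading 𝒜 ℳ) α := by
  intro γ v hv
  have hl := hv.1 (Sum.inl ())
  have hr := hv.1 (Sum.inr ())
  have hp := hv.2
  refine ⟨?_, ?_⟩
  · rintro (⟨⟩ | ⟨⟩)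
    · rw [coord_inl, add_comm γ α]
      exact sub_mem (SetLike.GradedMul.mul_mem ha hl) (q.degree hm hp)
    · rw [coord_inr, add_comm γ α]
      exact sub_mem (q.degree hn hp) (SetLike.GradedMul.mul_mem ha hr)
  · change _ ∈ ℳ (γ + α)
    rw [coord_snd]
    exact add_mem (sub_mem (op_smul_mem (𝒜 := 𝒜) hr hm) (op_smul_mem (𝒜 := 𝒜) hl hn))
      (hx γ _ hp)

/-- The coordinates of the generators of `eosp q_∞`. -/
theorem opE_qInf {α β : ZMod 2} {v w : Hyp Unit A × M} (hv : v ∈ infGrading 𝒜 ℳ α)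
    (hw : w ∈ infGrading 𝒜 ℳ β) : opE (qInf q) v w = coord q
      (v.1 (Sum.inl ()) * w.1 (Sum.inr ()) -
          sgn (α * β) • (w.1 (Sum.inl ()) * v.1 (Sum.inr ())),
        sgn (α * β) • (w.1 (Sum.inl ()) • v.2) - v.1 (Sum.inl ()) • w.2,
        v.1 (Sum.inr ()) • w.2 - sgn (α * β) • (w.1 (Sum.inr ()) • v.2), opE q v.2 w.2) := by
  apply end_ext
  intro p
  rw [opE_apply (qInf q) hv hw, qInf_form, qInf_form]
  obtain ⟨v1, v2⟩ := v
  obtain ⟨w1, w2⟩ := w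
  have hvl : v1 (Sum.inl ()) ∈ 𝒜 α := hv.1 _
  have hvr : v1 (Sum.inr ()) ∈ 𝒜 α := hv.1 _
  have hwl : w1 (Sum.inl ()) ∈ 𝒜 β := hw.1 _
  have hwr : w1 (Sum.inr ()) ∈ 𝒜 β := hw.1 _
  have hv2 : v2 ∈ ℳ α := hv.2
  have hw2 : w2 ∈ ℳ β := hw.2
  have c1 := IsSupercommutative.mul_comm hvl hwl
  have c2 := IsSupercommutative.mul_comm hvr hwr
  have c3 := IsSupercommutative.mul_comm hvr hwl
  have c4 := IsSupercommutative.mul_comm hvl hwr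
  apply hypUnit_ext
  · rw [coord_inl]
    simp only [Prod.fst_sub, Prod.smul_fst, Finsupp.sub_apply, Finsupp.smul_apply, op_smul_eq_mul,
      map_sub, map_zsmul, AddMonoidHom.sub_apply, AddMonoidHom.smul_apply, form_smul_left, mul_add,
      sub_mul, smul_add, smul_mul_assoc, ← mul_assoc, c1]
    abel
  · rw [coord_inr]
    simp only [Prod.fst_sub, Prod.smul_fst, Finsupp.sub_apply, Finsupp.smul_apply, op_smul_eq_mul,
      map_sub, map_zsmul, AddMonoidHom.sub_apply, AddMonoidHom.smul_apply, form_smul_left, mul_add,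
      sub_mul, smul_add, smul_mul_assoc, ← mul_assoc, c2, c3, c4]
    abel
  · rw [coord_snd]
    dsimp only
    simp only [Prod.snd_sub, Prod.smul_snd]
    rw [opE_apply q hv2 hw2, IsSupermodule.smul_eq (𝒜 := 𝒜) hvl hw2,
      IsSupermodule.smul_eq (𝒜 := 𝒜) hvr hw2, IsSupermodule.smul_eq (𝒜 := 𝒜) hwl hv2,
      IsSupermodule.smul_eq (𝒜 := 𝒜) hwr hv2]
    rw [mul_comm β α]
    simp only [sgn_smul_sgn_smul, smul_sub, op_add, op_mul, add_smul, smul_add,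
      op_smul_zsmul, mul_smul]
    abel

/-- The first three coordinates come from the generators `E (a h_∞) h_{-∞}`, `E m h_∞` and
`E h_{-∞} n`; the fourth embeds the generators of `eosp q`. -/
theorem coord_mem_eosp (a : A) (m n : M) {x : AddMonoid.End M} (hx : x ∈ eosp q) :
    coord q (a, m, n, x) ∈ eosp (qInf q) := by
  have hadd : ∀ s t, coord q s ∈ eosp (qInf q) → coord q t ∈ eosp (qInf q) →
      coord q (s + t) ∈ eosp (qInf q) := fun s t hs ht => by
    rw [map_add]
    exact add_mem hs ht
  have h0l : ((Finsupp.single (Sum.inl ()) 1, 0) : Hyp Unit A × M) ∈ infGrading 𝒜 ℳ 0 :=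
    ⟨fun s => by
      classical
      rw [Finsupp.single_apply]
      split_ifs
      exacts [SetLike.GradedOne.one_mem, zero_mem _], zero_mem _⟩
  have h0r : ((Finsupp.single (Sum.inr ()) 1, 0) : Hyp Unit A × M) ∈ infGrading 𝒜 ℳ 0 :=
    ⟨fun s => by
      classical
      rw [Finsupp.single_apply]
      split_ifs
      exacts [SetLike.GradedOne.one_mem, zero_mem _], zero_mem _⟩
  have hE0 : opE q (0 : M) 0 = 0 := by
    have h := opE_add_left q 0 0 (0 : M)
    rw [add_zero] at h
    exact left_eq_add.mp h
  have hEl : ∀ n : M, opE q n 0 = 0 := fun n => by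
    have h := opE_add_right q n 0 (0 : M)
    rw [add_zero] at h
    exact left_eq_add.mp h
  have hEr : ∀ n : M, opE q 0 n = 0 := fun n => by
    have h := opE_add_left q 0 0 n
    rw [add_zero] at h
    exact left_eq_add.mp h
  have h1 : coord q (a, 0, 0, 0) ∈ eosp (qInf q) := by
    refine hom_induction 𝒜 (p := fun a => coord q (a, 0, 0, 0) ∈ eosp (qInf q)) ?_ ?_ a
    · intro α a ha
      have h := opE_qInf q (v := ((Finsupp.single (Sum.inl ()) a, 0) : Hyp Unit A × M)) (α := α)
        ⟨fun s => by
          classical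
          rw [Finsupp.single_apply]
          split_ifs
          exacts [ha, zero_mem _], zero_mem _⟩ h0r
      simp [hE0] at h
      rw [← h]
      exact opE_mem _ _ _
    · intro a b ha hb
      simpa using hadd _ _ ha hb
  have h2 : coord q (0, m, 0, 0) ∈ eosp (qInf q) := by
    refine hom_induction ℳ (p := fun m => coord q (0, m, 0, 0) ∈ eosp (qInf q)) ?_ ?_ m
    · intro α m hm
      have h := opE_qInf q (v := ((0, m) : Hyp Unit A × M)) (α := α) ⟨zero_mem _, hm⟩ h0l
      simp [hEl] at h
      rw [← h]
      exact opE_mem _ _ _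
    · intro a b ha hb
      simpa using hadd _ _ ha hb
  have h3 : coord q (0, 0, n, 0) ∈ eosp (qInf q) := by
    refine hom_induction ℳ (p := fun n => coord q (0, 0, n, 0) ∈ eosp (qInf q)) ?_ ?_ n
    · intro α n hn
      have h := opE_qInf q (w := ((0, n) : Hyp Unit A × M)) (β := α) h0r ⟨zero_mem _, hn⟩
      simp [hEr] at h
      rw [← h]
      exact opE_mem _ _ _
    · intro a b ha hb
      simpa using hadd _ _ ha hb
  have h4 : coord q (0, 0, 0, x) ∈ eosp (qInf q) := by
    refine eosp_induction q (p := fun x => coord q (0, 0, 0, x) ∈ eosp (qInf q)) ?_ ?_ ?_ ?_ hx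
    · have h : ((0, 0, 0, 0) : A × M × M × AddMonoid.End M) = 0 := rfl
      rw [h, map_zero]
      exact zero_mem _
    · intro x y hx hy
      simpa using hadd _ _ hx hy
    · intro x hx
      have h : ((0, 0, 0, -x) : A × M × M × AddMonoid.End M) = -(0, 0, 0, x) := by simp
      rw [h, map_neg]
      exact neg_mem hx
    · intro α β m hm n hn
      have h := opE_qInf q (v := ((0, m) : Hyp Unit A × M)) (w := ((0, n) : Hyp Unit A × M))
        ⟨zero_mem _, hm⟩ ⟨zero_mem _, hn⟩
      simp at h
      rw [← h]
      exact opE_mem _ _ _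
  have h5 := hadd _ _ (hadd _ _ (hadd _ _ h1 h2) h3) h4
  simpa using h5

theorem mem_eosp_qInf (y : AddMonoid.End (Hyp Unit A × M)) :
    y ∈ eosp (qInf q) ↔ ∃ a m n, ∃ x ∈ eosp q, y = coord q (a, m, n, x) := by
  constructor
  · intro hy
    refine eosp_induction (qInf q)
      (p := fun y => ∃ a m n, ∃ x ∈ eosp q, y = coord q (a, m, n, x)) ?_ ?_ ?_ ?_ hy
    · exact ⟨0, 0, 0, 0, zero_mem _, (map_zero (coord q)).symm⟩
    · rintro _ _ ⟨a, m, n, x, hx, rfl⟩ ⟨b, k, l, y, hy, rfl⟩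
      exact ⟨a + b, m + k, n + l, x + y, add_mem hx hy, (map_add (coord q) _ _).symm⟩
    · rintro _ ⟨a, m, n, x, hx, rfl⟩
      exact ⟨-a, -m, -n, -x, neg_mem hx, (map_neg (coord q) _).symm⟩
    · intro α β v hv w hw
      exact ⟨_, _, _, _, opE_mem q _ _, opE_qInf q hv hw⟩
  · rintro ⟨a, m, n, x, hx, rfl⟩
    exact coord_mem_eosp q a m n hx

/-- The bracket of `eosp q_∞` in coordinates. -/
theorem sbr_coord {α β : ZMod 2} {a : A} (ha : a ∈ 𝒜 α) {m : M} (hm : m ∈ ℳ α) {n : M}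
    (hn : n ∈ ℳ α) {x : AddMonoid.End M} (hx : x ∈ eosp q) (hxα : x ∈ endGrading ℳ α)
    {a' : A} (ha' : a' ∈ 𝒜 β) {m' : M} (hm' : m' ∈ ℳ β) {n' : M} (hn' : n' ∈ ℳ β)
    {x' : AddMonoid.End M} (hx' : x' ∈ eosp q) (hxβ : x' ∈ endGrading ℳ β) :
    sbr (infGrading 𝒜 ℳ) (coord q (a, m, n, x)) (coord q (a', m', n', x')) =
      coord q (q.form m n' - q.form n m',
        a • m' + x m' - op a' • m - sgn (α * β) • x' m,
        -(a • n') + x n' + op a' • n - sgn (α * β) • x' n,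
        opE q m n' + opE q n m' + sbr ℳ x x') := by
  apply end_ext
  intro v
  rw [sbr_apply_hom _ (coord_mem_endGrading q ha hm hn hxα)
    (coord_mem_endGrading q ha' hm' hn' hxβ)]
  have c1 := IsSupercommutative.mul_comm ha ha'
  have c2 := IsSupermodule.smul_eq (𝒜 := 𝒜) ha hm'
  have c3 := IsSupermodule.smul_eq (𝒜 := 𝒜) ha hn'
  have d2 := op_smul_eq (𝒜 := 𝒜) ha' hm
  have d3 := op_smul_eq (𝒜 := 𝒜) ha' hn
  rw [mul_comm β α] at d2 d3
  have s1 := q.symm hm' hm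
  have s2 := q.symm hn' hn
  have s3 := q.symm hm' hn
  have s4 := q.symm hn' hm
  rw [mul_comm β α] at s1 s2 s3 s4
  have k1 : ∀ p, q.form (x m') p = -(sgn (α * β) • q.form m' (x p)) := eosp_skew q hx hxα hm'
  have k2 : ∀ p, q.form (x n') p = -(sgn (α * β) • q.form n' (x p)) := eosp_skew q hx hxα hn'
  have k3 : ∀ p, q.form (x' m) p = -(sgn (α * β) • q.form m (x' p)) := by
    rw [mul_comm α β]
    exact eosp_skew q hx' hxβ hm
  have k4 : ∀ p, q.form (x' n) p = -(sgn (α * β) • q.form n (x' p)) := by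
    rw [mul_comm α β]
    exact eosp_skew q hx' hxβ hn
  apply hypUnit_ext
  · simp only [Prod.fst_sub, Prod.smul_fst, Finsupp.sub_apply, Finsupp.smul_apply, coord_inl,
      coord_snd, map_add, map_sub, q.linear, mul_sub, sub_mul,
      AddMonoidHom.sub_apply, AddMonoidHom.add_apply, map_zsmul, AddMonoidHom.smul_apply, d2,
      form_smul_left, k1, k3, smul_sub, smul_add, smul_neg, smul_smul, sgn_mul_self, one_smul, s1,
      s3, smul_mul_assoc, ← mul_assoc, c1]
    abel
  · simp only [Prod.fst_sub, Prod.smul_fst, Finsupp.sub_apply, Finsupp.smul_apply,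
      coord_snd, coord_inr, map_add, map_sub, map_neg, q.linear, mul_sub,
      sub_mul, AddMonoidHom.sub_apply, AddMonoidHom.add_apply, AddMonoidHom.neg_apply, map_zsmul,
      AddMonoidHom.smul_apply, d3,
      form_smul_left, k2, k4, smul_sub, smul_add, smul_neg, smul_smul, sgn_mul_self, one_smul, s2,
      s4, smul_mul_assoc, ← mul_assoc, c1]
    abel
  · simp only [Prod.snd_sub, Prod.smul_snd, coord_snd, coord_inl, coord_inr, end_add_apply,
      sbr_apply_hom ℳ hxα hxβ, opE_apply q hm hn', opE_apply q hn hm', map_add, map_sub,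
      eosp_linear q hx, eosp_linear q hx', op_sub, op_mul, sub_smul, mul_smul, smul_sub, smul_add,
      c2, c3, smul_neg, op_smul_zsmul]
    abel

end Coordinates

/-! ### The Lie superalgebra `eosp q_∞` in coordinates -/

section LieCoordinates

variable {A M : Type*} [Ring A] [AddCommGroup M] [Module A M] [Module Aᵐᵒᵖ M]
  {𝒜 : ZMod 2 → AddSubgroup A} {ℳ : ZMod 2 → AddSubgroup M} [GradedRing 𝒜]
  [IsSupercommutative 𝒜] [DirectSum.Decomposition ℳ] [SMulCommClass A Aᵐᵒᵖ M]
  [IsSupermodule 𝒜 ℳ]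

/-- The operator `E m n`, regarded as an element of `eosp q`. -/
def opEs (q : QuadForm 𝒜 ℳ) (m n : M) : eosp q := ⟨opE q m n, opE_mem q m n⟩

/-- The coordinate isomorphism from `A ⊕ M ⊕ M ⊕ eosp q` onto `eosp q_∞`. -/
def ofCoord (q : QuadForm 𝒜 ℳ) : A × M × M × eosp q ≃+ eosp (qInf q) :=
  AddEquiv.ofBijective
    (((coord q).comp
      ((AddMonoidHom.id A).prodMap ((AddMonoidHom.id M).prodMap ((AddMonoidHom.id M).prodMap
        (eosp q).subtype)))).codRestrict (eosp (qInf q))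
      (fun t => coord_mem_eosp q t.1 t.2.1 t.2.2.1 t.2.2.2.2))
    (by
      constructor
      · rintro ⟨a, m, n, x⟩ ⟨a', m', n', x'⟩ h
        have h1 : (a, m, n, (x : AddMonoid.End M)) = (a', m', n', (x' : AddMonoid.End M)) :=
          coord_injective q (congrArg Subtype.val h)
        simp only [Prod.mk.injEq, SetLike.coe_eq_coe] at h1
        rw [h1.1, h1.2.1, h1.2.2.1, h1.2.2.2]
      · rintro ⟨y, hy⟩
        obtain ⟨a, m, n, x, hx, rfl⟩ := (mem_eosp_qInf q y).mp hy
        exact ⟨(a, m, n, ⟨x, hx⟩), rfl⟩)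

variable (q : QuadForm 𝒜 ℳ)

theorem coe_ofCoord (a : A) (m n : M) (x : eosp q) :
    (ofCoord q (a, m, n, x) : AddMonoid.End (Hyp Unit A × M)) = coord q (a, m, n, x) := rfl

theorem exists_ofCoord (y : eosp (qInf q)) : ∃ a m n x, y = ofCoord q (a, m, n, x) := by
  obtain ⟨⟨a, m, n, x⟩, rfl⟩ := (ofCoord q).surjective y
  exact ⟨a, m, n, x, rfl⟩

theorem ofCoord_mem {α : ZMod 2} {a : A} {m n : M} {x : eosp q} (ha : a ∈ 𝒜 α)
    (hm : m ∈ ℳ α) (hn : n ∈ ℳ α) (hx : x ∈ eospGrading q α) :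
    ofCoord q (a, m, n, x) ∈ eospGrading (qInf q) α :=
  coord_mem_endGrading q ha hm hn hx

theorem coe_mem_endGrading {α : ZMod 2} {x : eosp q} (hx : x ∈ eospGrading q α) :
    (x : AddMonoid.End M) ∈ endGrading ℳ α := hx

theorem exists_hom_ofCoord {α : ZMod 2} {y : eosp (qInf q)} (hy : y ∈ eospGrading (qInf q) α) :
    ∃ a ∈ 𝒜 α, ∃ m ∈ ℳ α, ∃ n ∈ ℳ α, ∃ x ∈ eospGrading q α, y = ofCoord q (a, m, n, x) := by
  obtain ⟨a, m, n, x, rfl⟩ := exists_ofCoord q y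
  refine ⟨_, part_mem 𝒜 α a, _, part_mem ℳ α m, _, part_mem ℳ α n, _,
    part_mem (eospGrading q) α x, ?_⟩
  have h : ofCoord q (a, m, n, x) =
      ofCoord q (part 𝒜 0 a, part ℳ 0 m, part ℳ 0 n, part (eospGrading q) 0 x) +
      ofCoord q (part 𝒜 1 a, part ℳ 1 m, part ℳ 1 n, part (eospGrading q) 1 x) := by
    rw [← map_add]
    simp only [Prod.mk_add_mk, part_add]
  have h0 := ofCoord_mem q (part_mem 𝒜 0 a) (part_mem ℳ 0 m) (part_mem ℳ 0 n)
    (part_mem (eospGrading q) 0 x)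
  have h1 := ofCoord_mem q (part_mem 𝒜 1 a) (part_mem ℳ 1 m) (part_mem ℳ 1 n)
    (part_mem (eospGrading q) 1 x)
  have h2 := part_same _ hy
  rw [← h2, h, map_add]
  rcases parity_cases α with rfl | rfl
  · rw [part_same _ h0, part_ne _ h1 (by decide), add_zero]
  · rw [part_same _ h1, part_ne _ h0 (by decide), zero_add]

/-- To check an additive statement on `eosp q_∞`, it suffices to consider homogeneous elements in
coordinates. -/
theorem ofCoord_induction {p : eosp (qInf q) → Prop}
    (h0 : ∀ α, ∀ a ∈ 𝒜 α, ∀ m ∈ ℳ α, ∀ n ∈ ℳ α, ∀ x ∈ eospGrading q α, p (ofCoord q (a, m, n, x)))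
    (hadd : ∀ x y, p x → p y → p (x + y)) (y : eosp (qInf q)) : p y := by
  refine hom_induction (eospGrading (qInf q)) ?_ hadd y
  intro α y hy
  obtain ⟨a, ha, m, hm, n, hn, x, hx, rfl⟩ := exists_hom_ofCoord q hy
  exact h0 α a ha m hm n hn x hx

theorem eospBr_ofCoord {α β : ZMod 2} {a : A} (ha : a ∈ 𝒜 α) {m : M} (hm : m ∈ ℳ α) {n : M}
    (hn : n ∈ ℳ α) {x : eosp q} (hx : x ∈ eospGrading q α)
    {a' : A} (ha' : a' ∈ 𝒜 β) {m' : M} (hm' : m' ∈ ℳ β) {n' : M} (hn' : n' ∈ ℳ β)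
    {x' : eosp q} (hx' : x' ∈ eospGrading q β) :
    eospBr (qInf q) (ofCoord q (a, m, n, x)) (ofCoord q (a', m', n', x')) =
      ofCoord q (q.form m n' - q.form n m',
        a • m' + (x : AddMonoid.End M) m' - op a' • m - sgn (α * β) • (x' : AddMonoid.End M) m,
        -(a • n') + (x : AddMonoid.End M) n' + op a' • n - sgn (α * β) • (x' : AddMonoid.End M) n,
        opEs q m n' + opEs q n m' + eospBr q x x') :=
  Subtype.ext (sbr_coord q ha hm hn x.2 hx ha' hm' hn' x'.2 hx')

theorem eospR_ofCoord (c a : A) (m n : M) (x : eosp q) :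
    eospR (qInf q) c (ofCoord q (a, m, n, x)) =
      ofCoord q (a * c, op c • m, op c • n, eospR q c x) := by
  apply Subtype.ext
  change coord q (a, m, n, x) * mulL _ c = coord q (a * c, op c • m, op c • n, x * mulL M c)
  apply end_ext
  intro v
  rw [end_mul_apply, mulL_apply]
  apply hypUnit_ext
  · simp [coord_inl, q.balanced, mul_assoc]
  · simp [coord_inr, q.balanced, mul_assoc]
  · simp only [coord_snd, Prod.smul_snd, Prod.smul_fst, Finsupp.smul_apply, smul_eq_mul, op_mul,
      mul_smul, end_mul_apply, mulL_apply]

theorem eospBr_mem {α β : ZMod 2} {x y : eosp q} (hx : x ∈ eospGrading q α)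
    (hy : y ∈ eospGrading q β) : eospBr q x y ∈ eospGrading q (α + β) :=
  sbr_mem_endGrading ℳ hx hy

theorem eospBr_jacobi {α β γ : ZMod 2} {x y z : eosp q} (hx : x ∈ eospGrading q α)
    (hy : y ∈ eospGrading q β) (hz : z ∈ eospGrading q γ) :
    eospBr q x (eospBr q y z) =
      eospBr q (eospBr q x y) z + sgn (α * β) • eospBr q y (eospBr q x z) :=
  Subtype.ext (sbr_jacobi ℳ hx hy hz)

theorem eospL_mem {α β : ZMod 2} {a : A} (ha : a ∈ 𝒜 α) {x : eosp q} (hx : x ∈ eospGrading q β) :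
    eospL q a x ∈ eospGrading q (α + β) :=
  mul_mem_endGrading ℳ (mulL_mem_endGrading ℳ ha) hx

/-- The bracket of `eosp q` is linear over `A` on the left. -/
theorem eospBr_eospL (a : A) (x y : eosp q) :
    eospBr q (eospL q a x) y = eospL q a (eospBr q x y) := by
  refine hom_induction 𝒜 (p := fun a => eospBr q (eospL q a x) y = eospL q a (eospBr q x y))
    ?_ ?_ a
  · intro α a ha
    refine hom_induction (eospGrading q)
      (p := fun x => eospBr q (eospL q a x) y = eospL q a (eospBr q x y)) ?_ ?_ x
    · intro β x hx
      refine hom_induction (eospGrading q)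
        (p := fun y => eospBr q (eospL q a x) y = eospL q a (eospBr q x y)) ?_ ?_ y
      · intro γ y hy
        apply Subtype.ext
        change sbr ℳ (mulL M a * x) y = mulL M a * sbr ℳ x y
        apply end_ext
        intro m
        rw [sbr_apply_hom ℳ (mul_mem_endGrading ℳ (mulL_mem_endGrading ℳ ha) (coe_mem_endGrading q hx))
            (coe_mem_endGrading q hy),
          end_mul_apply, end_mul_apply, end_mul_apply, sbr_apply_hom ℳ (coe_mem_endGrading q hx) (coe_mem_endGrading q hy)]
        simp only [mulL_apply]
        rw [map_smul_of_linear (coe_mem_endGrading q hy) (eosp_linear q y.2) ha]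
        rcases parity_cases α with rfl | rfl <;> rcases parity_cases β with rfl | rfl <;>
          rcases parity_cases γ with rfl | rfl <;> simp [smul_sub]
      · intro y z hy hz
        rw [map_add, hy, hz, map_add, map_add]
    · intro x z hx hz
      simp only [map_add, AddMonoidHom.add_apply, hx, hz]
  · intro a b ha hb
    have h : ∀ z : eosp q, eospL q (a + b) z = eospL q a z + eospL q b z := fun z => by
      apply Subtype.ext
      change mulL M (a + b) * z = mulL M a * z + mulL M b * z
      rw [mulL_add, add_mul]
    rw [h, h, map_add, AddMonoidHom.add_apply, ha, hb]

/-- The bracket of `eosp q` is linear over `A` on the right. -/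
theorem eospBr_eospR (a : A) (x y : eosp q) :
    eospBr q x (eospR q a y) = eospR q a (eospBr q x y) := by
  refine hom_induction 𝒜 (p := fun a => eospBr q x (eospR q a y) = eospR q a (eospBr q x y))
    ?_ ?_ a
  · intro α a ha
    refine hom_induction (eospGrading q)
      (p := fun x => eospBr q x (eospR q a y) = eospR q a (eospBr q x y)) ?_ ?_ x
    · intro β x hx
      refine hom_induction (eospGrading q)
        (p := fun y => eospBr q x (eospR q a y) = eospR q a (eospBr q x y)) ?_ ?_ y
      · intro γ y hy
        apply Subtype.ext
        change sbr ℳ x (y * mulL M a) = sbr ℳ x y * mulL M a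
        apply end_ext
        intro m
        rw [sbr_apply_hom ℳ (coe_mem_endGrading q hx)
            (mul_mem_endGrading ℳ (coe_mem_endGrading q hy) (mulL_mem_endGrading ℳ ha)),
          end_mul_apply, end_mul_apply, end_mul_apply, sbr_apply_hom ℳ (coe_mem_endGrading q hx) (coe_mem_endGrading q hy)]
        simp only [mulL_apply]
        rw [map_smul_of_linear (coe_mem_endGrading q hx) (eosp_linear q x.2) ha]
        rcases parity_cases α with rfl | rfl <;> rcases parity_cases β with rfl | rfl <;>
          rcases parity_cases γ with rfl | rfl <;> simp
      · intro y z hy hz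
        simp only [map_add, hy, hz]
    · intro x z hx hz
      simp only [map_add, AddMonoidHom.add_apply, hx, hz]
  · intro a b ha hb
    have h : ∀ z : eosp q, eospR q (a + b) z = eospR q a z + eospR q b z := fun z => by
      apply Subtype.ext
      change (z : AddMonoid.End M) * mulL M (a + b) = z * mulL M a + z * mulL M b
      rw [mulL_add, mul_add]
    rw [h, h, map_add, ha, hb]

/-- Left linearity of the bracket in the second argument. -/
theorem eospBr_eospL_right {α β : ZMod 2} {a : A} (ha : a ∈ 𝒜 α) {x : eosp q}
    (hx : x ∈ eospGrading q β) (y : eosp q) :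
    eospBr q x (eospL q a y) = sgn (α * β) • eospL q a (eospBr q x y) := by
  refine hom_induction (eospGrading q) (p := fun y => eospBr q x (eospL q a y) =
    sgn (α * β) • eospL q a (eospBr q x y)) ?_ ?_ y
  · intro γ y hy
    apply Subtype.ext
    change sbr ℳ x (mulL M a * y) = sgn (α * β) • (mulL M a * sbr ℳ x y)
    apply end_ext
    intro m
    rw [sbr_apply_hom ℳ (coe_mem_endGrading q hx)
        (mul_mem_endGrading ℳ (mulL_mem_endGrading ℳ ha) (coe_mem_endGrading q hy)),
      end_zsmul_apply, end_mul_apply, end_mul_apply, end_mul_apply, sbr_apply_hom ℳ (coe_mem_endGrading q hx)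
        (coe_mem_endGrading q hy)]
    simp only [mulL_apply]
    rw [map_smul_of_linear (coe_mem_endGrading q hx) (eosp_linear q x.2) ha]
    rcases parity_cases α with rfl | rfl <;> rcases parity_cases β with rfl | rfl <;>
      rcases parity_cases γ with rfl | rfl <;> (simp [smul_sub] <;> abel)
  · intro y z hy hz
    rw [map_add, map_add, hy, hz, map_add, map_add, smul_add]

theorem eospL_eospR (a b : A) (x : eosp q) :
    eospL q a (eospR q b x) = eospR q b (eospL q a x) :=
  Subtype.ext (mul_assoc _ _ _).symm

end LieCoordinates

/-! ### Endomorphisms over a derivation of the coordinate algebra -/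

section Lifts

variable {K A M : Type*} [Ring K] [Ring A] [AddCommGroup M] [Module A M] [Module Aᵐᵒᵖ M]
  {𝒜 : ZMod 2 → AddSubgroup A} {ℳ : ZMod 2 → AddSubgroup M} [GradedRing 𝒜]
  [IsSupercommutative 𝒜] [DirectSum.Decomposition ℳ] [SMulCommClass A Aᵐᵒᵖ M]
  [IsSupermodule 𝒜 ℳ]

/-- `(e, e')` is a hyperbolic pair of even vectors. -/
structure IsHypPair (q : QuadForm 𝒜 ℳ) (e e' : M) : Prop where
  left_mem : e ∈ ℳ 0
  right_mem : e' ∈ ℳ 0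
  left_self : q.form e e = 0
  right_self : q.form e' e' = 0
  pair : q.form e e' = 1

theorem IsHypPair.symm {q : QuadForm 𝒜 ℳ} {e e' : M} (h : IsHypPair q e e') :
    IsHypPair q e' e where
  left_mem := h.right_mem
  right_mem := h.left_mem
  left_self := h.right_self
  right_self := h.left_self
  pair := by
    rw [q.symm h.right_mem h.left_mem, h.pair]
    simp

theorem IsHypPair.form_smul {q : QuadForm 𝒜 ℳ} {e e' : M} (h : IsHypPair q e e') (a : A) :
    q.form e (a • e') = a := by
  rw [smul_eq_op_smul (𝒜 := 𝒜) h.right_mem, q.linear, h.pair, one_mul]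

theorem IsHypPair.mulL_injective {q : QuadForm 𝒜 ℳ} {e e' : M} (h : IsHypPair q e e')
    {a b : A} (hab : mulL M a = mulL M b) : a = b := by
  rw [← h.form_smul a, ← h.form_smul b, ← mulL_apply, hab, mulL_apply]

/-- `S` is an endomorphism of degree `δ` of the module `M` over the endomorphism `D` of the
coefficients, and the form is compatible with the pair `(S, D)`: both maps satisfy the product rules
for scalar multiplication and for the form. -/
structure IsLift (q : QuadForm 𝒜 ℳ) (δ : ZMod 2) (S : AddMonoid.End M) (D : AddMonoid.End A) :
    Prop where
  mem : S ∈ endGrading ℳ δ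
  coeff_mem : D ∈ endGrading 𝒜 δ
  map_smul : ∀ α, ∀ a ∈ 𝒜 α, ∀ m, S (a • m) = D a • m + sgn (δ * α) • (a • S m)
  map_form : ∀ β, ∀ m ∈ ℳ β, ∀ n, D (q.form m n) =
    q.form (S m) n + sgn (δ * β) • q.form m (S n)

variable {q : QuadForm 𝒜 ℳ} {δ : ZMod 2} {S : AddMonoid.End M} {D : AddMonoid.End A}

theorem IsLift.map_op_smul (h : IsLift q δ S D) (a : A) {β : ZMod 2} {m : M} (hm : m ∈ ℳ β) :
    S (op a • m) = op a • S m + sgn (δ * β) • (op (D a) • m) := by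
  refine hom_induction 𝒜 (p := fun a => S (op a • m) =
    op a • S m + sgn (δ * β) • (op (D a) • m)) ?_ ?_ a
  · intro α a ha
    rw [op_smul_eq (𝒜 := 𝒜) ha hm, map_zsmul, h.map_smul α a ha,
      IsSupermodule.smul_eq (𝒜 := 𝒜) (h.coeff_mem α a ha) hm,
      IsSupermodule.smul_eq (𝒜 := 𝒜) ha (h.mem β m hm)]
    rcases parity_cases α with rfl | rfl <;> rcases parity_cases β with rfl | rfl <;>
      rcases parity_cases δ with rfl | rfl <;> simp <;> abel
  · intro a b ha hb
    simp only [op_add, add_smul, map_add, ha, hb, smul_add]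
    abel

theorem IsLift.sbr_mulL (h : IsLift q δ S D) (a : A) : sbr ℳ S (mulL M a) = mulL M (D a) := by
  refine hom_induction 𝒜 (p := fun a => sbr ℳ S (mulL M a) = mulL M (D a)) ?_ ?_ a
  · intro α a ha
    apply end_ext
    intro m
    rw [sbr_apply_hom ℳ h.mem (mulL_mem_endGrading ℳ ha), mulL_apply, mulL_apply, mulL_apply,
      h.map_smul α a ha]
    abel
  · intro a b ha hb
    rw [mulL_add, map_add, ha, hb, map_add, mulL_add]

theorem IsLift.sbr_opE (h : IsLift q δ S D) {α β : ZMod 2} {m n : M} (hm : m ∈ ℳ α)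
    (hn : n ∈ ℳ β) :
    sbr ℳ S (opE q m n) = opE q (S m) n + sgn (δ * α) • opE q m (S n) := by
  apply end_ext
  intro p
  rw [sbr_apply_hom ℳ h.mem (opE_mem_grading q hm hn), end_add_apply, end_zsmul_apply,
    opE_apply q hm hn, opE_apply q hm hn, opE_apply q (h.mem α m hm) hn,
    opE_apply q hm (h.mem β n hn), map_sub, map_zsmul, h.map_op_smul _ hm, h.map_op_smul _ hn,
    h.map_form α m hm, h.map_form β n hn]
  rcases parity_cases α with rfl | rfl <;> rcases parity_cases β with rfl | rfl <;>
    rcases parity_cases δ with rfl | rfl <;> simp [add_smul] <;> abel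

theorem IsLift.sbr_mem_eosp (h : IsLift q δ S D) {x : AddMonoid.End M} (hx : x ∈ eosp q) :
    sbr ℳ S x ∈ eosp q := by
  refine eosp_induction q (p := fun x => sbr ℳ S x ∈ eosp q) ?_ ?_ ?_ ?_ hx
  · rw [map_zero]
    exact zero_mem _
  · intro x y hx hy
    rw [map_add]
    exact add_mem hx hy
  · intro x hx
    rw [map_neg]
    exact neg_mem hx
  · intro α β m hm n hn
    rw [h.sbr_opE hm hn]
    exact add_mem (opE_mem q _ _) (zsmul_mem (opE_mem q _ _) _)

theorem IsLift.coeff_mul (h : IsLift q δ S D) {e e' : M} (he : IsHypPair q e e') {α : ZMod 2}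
    {a : A} (ha : a ∈ 𝒜 α) (b : A) : D (a * b) = D a * b + sgn (δ * α) • (a * D b) := by
  refine hom_induction 𝒜 (p := fun b => D (a * b) = D a * b + sgn (δ * α) • (a * D b)) ?_ ?_ b
  · intro β b hb
    have h1 := h.map_smul _ (a * b) (SetLike.GradedMul.mul_mem ha hb) e'
    rw [mul_smul, h.map_smul α a ha, h.map_smul β b hb] at h1
    have h2 : D (a * b) • e' = (D a * b + sgn (δ * α) • (a * D b)) • e' := by
      rw [add_smul, mul_smul, smul_assoc, mul_smul]
      rcases parity_cases α with rfl | rfl <;> rcases parity_cases β with rfl | rfl <;>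
        rcases parity_cases δ with rfl | rfl <;>
        simp [mul_smul, smul_add, ← add_assoc] at h1 ⊢ <;> exact h1.symm
    rw [← he.form_smul (D (a * b)), h2, he.form_smul]
  · intro b c hb hc
    simp only [mul_add, map_add, hb, hc, smul_add]
    abel

/-- The members of `S_E` of degree `δ` are the `K`-linear maps over some derivation of the
coefficients; in particular the condition `[S, E] ⊆ E` is redundant. -/
theorem mem_sPiece_iff (f : K →+* A) {e e' : M} (he : IsHypPair q e e') :
    S ∈ sPiece f q (eosp q) δ ↔
      (∀ c m, S (op (f c) • m) = op (f c) • S m) ∧ ∃ D, IsLift q δ S D := by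
  have hsym : ∀ β, ∀ m ∈ ℳ β, ∀ γ, ∀ n ∈ ℳ γ, S ∈ endGrading ℳ δ →
      sgn (β * γ) • q.form (S n) m = sgn (δ * β) • q.form m (S n) := by
    intro β m hm γ n hn hS
    rw [q.symm (hS γ n hn) hm]
    rcases parity_cases β with rfl | rfl <;> rcases parity_cases γ with rfl | rfl <;>
      rcases parity_cases δ with rfl | rfl <;> simp
  constructor
  · rintro ⟨h1, h2, h3, h4, h5⟩
    choose D hD using h3
    have hDe : ∀ a, D a = q.form e (sbr ℳ S (mulL M a) e') := fun a => by
      rw [hD, mulL_apply, he.form_smul]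
    have hDa : ∀ a b, D (a + b) = D a + D b := fun a b => by
      rw [hDe, hDe, hDe, mulL_add, map_add, end_add_apply, map_add]
    refine ⟨h2, AddMonoidHom.mk' D hDa, h1, ?_, ?_, ?_⟩
    · intro α a ha
      change D a ∈ _
      rw [hDe]
      have h := q.degree he.left_mem
        (sbr_mem_endGrading ℳ h1 (mulL_mem_endGrading ℳ ha) 0 e' he.right_mem)
      rw [zero_add, zero_add, add_comm] at h
      exact h
    · intro α a ha m
      have h := DFunLike.congr_fun (hD a) m
      rw [sbr_apply_hom ℳ h1 (mulL_mem_endGrading ℳ ha)] at h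
      change S (a • m) = D a • m + sgn (δ * α) • (a • S m)
      exact sub_eq_iff_eq_add.mp h
    · intro β m hm n
      refine hom_induction ℳ (p := fun n => D (q.form m n) =
        q.form (S m) n + sgn (δ * β) • q.form m (S n)) ?_ ?_ n
      · intro γ n hn
        have h := h4 β γ m hm n hn
        rw [hD] at h
        rw [he.mulL_injective h, hsym β m hm γ n hn h1]
      · intro n p hn hp
        simp only [map_add, hDa, hn, hp, smul_add]
        abel
  · rintro ⟨h2, D, h⟩
    refine ⟨h.mem, h2, fun a => ⟨D a, h.sbr_mulL a⟩, ?_, fun x hx => h.sbr_mem_eosp hx⟩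
    intro β γ m hm n hn
    rw [h.sbr_mulL, h.map_form β m hm, hsym β m hm γ n hn h.mem]

/-- Elements of `eosp q` are lifts of the zero derivation. -/
theorem isLift_of_mem_eosp {x : AddMonoid.End M} (hx : x ∈ eosp q) (hδ : x ∈ endGrading ℳ δ) :
    IsLift q δ x 0 where
  mem := hδ
  coeff_mem := zero_mem _
  map_smul := fun α a ha m => by
    rw [map_smul_of_linear hδ (eosp_linear q hx) ha]
    simp
  map_form := fun β m hm n => by
    rw [eosp_skew q hx hδ hm]
    simp

theorem mem_sPiece_of_mem_eosp (f : K →+* A) {e e' : M} (he : IsHypPair q e e')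
    {x : AddMonoid.End M} (hx : x ∈ eosp q) (hδ : x ∈ endGrading ℳ δ) :
    x ∈ sPiece f q (eosp q) δ :=
  (mem_sPiece_iff f he).mpr ⟨fun c m => eosp_linear q hx (f c) m, 0, isLift_of_mem_eosp hx hδ⟩

theorem eosp_le_sE (f : K →+* A) {e e' : M} (he : IsHypPair q e e') :
    eosp q ≤ sE f q (eosp q) := by
  intro x hx
  rw [← endPart_add ℳ x]
  exact AddSubgroup.add_mem_sup
    (mem_sPiece_of_mem_eosp f he (endPart_mem_eosp q 0 hx) (endPart_mem ℳ 0 x))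
    (mem_sPiece_of_mem_eosp f he (endPart_mem_eosp q 1 hx) (endPart_mem ℳ 1 x))

/-- A `K`-linear lift of `D` forces `D` to vanish on the image of `K`. -/
theorem IsLift.coeff_map_eq_zero (h : IsLift q δ S D) {e e' : M} (he : IsHypPair q e e')
    (f : K →+* A) (hK : ∀ c m, S (op (f c) • m) = op (f c) • S m) (c : K) : D (f c) = 0 := by
  have h1 := h.map_op_smul (f c) he.right_mem
  rw [hK] at h1
  have h2 : D (f c) • e' = 0 := by
    rw [smul_eq_op_smul (𝒜 := 𝒜) he.right_mem]
    simpa using h1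
  rw [← he.form_smul (D (f c)), h2, map_zero]

end Lifts

/-! ### The derivations `d_{S,0}` -/

section OuterDerivations

variable {K A M : Type*} [Ring K] [Ring A] [AddCommGroup M] [Module A M] [Module Aᵐᵒᵖ M]
  {𝒜 : ZMod 2 → AddSubgroup A} {ℳ : ZMod 2 → AddSubgroup M} [GradedRing 𝒜]
  [IsSupercommutative 𝒜] [DirectSum.Decomposition ℳ] [SMulCommClass A Aᵐᵒᵖ M]
  [IsSupermodule 𝒜 ℳ] {q : QuadForm 𝒜 ℳ}

/-- `S` normalizes the scalars, acting on them through `D`, and it normalizes `eosp q`. These are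
the conditions under which `d_{S,0}` makes sense. -/
structure Normalizes (q : QuadForm 𝒜 ℳ) (S : AddMonoid.End M) (D : AddMonoid.End A) : Prop where
  coeff : ∀ a, sbr ℳ S (mulL M a) = mulL M (D a)
  sbr_mem : ∀ x ∈ eosp q, sbr ℳ S x ∈ eosp q

theorem IsLift.normalizes {δ : ZMod 2} {S : AddMonoid.End M} {D : AddMonoid.End A}
    (h : IsLift q δ S D) : Normalizes q S D :=
  ⟨h.sbr_mulL, fun _ hx => h.sbr_mem_eosp hx⟩

theorem Normalizes.add {S T : AddMonoid.End M} {D E : AddMonoid.End A}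
    (h : Normalizes q S D) (h' : Normalizes q T E) : Normalizes q (S + T) (D + E) where
  coeff := fun a => by
    rw [map_add, AddMonoidHom.add_apply, h.coeff, h'.coeff, end_add_apply, mulL_add]
  sbr_mem := fun x hx => by
    rw [map_add, AddMonoidHom.add_apply]
    exact add_mem (h.sbr_mem x hx) (h'.sbr_mem x hx)

/-- The endomorphism `d_{S,0}`. -/
def outerMap (q : QuadForm 𝒜 ℳ) {S : AddMonoid.End M} {D : AddMonoid.End A}
    (h : Normalizes q S D) : AddMonoid.End (eosp (qInf q)) :=
  AddMonoidHom.mk' (fun y => ofCoord q (D ((ofCoord q).symm y).1, S ((ofCoord q).symm y).2.1,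
      S ((ofCoord q).symm y).2.2.1,
      ⟨sbr ℳ S ((ofCoord q).symm y).2.2.2, h.sbr_mem _ ((ofCoord q).symm y).2.2.2.2⟩))
    (by
      intro y z
      rw [← map_add]
      congr 1
      refine Prod.ext ?_ (Prod.ext ?_ (Prod.ext ?_ (Subtype.ext ?_))) <;>
        simp only [map_add, Prod.fst_add, Prod.snd_add, AddSubgroup.coe_add])

theorem outerMap_ofCoord {S : AddMonoid.End M} {D : AddMonoid.End A} (h : Normalizes q S D)
    (a : A) (m n : M) (x : eosp q) : outerMap q h (ofCoord q (a, m, n, x)) =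
      ofCoord q (D a, S m, S n, ⟨sbr ℳ S x, h.sbr_mem x x.2⟩) := by
  change ofCoord q (D ((ofCoord q).symm (ofCoord q (a, m, n, x))).1, _, _, _) = _
  congr 1
  refine Prod.ext ?_ (Prod.ext ?_ (Prod.ext ?_ (Subtype.ext ?_))) <;>
    simp only [AddEquiv.symm_apply_apply]

variable {e e' : M}

theorem isOuter_iff (he : IsHypPair q e e') {S : AddMonoid.End M} {D : AddMonoid.End A}
    (h : Normalizes q S D) {d : AddMonoid.End (eosp (qInf q))} :
    IsOuter q S d ↔ d = outerMap q h := by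
  constructor
  · intro hd
    apply end_ext
    intro y
    obtain ⟨a, m, n, x, rfl⟩ := exists_ofCoord q y
    rw [outerMap_ofCoord]
    obtain ⟨b, hb, hb'⟩ := hd a m n x x.2 (ofCoord q (a, m, n, x)) rfl
    rw [h.coeff] at hb
    have hb1 := he.mulL_injective hb
    subst hb1
    exact Subtype.ext hb'
  · rintro rfl a m n x hx y hy
    refine ⟨D a, h.coeff a, ?_⟩
    have h1 : y = ofCoord q (a, m, n, ⟨x, hx⟩) := Subtype.ext hy
    rw [h1, outerMap_ofCoord]
    rfl

theorem isOuter_outerMap (he : IsHypPair q e e') {S : AddMonoid.End M} {D : AddMonoid.End A}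
    (h : Normalizes q S D) : IsOuter q S (outerMap q h) := (isOuter_iff he h).mpr rfl

variable (f : K →+* A)

theorem exists_isLift_of_mem_sE (he : IsHypPair q e e') {S : AddMonoid.End M}
    (hS : S ∈ sE f q (eosp q)) (α : ZMod 2) : ∃ D, IsLift q α (endPart ℳ α S) D :=
  ((mem_sPiece_iff f he).mp ((mem_sup_pieces ℳ (D := sPiece f q (eosp q))
    (fun _ _ h => And.left h)).mp hS α)).2

theorem exists_normalizes (he : IsHypPair q e e') {S : AddMonoid.End M}
    (hS : S ∈ sE f q (eosp q)) : ∃ D, Normalizes q S D := by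
  obtain ⟨D, hD⟩ := exists_isLift_of_mem_sE f he hS 0
  obtain ⟨D', hD'⟩ := exists_isLift_of_mem_sE f he hS 1
  refine ⟨D + D', ?_⟩
  rw [← endPart_add ℳ S]
  exact hD.normalizes.add hD'.normalizes

theorem existsUnique_isOuter (he : IsHypPair q e e') {S : AddMonoid.End M}
    (hS : S ∈ sE f q (eosp q)) : ∃! d, IsOuter q S d := by
  obtain ⟨D, hD⟩ := exists_normalizes f he hS
  exact ⟨outerMap q hD, isOuter_outerMap he hD, fun d hd => (isOuter_iff he hD).mp hd⟩

/-- The endomorphism `d_{S,0}` determines `S`. -/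
theorem IsOuter.injective {S T : AddMonoid.End M} {d : AddMonoid.End (eosp (qInf q))}
    (hS : IsOuter q S d) (hT : IsOuter q T d) : S = T := by
  apply end_ext
  intro m
  obtain ⟨b, -, hb⟩ := hS 0 m 0 0 (zero_mem _) (ofCoord q (0, m, 0, 0)) rfl
  obtain ⟨c, -, hc⟩ := hT 0 m 0 0 (zero_mem _) (ofCoord q (0, m, 0, 0)) rfl
  rw [hb] at hc
  exact congrArg (fun t => t.2.1) (coord_injective q hc)

theorem IsOuter.add {S T : AddMonoid.End M} {d d' : AddMonoid.End (eosp (qInf q))}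
    (hS : IsOuter q S d) (hT : IsOuter q T d') : IsOuter q (S + T) (d + d') := by
  intro a m n x hx y hy
  obtain ⟨b, hb, hb1⟩ := hS a m n x hx y hy
  obtain ⟨c, hc, hc1⟩ := hT a m n x hx y hy
  refine ⟨b + c, ?_, ?_⟩
  · rw [map_add, AddMonoidHom.add_apply, hb, hc, mulL_add]
  · rw [end_add_apply, AddSubgroup.coe_add, hb1, hc1, ← map_add, map_add (sbr ℳ) S T]
    rfl

theorem outerMap_mem_endGrading {δ : ZMod 2} {S : AddMonoid.End M} {D : AddMonoid.End A}
    (h : IsLift q δ S D) : outerMap q h.normalizes ∈ endGrading (eospGrading (qInf q)) δ := by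
  intro γ y hy
  obtain ⟨a, ha, m, hm, n, hn, x, hx, rfl⟩ := exists_hom_ofCoord q hy
  rw [outerMap_ofCoord]
  refine ofCoord_mem q (h.coeff_mem γ a ha) (h.mem γ m hm) (h.mem γ n hn) ?_
  rw [add_comm]
  exact sbr_mem_endGrading ℳ h.mem (coe_mem_endGrading q hx)

theorem IsLift.sbr_mul_mulL {δ : ZMod 2} {S : AddMonoid.End M} {D : AddMonoid.End A}
    (h : IsLift q δ S D) {α : ZMod 2} {x : AddMonoid.End M} (hx : x ∈ endGrading ℳ α) (b : A) :
    sbr ℳ S (x * mulL M b) = sbr ℳ S x * mulL M b + sgn (δ * α) • (x * mulL M (D b)) := by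
  refine hom_induction 𝒜 (p := fun b => sbr ℳ S (x * mulL M b) =
    sbr ℳ S x * mulL M b + sgn (δ * α) • (x * mulL M (D b))) ?_ ?_ b
  · intro β b hb
    apply end_ext
    intro m
    rw [sbr_apply_hom ℳ h.mem (mul_mem_endGrading ℳ hx (mulL_mem_endGrading ℳ hb)),
      end_add_apply, end_zsmul_apply, end_mul_apply, end_mul_apply, end_mul_apply, end_mul_apply,
      sbr_apply_hom ℳ h.mem hx, mulL_apply, mulL_apply, mulL_apply, h.map_smul β b hb]
    rcases parity_cases α with rfl | rfl <;> rcases parity_cases β with rfl | rfl <;>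
      rcases parity_cases δ with rfl | rfl <;> simp <;> abel
  · intro b c hb hc
    simp only [mulL_add, map_add, mul_add, hb, hc, zsmul_add]
    abel

/-- The endomorphism `d_{S,0}` is a derivation: this is where the compatibility of `S` with the form
and with the scalars is needed. -/
theorem outerMap_mem_derPiece (he : IsHypPair q e e') {δ : ZMod 2} {S : AddMonoid.End M}
    {D : AddMonoid.End A} (h : IsLift q δ S D)
    (hK : ∀ c m, S (op (f c) • m) = op (f c) • S m) :
    outerMap q h.normalizes ∈ derPiece (eospGrading (qInf q)) (fun c => eospR (qInf q) (f c))
      (eospBr (qInf q)) δ := by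
  have hD0 := h.coeff_map_eq_zero he f hK
  refine ⟨outerMap_mem_endGrading h, fun c y => ?_, fun β y hy z => ?_⟩
  · refine ofCoord_induction q (p := fun y => outerMap q h.normalizes (eospR (qInf q) (f c) y) =
      eospR (qInf q) (f c) (outerMap q h.normalizes y)) ?_ ?_ y
    · intro α a ha m hm n hn x hx
      rw [eospR_ofCoord, outerMap_ofCoord, outerMap_ofCoord, eospR_ofCoord]
      congr 1
      refine Prod.ext ?_ (Prod.ext (hK c m) (Prod.ext (hK c n) (Subtype.ext ?_)))
      · change D (a * f c) = D a * f c
        rw [h.coeff_mul he ha, hD0]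
        simp
      · change sbr ℳ S (x * mulL M (f c)) = sbr ℳ S x * mulL M (f c)
        rw [h.sbr_mul_mulL (coe_mem_endGrading q hx), hD0, mulL_zero]
        simp
    · intro y z hy hz
      rw [map_add, map_add, hy, hz, map_add, map_add]
  · obtain ⟨a, ha, m, hm, n, hn, x, hx, rfl⟩ := exists_hom_ofCoord q hy
    refine ofCoord_induction q (p := fun z => outerMap q h.normalizes
      (eospBr (qInf q) (ofCoord q (a, m, n, x)) z) =
        eospBr (qInf q) (outerMap q h.normalizes (ofCoord q (a, m, n, x))) z +
        sgn (δ * β) • eospBr (qInf q) (ofCoord q (a, m, n, x)) (outerMap q h.normalizes z))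
        ?_ ?_ z
    · intro γ a' ha' m' hm' n' hn' x' hx'
      have hx1 := coe_mem_endGrading q hx
      have hx1' := coe_mem_endGrading q hx'
      have hSx : (⟨sbr ℳ S x, h.normalizes.sbr_mem x x.2⟩ : eosp q) ∈ eospGrading q (β + δ) := by
        rw [add_comm]
        exact sbr_mem_endGrading ℳ h.mem hx1
      have hSx' : (⟨sbr ℳ S x', h.normalizes.sbr_mem x' x'.2⟩ : eosp q) ∈
          eospGrading q (γ + δ) := by
        rw [add_comm]
        exact sbr_mem_endGrading ℳ h.mem hx1'
      rw [eospBr_ofCoord q ha hm hn hx ha' hm' hn' hx', outerMap_ofCoord, outerMap_ofCoord,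
        outerMap_ofCoord, eospBr_ofCoord q (h.coeff_mem β a ha) (h.mem β m hm) (h.mem β n hn) hSx
          ha' hm' hn' hx',
        eospBr_ofCoord q ha hm hn hx (h.coeff_mem γ a' ha') (h.mem γ m' hm') (h.mem γ n' hn') hSx',
        ← map_zsmul (ofCoord q), ← map_add (ofCoord q)]
      congr 1
      refine Prod.ext ?_ (Prod.ext ?_ (Prod.ext ?_ (Subtype.ext ?_)))
      · change D (q.form m n' - q.form n m') = q.form (S m) n' - q.form (S n) m' +
          sgn (δ * β) • (q.form m (S n') - q.form n (S m'))
        rw [map_sub, h.map_form β m hm, h.map_form β n hn, smul_sub]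
        abel
      · change S (a • m' + (x : AddMonoid.End M) m' - op a' • m -
            sgn (β * γ) • (x' : AddMonoid.End M) m) =
          (D a • m' + sbr ℳ S x m' - op a' • S m -
            sgn ((β + δ) * γ) • (x' : AddMonoid.End M) (S m)) +
          sgn (δ * β) • (a • S m' + (x : AddMonoid.End M) (S m') - op (D a') • m -
            sgn (β * (γ + δ)) • sbr ℳ S x' m)
        rw [map_sub, map_sub, map_add, map_zsmul, h.map_smul β a ha, h.map_op_smul _ hm,
          sbr_apply_hom ℳ h.mem hx1, sbr_apply_hom ℳ h.mem hx1']
        rcases parity_cases β with rfl | rfl <;> rcases parity_cases γ with rfl | rfl <;>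
          rcases parity_cases δ with rfl | rfl <;> simp <;> abel
      · change S (-(a • n') + (x : AddMonoid.End M) n' + op a' • n -
            sgn (β * γ) • (x' : AddMonoid.End M) n) =
          (-(D a • n') + sbr ℳ S x n' + op a' • S n -
            sgn ((β + δ) * γ) • (x' : AddMonoid.End M) (S n)) +
          sgn (δ * β) • (-(a • S n') + (x : AddMonoid.End M) (S n') + op (D a') • n -
            sgn (β * (γ + δ)) • sbr ℳ S x' n)
        rw [map_sub, map_add, map_add, map_neg, map_zsmul, h.map_smul β a ha, h.map_op_smul _ hn,
          sbr_apply_hom ℳ h.mem hx1, sbr_apply_hom ℳ h.mem hx1']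
        rcases parity_cases β with rfl | rfl <;> rcases parity_cases γ with rfl | rfl <;>
          rcases parity_cases δ with rfl | rfl <;> simp <;> abel
      · change sbr ℳ S (opE q m n' + opE q n m' + sbr ℳ (x : AddMonoid.End M) x') =
          (opE q (S m) n' + opE q (S n) m' + sbr ℳ (sbr ℳ S x) x') +
          sgn (δ * β) • (opE q m (S n') + opE q n (S m') + sbr ℳ x (sbr ℳ S x'))
        rw [map_add, map_add, h.sbr_opE hm hn', h.sbr_opE hn hm', sbr_jacobi ℳ h.mem hx1 hx1',
          zsmul_add, zsmul_add]
        abel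
    · intro y z hy hz
      simp only [map_add, hy, hz, smul_add]
      abel

/-- The composite of `d_{S,0}` and `d_{T,0}` in coordinates gives `[d_{S,0}, d_{T,0}] = d_{[S,T],0}`
for homogeneous `S` and `T`. -/
theorem IsOuter.sbr_hom (he : IsHypPair q e e') {α β : ZMod 2} {S T : AddMonoid.End M}
    {D D' : AddMonoid.End A} (hS : IsLift q α S D) (hT : IsLift q β T D')
    {d d' : AddMonoid.End (eosp (qInf q))} (hd : IsOuter q S d) (hd' : IsOuter q T d') :
    IsOuter q (sbr ℳ S T) (sbr (eospGrading (qInf q)) d d') := by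
  rw [isOuter_iff he hS.normalizes] at hd
  rw [isOuter_iff he hT.normalizes] at hd'
  subst hd hd'
  have key : ∀ U : AddMonoid.End M, ∀ γ, U ∈ endGrading ℳ γ →
      sbr ℳ (sbr ℳ S T) U = sbr ℳ S (sbr ℳ T U) - sgn (α * β) • sbr ℳ T (sbr ℳ S U) := by
    intro U γ hU
    rw [sbr_jacobi ℳ hS.mem hT.mem hU]
    abel
  have key' : ∀ U : AddMonoid.End M,
      sbr ℳ (sbr ℳ S T) U = sbr ℳ S (sbr ℳ T U) - sgn (α * β) • sbr ℳ T (sbr ℳ S U) := by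
    intro U
    rw [← endPart_add ℳ U]
    simp only [map_add]
    rw [key _ 0 (endPart_mem ℳ 0 U), key _ 1 (endPart_mem ℳ 1 U), zsmul_add]
    abel
  intro a m n x hx y hy
  refine ⟨D (D' a) - sgn (α * β) • D' (D a), ?_, ?_⟩
  · rw [key', hT.sbr_mulL, hS.sbr_mulL, hS.sbr_mulL, hT.sbr_mulL, sub_eq_add_neg, ← neg_smul,
      sub_eq_add_neg, ← neg_smul, mulL_add]
    congr 1
    rcases parity_cases (α * β) with h | h <;> simp [h, mulL_neg]
  · have h1 : y = ofCoord q (a, m, n, ⟨x, hx⟩) := Subtype.ext hy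
    rw [h1, sbr_apply_hom _ (outerMap_mem_endGrading hS) (outerMap_mem_endGrading hT),
      outerMap_ofCoord, outerMap_ofCoord, outerMap_ofCoord, outerMap_ofCoord,
      ← map_zsmul (ofCoord q), ← map_sub (ofCoord q), coe_ofCoord, key', sbr_apply_hom ℳ hS.mem hT.mem, sbr_apply_hom ℳ hS.mem hT.mem]
    rfl

theorem part_op_smul {α : ZMod 2} {a : A} (ha : a ∈ 𝒜 α) (γ : ZMod 2) (m : M) :
    part ℳ (α + γ) (op a • m) = op a • part ℳ γ m := by
  refine hom_induction ℳ (p := fun m => part ℳ (α + γ) (op a • m) = op a • part ℳ γ m) ?_ ?_ m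
  · intro β m hm
    have h := op_smul_mem (𝒜 := 𝒜) ha hm
    by_cases hβ : β = γ
    · subst hβ
      rw [part_same ℳ h, part_same ℳ hm]
    · rw [part_ne ℳ h (fun e => hβ (add_left_cancel e)), part_ne ℳ hm hβ, smul_zero]
  · intro m n hm hn
    rw [smul_add, map_add, hm, hn, map_add, smul_add]

include 𝒜 in
theorem endPart_linear {x : AddMonoid.End M} (hx : ∀ (a : A) m, x (op a • m) = op a • x m)
    (δ : ZMod 2) (a : A) (m : M) : endPart ℳ δ x (op a • m) = op a • endPart ℳ δ x m := by
  refine hom_induction 𝒜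
    (p := fun a => endPart ℳ δ x (op a • m) = op a • endPart ℳ δ x m) ?_ ?_ a
  · intro α a ha
    refine hom_induction ℳ
      (p := fun m => endPart ℳ δ x (op a • m) = op a • endPart ℳ δ x m) ?_ ?_ m
    · intro β m hm
      rw [endPart_apply_hom ℳ (op_smul_mem (𝒜 := 𝒜) ha hm), endPart_apply_hom ℳ hm, hx,
        add_assoc, part_op_smul ha]
    · intro m n hm hn
      rw [smul_add, map_add, hm, hn, map_add, smul_add]
  · intro a b ha hb
    simp only [op_add, add_smul, map_add, ha, hb]

/-- The homogeneous case of `sbr_mulL_mul`. -/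
theorem mulL_mul_sbr {δ : ZMod 2} {S : AddMonoid.End M} (hS : S ∈ endGrading ℳ δ) {γ : ZMod 2}
    {c : A} (hc : c ∈ 𝒜 γ) {x : AddMonoid.End M} (hx : ∀ (a : A) m, x (op a • m) = op a • x m) :
    sbr ℳ (mulL M c * S) x = mulL M c * sbr ℳ S x := by
  have key : ∀ α, ∀ y ∈ endGrading ℳ α, (∀ (a : A) m, y (op a • m) = op a • y m) →
      sbr ℳ (mulL M c * S) y = mulL M c * sbr ℳ S y := by
    intro α y hy hy1
    apply end_ext
    intro m
    rw [sbr_apply_hom ℳ (mul_mem_endGrading ℳ (mulL_mem_endGrading ℳ hc) hS) hy, end_mul_apply,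
      end_mul_apply, end_mul_apply, sbr_apply_hom ℳ hS hy, mulL_apply, mulL_apply, mulL_apply,
      map_smul_of_linear hy hy1 hc, smul_sub, smul_comm c (sgn (δ * α)), smul_smul]
    congr 2
    rcases parity_cases α with rfl | rfl <;> rcases parity_cases γ with rfl | rfl <;>
      rcases parity_cases δ with rfl | rfl <;> simp
  rw [← endPart_add ℳ x, map_add, map_add, mul_add,
    key 0 _ (endPart_mem ℳ 0 x) (endPart_linear (𝒜 := 𝒜) hx 0),
    key 1 _ (endPart_mem ℳ 1 x) (endPart_linear (𝒜 := 𝒜) hx 1)]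

end OuterDerivations

/-! ### The subalgebras `d_{T,0}` -/

section OuterSubalgebra

variable {K A M : Type*} [Ring K] [Ring A] [AddCommGroup M] [Module A M] [Module Aᵐᵒᵖ M]
  {𝒜 : ZMod 2 → AddSubgroup A} {ℳ : ZMod 2 → AddSubgroup M} [GradedRing 𝒜]
  [IsSupercommutative 𝒜] [DirectSum.Decomposition ℳ] [SMulCommClass A Aᵐᵒᵖ M]
  [IsSupermodule 𝒜 ℳ] {q : QuadForm 𝒜 ℳ} {e e' : M}

include 𝒜 in
/-- The super bracket with a right linear map is linear over `A` on the left. -/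
theorem sbr_mulL_mul (c : A) (S : AddMonoid.End M) {x : AddMonoid.End M}
    (hx : ∀ (a : A) m, x (op a • m) = op a • x m) :
    sbr ℳ (mulL M c * S) x = mulL M c * sbr ℳ S x := by
  refine hom_induction 𝒜 (p := fun c => sbr ℳ (mulL M c * S) x = mulL M c * sbr ℳ S x) ?_ ?_ c
  · intro γ c hc
    have h : ∀ α, sbr ℳ (mulL M c * endPart ℳ α S) x = mulL M c * sbr ℳ (endPart ℳ α S) x :=
      fun α => mulL_mul_sbr (endPart_mem ℳ α S) hc hx
    rw [← endPart_add ℳ S, mul_add, map_add, map_add, AddMonoidHom.add_apply,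
      AddMonoidHom.add_apply, h, h, mul_add]
  · intro a b ha hb
    rw [mulL_add, add_mul, map_add, AddMonoidHom.add_apply, ha, hb, add_mul]

theorem IsOuter.mulL_mul {S : AddMonoid.End M} {d : AddMonoid.End (eosp (qInf q))}
    (h : IsOuter q S d) (c : A) : IsOuter q (mulL M c * S) (eospL (qInf q) c * d) := by
  intro a m n x hx y hy
  obtain ⟨b, hb, hb'⟩ := h a m n x hx y hy
  refine ⟨c * b, ?_, ?_⟩
  · rw [sbr_mulL_mul (𝒜 := 𝒜) c S (fun b m => smul_comm a (op b) m), hb, SuperLie.mulL_mul]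
  · rw [sbr_mulL_mul (𝒜 := 𝒜) c S (eosp_linear q hx)]
    change mulL _ c * (d y : AddMonoid.End (Hyp Unit A × M)) = _
    rw [hb']
    apply end_ext
    intro v
    rw [end_mul_apply, mulL_apply]
    apply hypUnit_ext
    · simp [coord_inl, form_smul_left, mul_sub, mul_assoc]
    · simp [coord_inr, form_smul_left, mul_sub, mul_assoc]
    · simp only [coord_snd, Prod.smul_snd, smul_add, smul_sub, end_mul_apply, mulL_apply,
        smul_comm c (op _)]

variable (f : K →+* A)

theorem IsOuter.endPart_of_mem_sE (he : IsHypPair q e e') {S : AddMonoid.End M}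
    (hS : S ∈ sE f q (eosp q)) {d : AddMonoid.End (eosp (qInf q))} (h : IsOuter q S d)
    (α : ZMod 2) : IsOuter q (endPart ℳ α S) (endPart (eospGrading (qInf q)) α d) := by
  choose D hD using exists_isLift_of_mem_sE f he hS
  have h0 := isOuter_outerMap he (hD 0).normalizes
  have h1 := isOuter_outerMap he (hD 1).normalizes
  have h2 := h0.add h1
  rw [endPart_add] at h2
  rw [(existsUnique_isOuter f he hS).unique h h2, map_add]
  have m0 := outerMap_mem_endGrading (hD 0)
  have m1 := outerMap_mem_endGrading (hD 1)
  rcases parity_cases α with rfl | rfl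
  · rwa [endPart_same _ m0, endPart_ne _ m1 (by decide), add_zero]
  · rwa [endPart_same _ m1, endPart_ne _ m0 (by decide), zero_add]

theorem isSubalgebra_outer (he : IsHypPair q e e') {T : AddSubgroup (AddMonoid.End M)}
    (hT : T ≤ sE f q (eosp q)) (hs : IsSubalgebra ℳ (fun c => mulL M (f c)) T) :
    IsSubalgebra (eospGrading (qInf q)) (fun c => eospL (qInf q) (f c)) (outer q T) := by
  have hpart : ∀ α, ∀ d ∈ outer q T, endPart (eospGrading (qInf q)) α d ∈ outer q T := by
    rintro α d ⟨S, hS, hd⟩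
    exact ⟨_, hs.part_mem α S hS, hd.endPart_of_mem_sE f he (hT hS) α⟩
  refine ⟨hpart, ?_, ?_⟩
  · rintro c d ⟨S, hS, hd⟩
    exact ⟨_, hs.smul_mem c S hS, hd.mulL_mul (f c)⟩
  · refine sbr_mem_of_hom _ hpart hpart ?_
    rintro α β d ⟨S, hS, hd⟩ hdα d' ⟨S', hS', hd'⟩ hdβ
    have h1 := hd.endPart_of_mem_sE f he (hT hS) α
    have h2 := hd'.endPart_of_mem_sE f he (hT hS') β
    rw [endPart_same _ hdα] at h1
    rw [endPart_same _ hdβ] at h2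
    obtain ⟨D, hD⟩ := exists_isLift_of_mem_sE f he (hT hS) α
    obtain ⟨D', hD'⟩ := exists_isLift_of_mem_sE f he (hT hS') β
    exact ⟨_, hs.bracket_mem _ (hs.part_mem α S hS) _ (hs.part_mem β S' hS'),
      IsOuter.sbr_hom he hD hD' h1 h2⟩

theorem outer_le_derEosp (he : IsHypPair q e e') : outer q (sE f q (eosp q)) ≤
    derEosp f (qInf q) := by
  rintro d ⟨S, hS, hd⟩
  have key : ∀ α, endPart (eospGrading (qInf q)) α d ∈ derEosp f (qInf q) := by
    intro α
    have h1 := (mem_sup_pieces ℳ (D := sPiece f q (eosp q)) (fun _ _ h => And.left h)).mp hS α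
    obtain ⟨hK, D, hD⟩ := (mem_sPiece_iff f he).mp h1
    rw [(isOuter_iff he hD.normalizes).mp (hd.endPart_of_mem_sE f he hS α)]
    exact mem_sup_of_mem_piece (outerMap_mem_derPiece f he hD hK)
  rw [← endPart_add (eospGrading (qInf q)) d]
  exact add_mem (key 0) (key 1)

theorem outer_mono {T U : AddSubgroup (AddMonoid.End M)} (h : T ≤ U) : outer q T ≤ outer q U :=
  fun _ ⟨S, hS, hd⟩ => ⟨S, h hS, hd⟩

end OuterSubalgebra

/-! ### Inner and locally inner derivations -/

section Inner

variable {K A M : Type*} [Ring K] [Ring A] [AddCommGroup M] [Module A M] [Module Aᵐᵒᵖ M]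
  {𝒜 : ZMod 2 → AddSubgroup A} {ℳ : ZMod 2 → AddSubgroup M} [GradedRing 𝒜]
  [IsSupercommutative 𝒜] [DirectSum.Decomposition ℳ] [SMulCommClass A Aᵐᵒᵖ M]
  [IsSupermodule 𝒜 ℳ] (f : K →+* A) (q : QuadForm 𝒜 ℳ)

/-- The inner derivation `ad z` of `eosp q`. -/
def adE (z : eosp q) : AddMonoid.End (eosp q) := eospBr q z

theorem adE_apply (z x : eosp q) : adE q z x = eospBr q z x := rfl

theorem adE_add (z w : eosp q) : adE q (z + w) = adE q z + adE q w := map_add (eospBr q) z w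

theorem mem_adOf {U : AddSubgroup (eosp q)} {d : AddMonoid.End (eosp q)} :
    d ∈ adOf (eospBr q) U ↔ ∃ z ∈ U, d = adE q z := by
  constructor
  · rintro ⟨z, hz, rfl⟩
    exact ⟨z, hz, rfl⟩
  · rintro ⟨z, hz, rfl⟩
    exact ⟨z, hz, rfl⟩

theorem adE_mem_adOf (z : eosp q) : adE q z ∈ adOf (eospBr q) ⊤ :=
  (mem_adOf q).mpr ⟨z, trivial, rfl⟩

theorem adE_mem_endGrading {α : ZMod 2} {z : eosp q} (hz : z ∈ eospGrading q α) :
    adE q z ∈ endGrading (eospGrading q) α := by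
  intro γ x hx
  rw [add_comm]
  exact eospBr_mem q hz hx

theorem adE_mem_derPiece {α : ZMod 2} {z : eosp q} (hz : z ∈ eospGrading q α) :
    adE q z ∈ derPiece (eospGrading q) (fun c => eospR q (f c)) (eospBr q) α := by
  refine ⟨adE_mem_endGrading q hz, fun c x => eospBr_eospR q (f c) z x, fun β x hx y => ?_⟩
  refine hom_induction (eospGrading q) (p := fun y => adE q z (eospBr q x y) =
    eospBr q (adE q z x) y + sgn (α * β) • eospBr q x (adE q z y)) ?_ ?_ y
  · intro γ y hy
    exact eospBr_jacobi q hz hx hy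
  · intro y w hy hw
    simp only [map_add, hy, hw, smul_add]
    abel

theorem adE_part (α : ZMod 2) (z : eosp q) :
    endPart (eospGrading q) α (adE q z) = adE q (part (eospGrading q) α z) := by
  conv_lhs => rw [← part_add (eospGrading q) z, adE_add, map_add]
  have h0 := adE_mem_endGrading q (part_mem (eospGrading q) 0 z)
  have h1 := adE_mem_endGrading q (part_mem (eospGrading q) 1 z)
  rcases parity_cases α with rfl | rfl
  · rw [endPart_same _ h0, endPart_ne _ h1 (by decide), add_zero]
  · rw [endPart_same _ h1, endPart_ne _ h0 (by decide), zero_add]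

theorem adE_mem_derEosp (z : eosp q) : adE q z ∈ derEosp f q := by
  refine (mem_der_iff (eospGrading q) (fun c => eospR q (f c)) (eospBr q)).mpr ?_
  intro α
  rw [adE_part]
  exact adE_mem_derPiece f q (part_mem (eospGrading q) α z)

theorem adE_mem_adLoc (z : eosp q) : adE q z ∈ adLocEosp f q :=
  ⟨adE_mem_derEosp f q z, fun _ => ⟨z, fun _ _ => rfl⟩⟩

theorem adOf_le_adLoc : adOf (eospBr q) ⊤ ≤ adLocEosp f q := by
  rintro d hd
  obtain ⟨z, -, rfl⟩ := (mem_adOf q).mp hd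
  exact adE_mem_adLoc f q z

theorem eospL_add (a b : A) : eospL q (a + b) = eospL q a + eospL q b := by
  apply end_ext
  intro x
  apply Subtype.ext
  change mulL M (a + b) * x = mulL M a * x + mulL M b * x
  rw [mulL_add, add_mul]

theorem eospL_mul_mem_derPiece {γ δ : ZMod 2} {c : A} (hc : c ∈ 𝒜 γ) {d : AddMonoid.End (eosp q)}
    (hd : d ∈ derPiece (eospGrading q) (fun c => eospR q (f c)) (eospBr q) δ) :
    eospL q c * d ∈ derPiece (eospGrading q) (fun c => eospR q (f c)) (eospBr q) (γ + δ) := by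
  refine ⟨?_, fun k x => ?_, fun β x hx y => ?_⟩
  · intro α x hx
    have h := eospL_mem q hc (hd.1 α x hx)
    rwa [← add_assoc, add_comm γ α, add_assoc] at h
  · rw [end_mul_apply, end_mul_apply, hd.2.1, eospL_eospR]
  · rw [end_mul_apply, end_mul_apply, end_mul_apply, hd.2.2 β x hx, map_add, map_zsmul,
      eospBr_eospL, eospBr_eospL_right q hc hx, smul_smul]
    congr 2
    rcases parity_cases β with rfl | rfl <;> rcases parity_cases γ with rfl | rfl <;>
      rcases parity_cases δ with rfl | rfl <;> simp

theorem eospL_mul_mem_derEosp (c : A) {d : AddMonoid.End (eosp q)} (hd : d ∈ derEosp f q) :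
    eospL q c * d ∈ derEosp f q := by
  have key : ∀ α, eospL q c * endPart (eospGrading q) α d ∈ derEosp f q := by
    intro α
    refine hom_induction 𝒜
      (p := fun c => eospL q c * endPart (eospGrading q) α d ∈ derEosp f q) ?_ ?_ c
    · intro γ c hc
      exact mem_sup_of_mem_piece (eospL_mul_mem_derPiece f q hc ((mem_der_iff _ _ _).mp hd α))
    · intro a b ha hb
      rw [eospL_add, add_mul]
      exact add_mem ha hb
  rw [← endPart_add (eospGrading q) d, mul_add]
  exact add_mem (key 0) (key 1)

theorem isSubalgebra_derEosp :
    IsSubalgebra (eospGrading q) (fun c => eospL q (f c)) (derEosp f q) where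
  part_mem := fun α _ hd => endPart_mem_der _ _ _ α hd
  smul_mem := fun c _ hd => eospL_mul_mem_derEosp f q (f c) hd
  bracket_mem := fun _ hd _ he => sbr_mem_der _ _ _ hd he

theorem sbr_adE_of_derPiece {δ : ZMod 2} {d : AddMonoid.End (eosp q)}
    (hd : d ∈ derPiece (eospGrading q) (fun c => eospR q (f c)) (eospBr q) δ) {β : ZMod 2}
    {z : eosp q} (hz : z ∈ eospGrading q β) :
    sbr (eospGrading q) d (adE q z) = adE q (d z) :=
  sbr_derPiece_mul (eospGrading q) (fun c => eospR q (f c)) (eospBr q)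
    (fun _ _ _ hx _ hy => eospBr_mem q hx hy) hd hz

theorem endPart_mem_ad (α : ZMod 2) {d : AddMonoid.End (eosp q)}
    (hd : d ∈ adOf (eospBr q) ⊤) : endPart (eospGrading q) α d ∈ adOf (eospBr q) ⊤ := by
  obtain ⟨z, -, rfl⟩ := (mem_adOf q).mp hd
  rw [adE_part]
  exact adE_mem_adOf q _

theorem sbr_mem_ad {d : AddMonoid.End (eosp q)} (hd : d ∈ derEosp f q) {g : AddMonoid.End (eosp q)}
    (hg : g ∈ adOf (eospBr q) ⊤) : sbr (eospGrading q) d g ∈ adOf (eospBr q) ⊤ := by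
  obtain ⟨z, -, rfl⟩ := (mem_adOf q).mp hg
  have key : ∀ α β, sbr (eospGrading q) (endPart (eospGrading q) α d)
      (adE q (part (eospGrading q) β z)) ∈ adOf (eospBr q) ⊤ := by
    intro α β
    rw [sbr_adE_of_derPiece f q ((mem_der_iff _ _ _).mp hd α) (part_mem (eospGrading q) β z)]
    exact adE_mem_adOf q _
  rw [← endPart_add (eospGrading q) d, ← part_add (eospGrading q) z, adE_add]
  simp only [map_add, AddMonoidHom.add_apply]
  exact add_mem (add_mem (key 0 0) (key 1 0)) (add_mem (key 0 1) (key 1 1))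

theorem isSubalgebra_ad :
    IsSubalgebra (eospGrading q) (fun c => eospL q (f c)) (adOf (eospBr q) ⊤) where
  part_mem := fun α _ hd => endPart_mem_ad q α hd
  smul_mem := by
    intro c d hd
    obtain ⟨z, -, rfl⟩ := (mem_adOf q).mp hd
    have h : eospL q (f c) * adE q z = adE q (eospL q (f c) z) := by
      apply end_ext
      intro x
      exact (eospBr_eospL q (f c) z x).symm
    rw [h]
    exact adE_mem_adOf q _
  bracket_mem := by
    intro d hd g hg
    obtain ⟨z, -, rfl⟩ := (mem_adOf q).mp hd
    exact sbr_mem_ad f q (adE_mem_derEosp f q z) hg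

/-- A homogeneous locally inner derivation agrees on finite sets with homogeneous inner
derivations. -/
theorem exists_hom_of_mem_adLoc {β : ZMod 2} {d : AddMonoid.End (eosp q)}
    (hd : d ∈ adLocEosp f q) (F : Finset (eosp q)) : ∃ z ∈ eospGrading q β, ∀ x ∈ F,
      endPart (eospGrading q) β d x = eospBr q z x := by
  classical
  obtain ⟨z, hz⟩ := hd.2 (F.image (part (eospGrading q) 0) ∪ F.image (part (eospGrading q) 1))
  refine ⟨part (eospGrading q) β z, part_mem _ β z, fun x hx => ?_⟩
  rw [← adE_apply, ← adE_part, endPart_apply, endPart_apply,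
    hz _ (Finset.mem_union_left _ (Finset.mem_image_of_mem _ hx)),
    hz _ (Finset.mem_union_right _ (Finset.mem_image_of_mem _ hx))]
  rfl

theorem endPart_mem_adLoc (α : ZMod 2) {d : AddMonoid.End (eosp q)} (hd : d ∈ adLocEosp f q) :
    endPart (eospGrading q) α d ∈ adLocEosp f q := by
  refine ⟨endPart_mem_der _ _ _ α hd.1, fun F => ?_⟩
  obtain ⟨z, -, hz⟩ := exists_hom_of_mem_adLoc f q (β := α) hd F
  exact ⟨z, hz⟩

theorem sbr_mem_adLoc : ∀ d ∈ derEosp f q, ∀ g ∈ adLocEosp f q,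
    sbr (eospGrading q) d g ∈ adLocEosp f q := by
  classical
  refine sbr_mem_of_hom _ (fun α d hd => endPart_mem_der _ _ _ α hd)
    (fun α d hd => endPart_mem_adLoc f q α hd) ?_
  intro α β d hd hdα g hg hgβ
  refine ⟨sbr_mem_der _ _ _ hd hg.1, fun F => ?_⟩
  obtain ⟨z, hzβ, hz⟩ := exists_hom_of_mem_adLoc f q (β := β) hg (F ∪ F.image d)
  rw [endPart_same _ hgβ] at hz
  have hdp := mem_derPiece_of_mem_der _ _ _ hd hdα
  refine ⟨d z, fun x hx => ?_⟩
  rw [sbr_apply_hom _ hdα hgβ, hz x (Finset.mem_union_left _ hx),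
    hz _ (Finset.mem_union_right _ (Finset.mem_image_of_mem _ hx)), hdp.2.2 β z hzβ]
  abel

theorem isSubalgebra_adLoc :
    IsSubalgebra (eospGrading q) (fun c => eospL q (f c)) (adLocEosp f q) where
  part_mem := fun α _ hd => endPart_mem_adLoc f q α hd
  smul_mem := by
    intro c d hd
    refine ⟨eospL_mul_mem_derEosp f q (f c) hd.1, fun F => ?_⟩
    obtain ⟨z, hz⟩ := hd.2 F
    refine ⟨eospL q (f c) z, fun x hx => ?_⟩
    rw [eospBr_eospL, end_mul_apply, hz x hx]
  bracket_mem := fun d hd g hg => sbr_mem_adLoc f q d hd.1 g hg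

/-- Locally inner derivations are linear over `A`, so they are determined by their values on a set
of generators. On a finite set of generators they agree with an inner derivation. -/
theorem adLoc_le_ad_of_finite (F : Finset (eosp q))
    (hF : AddSubgroup.closure {y | ∃ a, ∃ x ∈ F, y = eospL q a x} = ⊤) :
    adLocEosp f q ≤ adOf (eospBr q) ⊤ := by
  classical
  intro d hd
  have key : ∀ β, endPart (eospGrading q) β d ∈ adOf (eospBr q) ⊤ := by
    intro β
    obtain ⟨z, hzβ, hz⟩ := exists_hom_of_mem_adLoc f q (β := β) hd F
    have h : endPart (eospGrading q) β d = adE q z := by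
      apply end_ext
      intro y
      have hy : y ∈ AddSubgroup.closure {y | ∃ a, ∃ x ∈ F, y = eospL q a x} := by
        rw [hF]
        trivial
      refine AddSubgroup.closure_induction
        (p := fun y _ => endPart (eospGrading q) β d y = adE q z y) ?_ ?_ ?_ ?_ hy
      · rintro _ ⟨a, x, hx, rfl⟩
        refine hom_induction 𝒜 (p := fun a => endPart (eospGrading q) β d (eospL q a x) =
          adE q z (eospL q a x)) ?_ ?_ a
        · intro γ a ha
          obtain ⟨w, hwβ, hw⟩ := exists_hom_of_mem_adLoc f q (β := β) hd {x, eospL q a x}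
          rw [hw (eospL q a x) (by simp), adE_apply, eospBr_eospL_right q ha hwβ,
            eospBr_eospL_right q ha hzβ, ← hw x (by simp), hz x hx]
        · intro a b ha hb
          rw [eospL_add, end_add_apply, map_add, map_add, ha, hb]
      · rw [map_zero, map_zero]
      · intro x y _ _ hx hy
        rw [map_add, map_add, hx, hy]
      · intro x _ hx
        rw [map_neg, map_neg, hx]
    rw [h]
    exact adE_mem_adOf q z
  rw [← endPart_add (eospGrading q) d]
  exact add_mem (key 0) (key 1)

end Inner

/-! ### Schur's lemma -/

section Schur

variable {A M : Type*} [Ring A] [AddCommGroup M] [Module A M] [Module Aᵐᵒᵖ M]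
  {𝒜 : ZMod 2 → AddSubgroup A} {ℳ : ZMod 2 → AddSubgroup M} [GradedRing 𝒜]
  [IsSupercommutative 𝒜] [DirectSum.Decomposition ℳ] [SMulCommClass A Aᵐᵒᵖ M]
  [IsSupermodule 𝒜 ℳ] {q : QuadForm 𝒜 ℳ} {e e' : M}

theorem IsHypPair.opE_apply (he : IsHypPair q e e') (p : M) :
    opE q e e' p = op (q.form e' p) • e - op (q.form e p) • e' := by
  rw [SuperLie.opE_apply q he.left_mem he.right_mem]
  simp

theorem IsHypPair.form_smul_eq (he : IsHypPair q e e') (a : A) (n : M) :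
    q.form e (a • n) = a * q.form e n := by
  rw [← q.balanced, ← smul_eq_op_smul (𝒜 := 𝒜) he.left_mem, form_smul_left]

/-- If the bracket of `U` with the operator `E e e'` is a scalar, then `U` commutes with `E e e'`:
evaluation at `e`, followed by pairing with `e'`, shows that the scalar is zero. -/
theorem IsHypPair.map_opE (he : IsHypPair q e e') {δ : ZMod 2}
    {U : AddMonoid.End M} (hU : U ∈ endGrading ℳ δ) {c : A}
    (hc : sbr ℳ U (opE q e e') = mulL M c) (p : M) : U (opE q e e' p) = opE q e e' (U p) := by
  have h : ∀ p, U (opE q e e' p) - opE q e e' (U p) = c • p := by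
    intro p
    have h1 := DFunLike.congr_fun hc p
    rw [sbr_apply_hom ℳ hU (opE_mem_grading q he.left_mem he.right_mem)] at h1
    simpa using h1
  have hc0 : c = 0 := by
    have h1 := congrArg (q.form e') (h e)
    rw [he.opE_apply e, he.symm.pair, he.left_self, he.symm.form_smul, he.opE_apply (U e),
      op_one, one_smul, op_zero, zero_smul, sub_zero, map_sub (q.form e'), map_sub (q.form e'),
      q.linear, q.linear, he.symm.pair, he.right_self] at h1
    simpa using h1.symm
  have h1 := h p
  rw [hc0, zero_smul] at h1
  exact sub_eq_zero.mp h1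

/-- `U e` is a multiple of `e`, because `U` commutes with `E e e'`, which acts as `1` on `e`, as `-1` on
`e'` and as `0` on their orthogonal complement. -/
theorem IsHypPair.map_left (h2 : IsUnit (2 : A)) (he : IsHypPair q e e') {δ : ZMod 2}
    {U : AddMonoid.End M} (hU : U ∈ endGrading ℳ δ)
    (hE : ∀ x ∈ eosp q, ∃ c : A, sbr ℳ U x = mulL M c) :
    U e = q.form e' (U e) • e := by
  obtain ⟨c, hc⟩ := hE _ (opE_mem q e e')
  have h := he.map_opE hU hc e
  rw [he.opE_apply e, he.symm.pair, he.left_self, he.opE_apply] at h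
  have h0 : q.form e (U e) = 0 := by
    have h1 := congrArg (q.form e) h
    rw [map_sub (q.form e), q.linear, q.linear, he.left_self, he.pair] at h1
    exact eq_zero_of_eq_neg h2 (by simpa using h1)
  rw [h0] at h
  rw [smul_eq_op_smul (𝒜 := 𝒜) he.left_mem]
  simpa using h

/-- On the orthogonal complement of the hyperbolic plane, `U` is the scalar by which it acts on `e'`.
The operator `E n e` maps `e'` to `n` and has scalar bracket with `U`; pairing with `e` shows that
this scalar kills `e'`. -/
theorem IsHypPair.map_orthogonal (h2 : IsUnit (2 : A)) (he : IsHypPair q e e') {δ : ZMod 2}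
    {U : AddMonoid.End M} (hU : U ∈ endGrading ℳ δ)
    (hE : ∀ x ∈ eosp q, ∃ c : A, sbr ℳ U x = mulL M c)
    {γ : ZMod 2} {n : M} (hn : n ∈ ℳ γ) (h1 : q.form e n = 0) (h1' : q.form e' n = 0) :
    U n = q.form e (U e') • n := by
  set l := q.form e (U e') with hl
  have hlm : l ∈ 𝒜 δ := by
    have h := q.degree he.left_mem (hU 0 e' he.right_mem)
    rwa [zero_add, zero_add] at h
  have hUe' : U e' = l • e' := he.symm.map_left h2 hU hE
  have hne' : q.form n e' = 0 := by
    rw [q.symm hn he.right_mem, h1', smul_zero]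
  obtain ⟨c, hc⟩ := hE _ (opE_mem q n e)
  have h3 := DFunLike.congr_fun hc e'
  have hm := opE_mem_grading q hn he.left_mem
  have h4 : opE q n e e' = n := by
    rw [SuperLie.opE_apply q hn he.left_mem, he.pair, hne']
    simp
  rw [sbr_apply_hom ℳ hU hm, hUe', h4,
    map_smul_of_linear hm (fun a m => opE_linear_all q n e a m) hlm, h4, mulL_apply, smul_smul,
    add_zero, mul_comm δ γ, sgn_mul_self, one_smul] at h3
  obtain ⟨b, hb⟩ := hE _ (opE_mem q e e')
  have h5 := he.map_opE hU hb n
  have h6 : q.form e (U n) = 0 := by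
    have h7 := congrArg (q.form e) h5
    rw [he.opE_apply n, he.opE_apply (U n), h1, h1', map_sub (q.form e), q.linear, q.linear,
      he.left_self, he.pair] at h7
    simpa using h7
  have h8 := congrArg (q.form e) h3
  rw [map_sub, he.form_smul, h6, he.form_smul_eq, h1, mul_zero, sub_zero] at h8
  rw [← h8, zero_smul] at h3
  exact sub_eq_zero.mp h3

theorem part_form_even (he : e ∈ ℳ 0) (γ : ZMod 2) (n : M) :
    part 𝒜 γ (q.form e n) = q.form e (part ℳ γ n) := by
  refine hom_induction ℳ (p := fun n => part 𝒜 γ (q.form e n) = q.form e (part ℳ γ n)) ?_ ?_ n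
  · intro β n hn
    have h := q.degree he hn
    rw [zero_add] at h
    by_cases hβ : β = γ
    · subst hβ
      rw [part_same 𝒜 h, part_same ℳ hn]
    · rw [part_ne 𝒜 h hβ, part_ne ℳ hn hβ, map_zero]
  · intro m n hm hn
    simp only [map_add, hm, hn]

/-- The module splits off a hyperbolic plane and a vector with zero annihilator orthogonal to it.
This is what the assumption on `I` and `P` provides. -/
structure IsLarge (q : QuadForm 𝒜 ℳ) (e e' n : M) : Prop extends IsHypPair q e e' where
  left_orthogonal : q.form e n = 0
  right_orthogonal : q.form e' n = 0
  faithful : ∀ a : A, a • n = 0 → a = 0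

/-- Schur's lemma: a homogeneous linear map that commutes with `eosp q` up to scalars is a
scalar. On each of `e`, `e'` it acts by a scalar, on the orthogonal complement of the plane it acts
by both of these scalars, and the vector with zero annihilator shows that they are equal. -/
theorem IsLarge.schur (h2 : IsUnit (2 : A)) {n : M} (h : IsLarge q e e' n) {δ : ZMod 2}
    {U : AddMonoid.End M} (hU : U ∈ endGrading ℳ δ)
    (hlin : ∀ (a : A) m, U (op a • m) = op a • U m)
    (hE : ∀ x ∈ eosp q, ∃ c : A, sbr ℳ U x = mulL M c) : ∃ l ∈ 𝒜 δ, U = mulL M l := by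
  have he := h.toIsHypPair
  have horth : ∀ p, q.form e p = 0 → q.form e' p = 0 → U p = q.form e (U e') • p ∧
      U p = q.form e' (U e) • p := by
    intro p h1 h1'
    have k : ∀ γ, U (part ℳ γ p) = q.form e (U e') • part ℳ γ p ∧
        U (part ℳ γ p) = q.form e' (U e) • part ℳ γ p := by
      intro γ
      have k1 : q.form e (part ℳ γ p) = 0 := by
        rw [← part_form_even he.left_mem, h1, map_zero]
      have k2 : q.form e' (part ℳ γ p) = 0 := by
        rw [← part_form_even he.right_mem, h1', map_zero]
      exact ⟨he.map_orthogonal h2 hU hE (part_mem ℳ γ p) k1 k2,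
        he.symm.map_orthogonal h2 hU hE (part_mem ℳ γ p) k2 k1⟩
    rw [← part_add ℳ p, map_add, smul_add, smul_add]
    exact ⟨by rw [(k 0).1, (k 1).1], by rw [(k 0).2, (k 1).2]⟩
  have hll : q.form e (U e') = q.form e' (U e) := by
    obtain ⟨h3, h4⟩ := horth n h.left_orthogonal h.right_orthogonal
    rw [h3, ← sub_eq_zero, ← sub_smul] at h4
    exact sub_eq_zero.mp (h.faithful _ h4)
  refine ⟨q.form e' (U e), ?_, ?_⟩
  · have h := q.degree he.right_mem (hU 0 e he.left_mem)
    rwa [zero_add, zero_add] at h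
  · apply end_ext
    intro m
    have h1 := he.map_left h2 hU hE
    have h1' := he.symm.map_left h2 hU hE
    rw [hll] at h1'
    have h3 := (horth (m - op (q.form e' m) • e - op (q.form e m) • e')
      (by simp [q.linear, he.left_self, he.pair])
      (by simp [q.linear, he.right_self, he.symm.pair])).2
    rw [map_sub, map_sub, hlin, hlin, smul_sub, smul_sub] at h3
    rw [smul_comm _ (op (q.form e' m)) e, smul_comm _ (op (q.form e m)) e', ← h1, ← h1'] at h3
    rw [mulL_apply]
    exact sub_left_injective (sub_left_injective h3)

/-- A central element is a scalar by Schur's lemma, and a skew scalar is zero. -/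
theorem IsLarge.eq_zero_of_central (h2 : IsUnit (2 : A)) {n : M} (h : IsLarge q e e' n)
    {δ : ZMod 2} {x : AddMonoid.End M} (hx : x ∈ eosp q) (hδ : x ∈ endGrading ℳ δ)
    (hE : ∀ y ∈ eosp q, sbr ℳ x y = 0) : x = 0 := by
  obtain ⟨l, hl, hxl⟩ := h.schur h2 hδ (eosp_linear q hx)
    (fun y hy => ⟨0, by rw [hE y hy, mulL_zero]⟩)
  have h1 := eosp_skew q hx hδ h.left_mem e'
  rw [hxl, mulL_apply, mulL_apply, form_smul_left, h.pair, h.form_smul] at h1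
  have h3 : l = 0 := eq_zero_of_eq_neg h2 (by simpa using h1)
  rw [hxl, h3, mulL_zero]

theorem exists_half (𝒜 : ZMod 2 → AddSubgroup A) [GradedRing 𝒜] (h2 : IsUnit (2 : A)) :
    ∃ h ∈ 𝒜 0, h + h = 1 := by
  obtain ⟨h, hh⟩ := h2.exists_right_inv
  refine ⟨part 𝒜 0 h, part_mem 𝒜 0 h, ?_⟩
  rw [← map_add, ← two_mul, hh]
  exact part_same 𝒜 SetLike.GradedOne.one_mem

/-- For homogeneous maps, linearity with signs on the left is linearity on the right. -/
theorem op_smul_of_map_smul {δ : ZMod 2} {S : AddMonoid.End M} (hS : S ∈ endGrading ℳ δ)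
    (h : ∀ α, ∀ a ∈ 𝒜 α, ∀ m, S (a • m) = sgn (δ * α) • (a • S m)) (a : A) (m : M) :
    S (op a • m) = op a • S m := by
  refine hom_induction 𝒜 (p := fun a => S (op a • m) = op a • S m) ?_ ?_ a
  · intro α a ha
    refine hom_induction ℳ (p := fun m => S (op a • m) = op a • S m) ?_ ?_ m
    · intro β m hm
      rw [op_smul_eq (𝒜 := 𝒜) ha hm, map_zsmul, h α a ha, op_smul_eq (𝒜 := 𝒜) ha (hS β m hm)]
      rcases parity_cases α with rfl | rfl <;> rcases parity_cases β with rfl | rfl <;>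
        rcases parity_cases δ with rfl | rfl <;> simp
    · intro m n hm hn
      simp only [smul_add, map_add, hm, hn]
  · intro a b ha hb
    simp only [op_add, add_smul, map_add, ha, hb]

end Schur

/-! ### The grading element -/

section Decomposition

variable {K A M : Type*} [Ring K] [Ring A] [AddCommGroup M] [Module A M] [Module Aᵐᵒᵖ M]
  {𝒜 : ZMod 2 → AddSubgroup A} {ℳ : ZMod 2 → AddSubgroup M} [GradedRing 𝒜]
  [IsSupercommutative 𝒜] [DirectSum.Decomposition ℳ] [SMulCommClass A Aᵐᵒᵖ M]
  [IsSupermodule 𝒜 ℳ] (f : K →+* A) {q : QuadForm 𝒜 ℳ} {e e' : M}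

theorem opEs_zero_left (n : M) : opEs q 0 n = 0 := by
  have h := opE_add_left q 0 0 n
  rw [add_zero] at h
  exact Subtype.ext (left_eq_add.mp h)

theorem opEs_zero_right (n : M) : opEs q n 0 = 0 := by
  have h := opE_add_right q n 0 0
  rw [add_zero] at h
  exact Subtype.ext (left_eq_add.mp h)

/-- The bracket with an element of degree zero with respect to the `3`-grading. -/
theorem eospBr_ofCoord_zero {α β : ZMod 2} {a : A} (ha : a ∈ 𝒜 α) {x : eosp q}
    (hx : x ∈ eospGrading q α) {a' : A} (ha' : a' ∈ 𝒜 β) {m' : M} (hm' : m' ∈ ℳ β) {n' : M}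
    (hn' : n' ∈ ℳ β) {x' : eosp q} (hx' : x' ∈ eospGrading q β) :
    eospBr (qInf q) (ofCoord q (a, 0, 0, x)) (ofCoord q (a', m', n', x')) =
      ofCoord q (0, a • m' + (x : AddMonoid.End M) m', -(a • n') + (x : AddMonoid.End M) n',
        eospBr q x x') := by
  rw [eospBr_ofCoord q ha (zero_mem _) (zero_mem _) hx ha' hm' hn' hx']
  simp only [map_zero, AddMonoidHom.zero_apply, sub_zero, smul_zero, add_zero, opEs_zero_left,
    zero_add]

/-- The even element of `eosp q_∞` whose eigenspaces are the pieces of the `3`-grading. -/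
def gradingElement (q : QuadForm 𝒜 ℳ) : eosp (qInf q) := ofCoord q (1, 0, 0, 0)

theorem gradingElement_mem : gradingElement q ∈ eospGrading (qInf q) 0 :=
  ofCoord_mem q SetLike.GradedOne.one_mem (zero_mem _) (zero_mem _) (zero_mem _)

theorem eospBr_gradingElement {β : ZMod 2} {a' : A} (ha' : a' ∈ 𝒜 β) {m' : M} (hm' : m' ∈ ℳ β)
    {n' : M} (hn' : n' ∈ ℳ β) {x' : eosp q} (hx' : x' ∈ eospGrading q β) :
    eospBr (qInf q) (gradingElement q) (ofCoord q (a', m', n', x')) =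
      ofCoord q (0, m', -n', 0) := by
  rw [gradingElement, eospBr_ofCoord_zero SetLike.GradedOne.one_mem (zero_mem _) ha' hm' hn' hx']
  simp

theorem ofCoord_eq_iff {a a' : A} {m m' n n' : M} {x x' : eosp q} :
    ofCoord q (a, m, n, x) = ofCoord q (a', m', n', x') ↔ a = a' ∧ m = m' ∧ n = n' ∧ x = x' := by
  rw [(ofCoord q).injective.eq_iff]
  simp only [Prod.mk.injEq]

theorem ofCoord_add (a a' : A) (m m' n n' : M) (x x' : eosp q) :
    ofCoord q (a, m, n, x) + ofCoord q (a', m', n', x') =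
      ofCoord q (a + a', m + m', n + n', x + x') := (map_add (ofCoord q) _ _).symm

theorem ofCoord_zsmul (c : ℤ) (a : A) (m n : M) (x : eosp q) :
    c • ofCoord q (a, m, n, x) = ofCoord q (c • a, c • m, c • n, c • x) :=
  (map_zsmul (ofCoord q) _ _).symm

theorem ofCoord_zero : ofCoord q (0, 0, 0, 0) = 0 := map_zero (ofCoord q)

variable {δ : ZMod 2} {d : AddMonoid.End (eosp (qInf q))}

/-- If a derivation maps the grading element into the zero piece of the `3`-grading, it kills the
grading element and preserves the `3`-grading. -/
theorem derPiece_of_map_gradingElement (h2 : IsUnit (2 : A)) (he : IsHypPair q e e')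
    (hd : d ∈ derPiece (eospGrading (qInf q)) (fun c => eospR (qInf q) (f c))
      (eospBr (qInf q)) δ) {a₀ : A} (ha₀ : a₀ ∈ 𝒜 δ) {x₀ : eosp q} (hx₀ : x₀ ∈ eospGrading q δ)
    (h0 : d (gradingElement q) = ofCoord q (a₀, 0, 0, x₀)) :
    d (gradingElement q) = 0 ∧ (∀ m, ∃ m', d (ofCoord q (0, m, 0, 0)) = ofCoord q (0, m', 0, 0)) ∧
      (∀ n, ∃ n', d (ofCoord q (0, 0, n, 0)) = ofCoord q (0, 0, n', 0)) ∧
      ∀ a x, ∃ a' x', d (ofCoord q (a, 0, 0, x)) = ofCoord q (a', 0, 0, x') := by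
  have hder := hd.2.2 0 _ (gradingElement_mem (q := q))
  rw [mul_zero, sgn_zero] at hder
  -- the derivation property on the product of `ζ` and `(0, m, 0, 0)`, which is `(0, m, 0, 0)`
  have hplus : ∀ γ, ∀ m ∈ ℳ γ, a₀ • m + (x₀ : AddMonoid.End M) m = 0 ∧
      ∃ m', d (ofCoord q (0, m, 0, 0)) = ofCoord q (0, m', 0, 0) := by
    intro γ m hm
    have h1 := hder (ofCoord q (0, m, 0, 0))
    have hy := ofCoord_mem q (zero_mem (𝒜 γ)) hm (zero_mem _) (zero_mem (eospGrading q γ))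
    obtain ⟨a, ha, m', hm', n', hn', x, hx, hdy⟩ := exists_hom_ofCoord q (hd.1 γ _ hy)
    rw [eospBr_gradingElement (zero_mem _) hm (zero_mem _) (zero_mem _), h0,
      eospBr_ofCoord_zero ha₀ hx₀ (zero_mem _) hm (zero_mem _) (zero_mem _), neg_zero, hdy,
      eospBr_gradingElement ha hm' hn' hx, one_smul, ofCoord_add, ofCoord_eq_iff] at h1
    obtain ⟨k1, k2, k3, k4⟩ := h1
    have k5 : n' = 0 := eq_zero_of_eq_neg h2 (by simpa using k3)
    refine ⟨by simpa using k2, m', ?_⟩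
    rw [hdy, k1, k4, k5]
    simp
  -- the same on the product of `ζ` and `(0, 0, -n, 0)`, which is `(0, 0, n, 0)`
  have hminus : ∀ γ, ∀ n ∈ ℳ γ, -(a₀ • n) + (x₀ : AddMonoid.End M) n = 0 ∧
      ∃ n', d (ofCoord q (0, 0, n, 0)) = ofCoord q (0, 0, n', 0) := by
    intro γ n hn
    have h1 := hder (ofCoord q (0, 0, -n, 0))
    have hn1 : -n ∈ ℳ γ := neg_mem hn
    have hy := ofCoord_mem q (zero_mem (𝒜 γ)) (zero_mem _) hn (zero_mem (eospGrading q γ))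
    obtain ⟨a, ha, m', hm', n', hn', x, hx, hdy⟩ := exists_hom_ofCoord q (hd.1 γ _ hy)
    have hneg : d (ofCoord q (0, 0, -n, 0)) = ofCoord q (-a, -m', -n', -x) := by
      have e1 : ofCoord q (0, 0, -n, 0) = -ofCoord q (0, 0, n, 0) := by
        rw [← map_neg]
        simp
      rw [e1, map_neg, hdy, ← map_neg]
      rfl
    rw [eospBr_gradingElement (zero_mem _) (zero_mem _) hn1 (zero_mem _), h0,
      eospBr_ofCoord_zero ha₀ hx₀ (zero_mem _) (zero_mem _) hn1 (zero_mem _), neg_neg, hneg, hdy,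
      eospBr_gradingElement (neg_mem ha) (neg_mem hm') (neg_mem hn') (neg_mem hx), one_smul,
      ofCoord_add, ofCoord_eq_iff] at h1
    obtain ⟨k1, k2, k3, k4⟩ := h1
    have k5 : m' = 0 := eq_zero_of_eq_neg h2 (by simpa using k2)
    refine ⟨?_, n', ?_⟩
    · have k6 : -(-(a₀ • n) + (x₀ : AddMonoid.End M) n) = 0 := by
        simpa [add_comm] using k3
      exact neg_eq_zero.mp k6
    · rw [hdy, k1, k4, k5]
      simp
  -- `x₀` acts as `-a₀` on the one copy of `M` and as `a₀` on the other
  have ha0 : a₀ = 0 := by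
    have k1 := (hplus 0 e he.left_mem).1
    have k2 := (hminus 0 e he.left_mem).1
    have k3 : a₀ • e = -(a₀ • e) := by
      rw [eq_neg_of_add_eq_zero_right k1, ← neg_add, neg_eq_zero] at k2
      exact eq_neg_of_add_eq_zero_left k2
    rw [← he.symm.form_smul a₀, eq_zero_of_eq_neg h2 k3, map_zero]
  have hx0 : x₀ = 0 := by
    apply Subtype.ext
    apply end_ext
    intro m
    refine hom_induction ℳ (p := fun m => (x₀ : AddMonoid.End M) m = 0) ?_ ?_ m
    · intro γ m hm
      simpa [ha0] using (hplus γ m hm).1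
    · intro m n hm hn
      rw [map_add, hm, hn, add_zero]
  have hd0 : d (gradingElement q) = 0 := by
    rw [h0, ha0, hx0, ofCoord_zero]
  have hz : ∀ m n : M, ofCoord q (0, m + n, 0, 0) =
      ofCoord q (0, m, 0, 0) + ofCoord q (0, n, 0, 0) := fun m n => by
    rw [ofCoord_add]
    simp
  have hz' : ∀ m n : M, ofCoord q (0, 0, m + n, 0) =
      ofCoord q (0, 0, m, 0) + ofCoord q (0, 0, n, 0) := fun m n => by
    rw [ofCoord_add]
    simp
  refine ⟨hd0, fun m => ?_, fun n => ?_, fun a x => ?_⟩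
  · refine hom_induction ℳ (p := fun m => ∃ m', d (ofCoord q (0, m, 0, 0)) =
      ofCoord q (0, m', 0, 0)) (fun γ m hm => (hplus γ m hm).2) ?_ m
    rintro m n ⟨m', hm⟩ ⟨n', hn⟩
    exact ⟨m' + n', by rw [hz, map_add, hm, hn, hz]⟩
  · refine hom_induction ℳ (p := fun n => ∃ n', d (ofCoord q (0, 0, n, 0)) =
      ofCoord q (0, 0, n', 0)) (fun γ m hm => (hminus γ m hm).2) ?_ n
    rintro m n ⟨m', hm⟩ ⟨n', hn⟩
    exact ⟨m' + n', by rw [hz', map_add, hm, hn, hz']⟩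
  · have key : ∀ γ, ∃ a' x', d (ofCoord q (part 𝒜 γ a, 0, 0, part (eospGrading q) γ x)) =
        ofCoord q (a', 0, 0, x') := by
      intro γ
      have hy := ofCoord_mem q (part_mem 𝒜 γ a) (zero_mem (ℳ γ)) (zero_mem (ℳ γ))
        (part_mem (eospGrading q) γ x)
      obtain ⟨a', ha', m', hm', n', hn', x', hx', hdy⟩ := exists_hom_ofCoord q (hd.1 γ _ hy)
      have h1 := hder (ofCoord q (part 𝒜 γ a, 0, 0, part (eospGrading q) γ x))
      rw [eospBr_gradingElement (part_mem 𝒜 γ a) (zero_mem (ℳ γ)) (zero_mem (ℳ γ))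
        (part_mem (eospGrading q) γ x), hd0, hdy, eospBr_gradingElement ha' hm' hn' hx', neg_zero,
        ofCoord_zero, map_zero, map_zero, AddMonoidHom.zero_apply, zero_add, one_smul,
        ← ofCoord_zero, ofCoord_eq_iff] at h1
      refine ⟨a', x', ?_⟩
      rw [hdy, ← h1.2.1, neg_eq_zero.mp h1.2.2.1.symm]
    obtain ⟨a', x', h⟩ := key 0
    obtain ⟨a'', x'', h'⟩ := key 1
    refine ⟨a' + a'', x' + x'', ?_⟩
    rw [← part_add 𝒜 a, ← part_add (eospGrading q) x]
    have h3 := congrArg₂ (· + ·) h h'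
    simp only [← map_add d, ofCoord_add, add_zero] at h3
    exact h3

end Decomposition

/-! ### Derivations modulo inner derivations -/

section Structure

variable {K A M : Type*} [Ring K] [Ring A] [AddCommGroup M] [Module A M] [Module Aᵐᵒᵖ M]
  {𝒜 : ZMod 2 → AddSubgroup A} {ℳ : ZMod 2 → AddSubgroup M} [GradedRing 𝒜]
  [IsSupercommutative 𝒜] [DirectSum.Decomposition ℳ] [SMulCommClass A Aᵐᵒᵖ M]
  [IsSupermodule 𝒜 ℳ] (f : K →+* A) {q : QuadForm 𝒜 ℳ} {e e' : M}
  {δ : ZMod 2} {d : AddMonoid.End (eosp (qInf q))}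

theorem mem_of_ofCoord_mem {α : ZMod 2} {a : A} {m n : M} {x : eosp q}
    (h : ofCoord q (a, m, n, x) ∈ eospGrading (qInf q) α) :
    a ∈ 𝒜 α ∧ m ∈ ℳ α ∧ n ∈ ℳ α ∧ x ∈ eospGrading q α := by
  obtain ⟨a', ha, m', hm, n', hn, x', hx, h'⟩ := exists_hom_ofCoord q h
  obtain ⟨rfl, rfl, rfl, rfl⟩ := ofCoord_eq_iff.mp h'
  exact ⟨ha, hm, hn, hx⟩

/-- A derivation that preserves the `3`-grading becomes some `d_{S,0}` after subtracting the inner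
derivation of a scalar multiple of the grading element. The restrictions `S` and `T` to the two outer
pieces differ by a scalar because of Schur's lemma, and the inner derivation removes half of it. -/
theorem exists_isOuter_sub_of_preserves (h2 : IsUnit (2 : A)) {n₀ : M}
    (h : IsLarge q e e' n₀)
    (hd : d ∈ derPiece (eospGrading (qInf q)) (fun c => eospR (qInf q) (f c))
      (eospBr (qInf q)) δ)
    (h1 : ∀ m, ∃ m', d (ofCoord q (0, m, 0, 0)) = ofCoord q (0, m', 0, 0))
    (h1' : ∀ n, ∃ n', d (ofCoord q (0, 0, n, 0)) = ofCoord q (0, 0, n', 0))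
    (h0 : ∀ a x, ∃ a' x', d (ofCoord q (a, 0, 0, x)) = ofCoord q (a', 0, 0, x')) :
    ∃ z, ∃ S ∈ sPiece f q (eosp q) δ, IsOuter q S (d - adE (qInf q) z) := by
  have he := h.toIsHypPair
  choose S0 hS0 using h1
  choose T0 hT0 using h1'
  choose dA dE hdAE using h0
  -- the components of `d` are additive
  have hSadd : ∀ m n, S0 (m + n) = S0 m + S0 n := by
    intro m n
    have k := hS0 (m + n)
    have k1 : ofCoord q (0, m + n, 0, 0) = ofCoord q (0, m, 0, 0) + ofCoord q (0, n, 0, 0) := by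
      simp [ofCoord_add]
    rw [k1, map_add, hS0, hS0, ofCoord_add, ofCoord_eq_iff] at k
    exact k.2.1.symm
  have hTadd : ∀ m n, T0 (m + n) = T0 m + T0 n := by
    intro m n
    have k := hT0 (m + n)
    have k1 : ofCoord q (0, 0, m + n, 0) = ofCoord q (0, 0, m, 0) + ofCoord q (0, 0, n, 0) := by
      simp [ofCoord_add]
    rw [k1, map_add, hT0, hT0, ofCoord_add, ofCoord_eq_iff] at k
    exact k.2.2.1.symm
  have hAEadd : ∀ a b x y, dA (a + b) (x + y) = dA a x + dA b y ∧
      dE (a + b) (x + y) = dE a x + dE b y := by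
    intro a b x y
    have k := hdAE (a + b) (x + y)
    have k1 : ofCoord q (a + b, 0, 0, x + y) = ofCoord q (a, 0, 0, x) + ofCoord q (b, 0, 0, y) := by
      simp [ofCoord_add]
    rw [k1, map_add, hdAE, hdAE, ofCoord_add, ofCoord_eq_iff] at k
    exact ⟨k.1.symm, k.2.2.2.symm⟩
  have hdval : ∀ a m n x, d (ofCoord q (a, m, n, x)) = ofCoord q (dA a x, S0 m, T0 n, dE a x) := by
    intro a m n x
    have k1 : ofCoord q (a, m, n, x) = ofCoord q (a, 0, 0, x) + ofCoord q (0, m, 0, 0) +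
        ofCoord q (0, 0, n, 0) := by
      simp [ofCoord_add]
    rw [k1, map_add, map_add, hdAE, hS0, hT0, ofCoord_add, ofCoord_add]
    simp
  let S : AddMonoid.End M := AddMonoidHom.mk' S0 hSadd
  let T : AddMonoid.End M := AddMonoidHom.mk' T0 hTadd
  have hA0 : dA 0 0 = 0 := by
    have k := (hAEadd 0 0 0 0).1
    rw [add_zero, add_zero] at k
    exact left_eq_add.mp k
  have hE0 : dE 0 0 = 0 := by
    have k := (hAEadd 0 0 0 0).2
    rw [add_zero, add_zero] at k
    exact left_eq_add.mp k
  -- the components of `d` are homogeneous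
  have hmem : ∀ γ, ∀ a ∈ 𝒜 γ, ∀ m ∈ ℳ γ, ∀ n ∈ ℳ γ, ∀ x ∈ eospGrading q γ,
      dA a x ∈ 𝒜 (γ + δ) ∧ S m ∈ ℳ (γ + δ) ∧ T n ∈ ℳ (γ + δ) ∧
        dE a x ∈ eospGrading q (γ + δ) := by
    intro γ a ha m hm n hn x hx
    have k := hd.1 γ _ (ofCoord_mem q ha hm hn hx)
    rw [hdval] at k
    exact mem_of_ofCoord_mem k
  have hSmem : S ∈ endGrading ℳ δ := fun γ m hm =>
    (hmem γ 0 (zero_mem _) m hm 0 (zero_mem _) 0 (zero_mem _)).2.1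
  have hTmem : T ∈ endGrading ℳ δ := fun γ m hm =>
    (hmem γ 0 (zero_mem _) 0 (zero_mem _) m hm 0 (zero_mem _)).2.2.1
  -- the derivation property on products with elements of degree zero in the `3`-grading
  have hprod : ∀ α, ∀ a ∈ 𝒜 α, ∀ x ∈ eospGrading q α, ∀ γ, ∀ m ∈ ℳ γ, ∀ y ∈ eospGrading q γ,
      S (a • m + (x : AddMonoid.End M) m) = dA a x • m + (dE a x : AddMonoid.End M) m +
        sgn (δ * α) • (a • S m + (x : AddMonoid.End M) (S m)) ∧
      T (-(a • m) + (x : AddMonoid.End M) m) = -(dA a x • m) + (dE a x : AddMonoid.End M) m +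
        sgn (δ * α) • (-(a • T m) + (x : AddMonoid.End M) (T m)) ∧
      dE 0 (eospBr q x y) = eospBr q (dE a x) y + sgn (δ * α) • eospBr q x (dE 0 y) := by
    intro α a ha x hx γ m hm y hy
    have k := hd.2.2 α _ (ofCoord_mem q ha (zero_mem _) (zero_mem _) hx) (ofCoord q (0, m, m, y))
    obtain ⟨c1, c2, c3, c4⟩ := hmem α a ha 0 (zero_mem _) 0 (zero_mem _) x hx
    obtain ⟨b1, b2, b3, b4⟩ := hmem γ 0 (zero_mem _) m hm m hm y hy
    rw [eospBr_ofCoord_zero ha hx (zero_mem _) hm hm hy, hdval, hdAE,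
      eospBr_ofCoord_zero c1 c4 (zero_mem _) hm hm hy, hdval] at k
    rw [show ofCoord q (dA 0 y, S0 m, T0 m, dE 0 y) = ofCoord q (dA 0 y, S m, T m, dE 0 y) from rfl,
      eospBr_ofCoord_zero ha hx b1 b2 b3 b4, ofCoord_zsmul, ofCoord_add, ofCoord_eq_iff] at k
    exact k.2
  -- the elements `dE a 0` are central
  have hrho : ∀ α, ∀ a ∈ 𝒜 α, dE a 0 = 0 := by
    intro α a ha
    have c4 := (hmem α a ha 0 (zero_mem _) 0 (zero_mem _) 0 (zero_mem _)).2.2.2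
    apply Subtype.ext
    refine h.eq_zero_of_central h2 (dE a 0).2 (coe_mem_endGrading q c4) ?_
    intro y hy
    have k : ∀ γ, sbr ℳ (dE a 0 : AddMonoid.End M) (endPart ℳ γ y) = 0 := by
      intro γ
      have k1 := (hprod α a ha 0 (zero_mem _) γ 0 (zero_mem _) ⟨_, endPart_mem_eosp q γ hy⟩
        (endPart_mem ℳ γ y)).2.2
      rw [map_zero, AddMonoidHom.zero_apply, AddMonoidHom.zero_apply, hE0, smul_zero,
        add_zero] at k1
      exact (congrArg Subtype.val k1).symm
    rw [← endPart_add ℳ y, map_add, k, k, add_zero]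
  have hS1 : ∀ α, ∀ a ∈ 𝒜 α, ∀ m, S (a • m) = dA a 0 • m + sgn (δ * α) • (a • S m) := by
    intro α a ha m
    refine hom_induction ℳ (p := fun m => S (a • m) = dA a 0 • m + sgn (δ * α) • (a • S m)) ?_ ?_ m
    · intro γ m hm
      simpa [hrho α a ha] using
        (hprod α a ha 0 (zero_mem _) γ m hm 0 (zero_mem _)).1
    · intro m n hm hn
      simp only [smul_add, map_add, hm, hn]
      abel
  have hT1 : ∀ α, ∀ a ∈ 𝒜 α, ∀ m, T (a • m) = dA a 0 • m + sgn (δ * α) • (a • T m) := by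
    intro α a ha m
    refine hom_induction ℳ (p := fun m => T (a • m) = dA a 0 • m + sgn (δ * α) • (a • T m)) ?_ ?_ m
    · intro γ m hm
      have k := (hprod α a ha 0 (zero_mem _) γ m hm 0 (zero_mem _)).2.1
      simp only [hrho α a ha, ZeroMemClass.coe_zero, AddMonoid.End.zero_apply, add_zero, map_neg,
        smul_neg, ← neg_add] at k
      exact neg_injective k
    · intro m n hm hn
      simp only [smul_add, map_add, hm, hn]
      abel
  have hS2 : ∀ α, ∀ x ∈ eospGrading q α, ∀ m, S ((x : AddMonoid.End M) m) =
      dA 0 x • m + (dE 0 x : AddMonoid.End M) m + sgn (δ * α) • (x : AddMonoid.End M) (S m) := by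
    intro α x hx m
    refine hom_induction ℳ (p := fun m => S ((x : AddMonoid.End M) m) =
      dA 0 x • m + (dE 0 x : AddMonoid.End M) m + sgn (δ * α) • (x : AddMonoid.End M) (S m)) ?_ ?_ m
    · intro γ m hm
      simpa using (hprod α 0 (zero_mem _) x hx γ m hm 0 (zero_mem _)).1
    · intro m n hm hn
      simp only [smul_add, map_add, hm, hn]
      abel
  have hT2 : ∀ α, ∀ x ∈ eospGrading q α, ∀ m, T ((x : AddMonoid.End M) m) =
      -(dA 0 x • m) + (dE 0 x : AddMonoid.End M) m + sgn (δ * α) • (x : AddMonoid.End M) (T m) := by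
    intro α x hx m
    refine hom_induction ℳ (p := fun m => T ((x : AddMonoid.End M) m) =
      -(dA 0 x • m) + (dE 0 x : AddMonoid.End M) m + sgn (δ * α) • (x : AddMonoid.End M) (T m))
      ?_ ?_ m
    · intro γ m hm
      simpa using (hprod α 0 (zero_mem _) x hx γ m hm 0 (zero_mem _)).2.1
    · intro m n hm hn
      simp only [smul_add, map_add, hm, hn]
      abel
  -- `S - T` is a scalar
  have hUmem : S - T ∈ endGrading ℳ δ := sub_mem hSmem hTmem
  have hUx : ∀ α, ∀ x ∈ eospGrading q α,
      sbr ℳ (S - T) (x : AddMonoid.End M) = mulL M (dA 0 x + dA 0 x) := by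
    intro α x hx
    apply end_ext
    intro m
    rw [sbr_apply_hom ℳ hUmem (coe_mem_endGrading q hx), end_sub_apply, end_sub_apply, hS2 α x hx,
      hT2 α x hx, map_sub, smul_sub, mulL_apply, add_smul]
    abel
  obtain ⟨l, hl, hUl⟩ : ∃ l ∈ 𝒜 δ, S - T = mulL M l := by
    refine h.schur h2 hUmem (op_smul_of_map_smul (𝒜 := 𝒜) hUmem ?_) ?_
    · intro α a ha m
      rw [end_sub_apply, end_sub_apply, hS1 α a ha, hT1 α a ha, smul_sub, smul_sub]
      abel
    · intro x hx
      have k := hUx 0 ⟨_, endPart_mem_eosp q 0 hx⟩ (endPart_mem ℳ 0 x)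
      have k' := hUx 1 ⟨_, endPart_mem_eosp q 1 hx⟩ (endPart_mem ℳ 1 x)
      rw [← endPart_add ℳ x, map_add]
      exact ⟨_, (congrArg₂ (· + ·) k k').trans (mulL_add _ _).symm⟩
  -- scalars commute with `eosp q`, so `d` maps `eosp q` to itself
  have hmu : ∀ α, ∀ x ∈ eospGrading q α, dA 0 x = 0 := by
    intro α x hx
    have k := hUx α x hx
    have k1 : sbr ℳ (mulL M l) (x : AddMonoid.End M) = 0 := by
      apply end_ext
      intro m
      rw [sbr_apply_hom ℳ (mulL_mem_endGrading ℳ hl) (coe_mem_endGrading q hx), mulL_apply,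
        mulL_apply, map_smul_of_linear (coe_mem_endGrading q hx) (eosp_linear q x.2) hl,
        mul_comm α δ, sgn_smul_sgn_smul, sub_self]
      rfl
    rw [hUl, k1, ← mulL_zero (A := A) (M := M)] at k
    exact eq_zero_of_eq_neg h2 (eq_neg_of_add_eq_zero_left (he.mulL_injective k).symm)
  -- half of `l` is subtracted from `S` and added to `T`
  obtain ⟨r, hr, hrr⟩ := exists_half 𝒜 h2
  have hrl : r * l ∈ 𝒜 δ := by
    have k := SetLike.GradedMul.mul_mem hr hl
    rwa [zero_add] at k
  have hTS : ∀ m, T m = S m - (r * l) • m - (r * l) • m := by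
    intro m
    have k := DFunLike.congr_fun hUl m
    rw [end_sub_apply, mulL_apply] at k
    rw [sub_sub, ← add_smul, ← add_mul, hrr, one_mul, ← k]
    abel
  have hlform : ∀ β, ∀ m ∈ ℳ β, ∀ n,
      sgn (δ * β) • q.form m ((r * l) • n) = q.form ((r * l) • m) n := by
    intro β m hm n
    rw [← q.balanced, op_smul_eq (𝒜 := 𝒜) hrl hm, map_zsmul, AddMonoidHom.smul_apply,
      sgn_smul_sgn_smul]
  have hDadd : ∀ a b, dA (a + b) 0 = dA a 0 + dA b 0 := fun a b => by
    have k := (hAEadd a b 0 0).1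
    rwa [add_zero] at k
  let D : AddMonoid.End A := AddMonoidHom.mk' (fun a => dA a 0) hDadd
  have hlift : IsLift q δ (S - mulL M (r * l)) D := by
    refine ⟨sub_mem hSmem (mulL_mem_endGrading ℳ hrl), ?_, ?_, ?_⟩
    · intro γ a ha
      exact (hmem γ a ha 0 (zero_mem _) 0 (zero_mem _) 0 (zero_mem _)).1
    · intro α a ha m
      change S (a • m) - (r * l) • (a • m) = dA a 0 • m + sgn (δ * α) • (a • (S m - (r * l) • m))
      rw [hS1 α a ha, smul_sub, smul_sub, ← mul_smul, ← mul_smul,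
        IsSupercommutative.mul_comm hrl ha, smul_assoc]
      abel
    · intro β m hm n
      change dA (q.form m n) 0 = q.form (S m - (r * l) • m) n +
        sgn (δ * β) • q.form m (S n - (r * l) • n)
      -- the derivation property on the product of `(0, m, 0, 0)` and `(0, 0, n, 0)`
      have hform : dA (q.form m n) 0 = q.form (S m) n + sgn (δ * β) • q.form m (T n) := by
        refine hom_induction ℳ (p := fun n => dA (q.form m n) 0 =
          q.form (S m) n + sgn (δ * β) • q.form m (T n)) ?_ ?_ n
        · intro γ n hn
          have k := hd.2.2 β _ (ofCoord_mem q (zero_mem (𝒜 β)) hm (zero_mem _)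
            (zero_mem (eospGrading q β))) (ofCoord q (0, 0, n, 0))
          have b2 := hSmem β m hm
          have b3 := hTmem γ n hn
          rw [hS0, hT0, show S0 m = S m from rfl, show T0 n = T n from rfl,
            eospBr_ofCoord q (zero_mem (𝒜 β)) hm (zero_mem _) (zero_mem (eospGrading q β))
              (zero_mem (𝒜 γ)) (zero_mem _) hn (zero_mem (eospGrading q γ)), hdval,
            eospBr_ofCoord q (zero_mem (𝒜 _)) b2 (zero_mem _) (zero_mem (eospGrading q _))
              (zero_mem (𝒜 γ)) (zero_mem _) hn (zero_mem (eospGrading q γ)),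
            eospBr_ofCoord q (zero_mem (𝒜 β)) hm (zero_mem _) (zero_mem (eospGrading q β))
              (zero_mem (𝒜 _)) (zero_mem _) b3 (zero_mem (eospGrading q _)),
            ofCoord_zsmul, ofCoord_add, ofCoord_eq_iff] at k
          have k1 := k.1
          simp only [map_zero, sub_zero, opEs_zero_left, add_zero] at k1
          rw [← k1]
          have k2 := (hAEadd (q.form m n) 0 0 (opEs q m n)).1
          rw [hmu _ (opEs q m n) (opE_mem_grading q hm hn), add_zero, add_zero, zero_add] at k2
          exact k2.symm
        · intro n p hn hp
          simp only [map_add, hDadd, hn, hp, smul_add]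
          abel
      rw [hform, hTS]
      simp only [map_sub, AddMonoidHom.sub_apply, smul_sub, hlform β m hm]
      abel
  have hK : ∀ c m, (S - mulL M (r * l)) (op (f c) • m) = op (f c) • (S - mulL M (r * l)) m := by
    intro c m
    have k := hd.2.1 c (ofCoord q (0, m, 0, 0))
    rw [eospR_ofCoord, hdval, hdval, eospR_ofCoord, ofCoord_eq_iff] at k
    have k1 : S (op (f c) • m) = op (f c) • S m := k.2.1
    rw [end_sub_apply, end_sub_apply, k1, mulL_apply, mulL_apply, smul_sub,
      smul_comm (r * l) (op (f c)) m]
  refine ⟨ofCoord q (r * l, 0, 0, 0), S - mulL M (r * l),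
    (mem_sPiece_iff f he).mpr ⟨hK, _, hlift⟩, (isOuter_iff he hlift.normalizes).mpr ?_⟩
  apply end_ext
  intro y
  refine ofCoord_induction q (p := fun y => (d - adE (qInf q) (ofCoord q (r * l, 0, 0, 0))) y =
    outerMap q hlift.normalizes y) ?_ ?_ y
  · intro α a ha m hm n hn x hx
    rw [end_sub_apply, hdval, adE_apply, eospBr_ofCoord_zero hrl (zero_mem _) ha hm hn hx,
      outerMap_ofCoord, ← map_sub]
    refine congrArg (ofCoord q) (Prod.ext ?_ (Prod.ext ?_ (Prod.ext ?_ (Subtype.ext ?_))))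
    · have k := (hAEadd a 0 0 x).1
      rw [hmu α x hx, add_zero, add_zero, zero_add] at k
      change dA a x - 0 = dA a 0
      rw [k, sub_zero]
    · change S m - ((r * l) • m + 0) = S m - (r * l) • m
      rw [add_zero]
    · change T n - (-((r * l) • n) + 0) = S n - (r * l) • n
      rw [hTS]
      abel
    · have k := (hAEadd a 0 0 x).2
      rw [hrho α a ha, zero_add, add_zero, zero_add] at k
      change (dE a x : AddMonoid.End M) - sbr ℳ (0 : AddMonoid.End M) x =
        sbr ℳ (S - mulL M (r * l)) x
      rw [k, map_zero, AddMonoidHom.zero_apply, sub_zero]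
      apply end_ext
      intro p
      rw [sbr_apply_hom ℳ hlift.mem (coe_mem_endGrading q hx), end_sub_apply, end_sub_apply,
        hS2 α x hx, hmu α x hx, mulL_apply, mulL_apply, map_sub,
        map_smul_of_linear (coe_mem_endGrading q hx) (eosp_linear q x.2) hrl, mul_comm α δ,
        smul_sub, sgn_smul_sgn_smul]
      simp
  · intro y z hy hz
    rw [map_add, map_add, hy, hz]

/-- With `d ζ = (a₀, m₀, n₁, x₀)`, subtracting the inner derivation of `(0, -m₀, n₁, 0)` removes the
components of `d ζ` of degree `±1` in the `3`-grading. -/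
theorem exists_isOuter_sub (h2 : IsUnit (2 : A)) {n₀ : M} (h : IsLarge q e e' n₀)
    (hd : d ∈ derPiece (eospGrading (qInf q)) (fun c => eospR (qInf q) (f c))
      (eospBr (qInf q)) δ) :
    ∃ z, ∃ S ∈ sPiece f q (eosp q) δ, IsOuter q S (d - adE (qInf q) z) := by
  have hζ := hd.1 0 _ (gradingElement_mem (q := q))
  rw [zero_add] at hζ
  obtain ⟨a₀, ha₀, m₀, hm₀, n₁, hn₁, x₀, hx₀, hdζ⟩ := exists_hom_ofCoord q hζ
  have hz := ofCoord_mem q (zero_mem (𝒜 δ)) (neg_mem hm₀) hn₁ (zero_mem (eospGrading q δ))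
  have hd1 := sub_mem hd (adE_mem_derPiece f (qInf q) hz)
  have h1 : (d - adE (qInf q) (ofCoord q (0, -m₀, n₁, 0))) (gradingElement q) =
      ofCoord q (a₀, 0, 0, x₀) := by
    rw [end_sub_apply, hdζ, adE_apply, gradingElement, eospBr_ofCoord q (zero_mem (𝒜 δ))
      (neg_mem hm₀) hn₁ (zero_mem (eospGrading q δ)) SetLike.GradedOne.one_mem (zero_mem (ℳ 0))
      (zero_mem (ℳ 0)) (zero_mem (eospGrading q 0)), ← map_sub]
    congr 1
    simp [opEs_zero_right]
  obtain ⟨-, k1, k2, k3⟩ := derPiece_of_map_gradingElement f h2 h.toIsHypPair hd1 ha₀ hx₀ h1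
  obtain ⟨z, S, hS, hz⟩ := exists_isOuter_sub_of_preserves f h2 h hd1 k1 k2 k3
  refine ⟨ofCoord q (0, -m₀, n₁, 0) + z, S, hS, ?_⟩
  rwa [adE_add, ← sub_sub]

theorem derEosp_eq (h2 : IsUnit (2 : A)) {n₀ : M} (h : IsLarge q e e' n₀) :
    derEosp f (qInf q) = adOf (eospBr (qInf q)) ⊤ ⊔ outer q (sE f q (eosp q)) := by
  apply le_antisymm
  · have key : ∀ α, derPiece (eospGrading (qInf q)) (fun c => eospR (qInf q) (f c))
        (eospBr (qInf q)) α ≤ adOf (eospBr (qInf q)) ⊤ ⊔ outer q (sE f q (eosp q)) := by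
      intro α d hd
      obtain ⟨z, S, hS, hz⟩ := exists_isOuter_sub f h2 h hd
      rw [← add_sub_cancel (adE (qInf q) z) d]
      exact AddSubgroup.add_mem_sup (adE_mem_adOf _ z) ⟨S, mem_sup_of_mem_piece hS, hz⟩
    exact sup_le (key 0) (key 1)
  · refine sup_le ?_ (outer_le_derEosp f h.toIsHypPair)
    intro d hd
    obtain ⟨z, -, rfl⟩ := (mem_adOf _).mp hd
    exact adE_mem_derEosp f _ z

theorem isOuter_adE_coe (he : IsHypPair q e e') (x : eosp q) :
    IsOuter q (x : AddMonoid.End M) (adE (qInf q) (ofCoord q (0, 0, 0, x))) := by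
  have key : ∀ α, ∀ x ∈ eospGrading q α,
      IsOuter q (x : AddMonoid.End M) (adE (qInf q) (ofCoord q (0, 0, 0, x))) := by
    intro α x hx
    have hl := isLift_of_mem_eosp x.2 (coe_mem_endGrading q hx)
    rw [isOuter_iff he hl.normalizes]
    apply end_ext
    intro y
    refine ofCoord_induction q (p := fun y => adE (qInf q) (ofCoord q (0, 0, 0, x)) y =
      outerMap q hl.normalizes y) ?_ ?_ y
    · intro β a ha m hm n hn y hy
      rw [adE_apply, eospBr_ofCoord_zero (zero_mem _) hx ha hm hn hy, outerMap_ofCoord]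
      simp
      rfl
    · intro y z hy hz
      rw [map_add, map_add, hy, hz]
  rw [← part_add (eospGrading q) x]
  have k := (key 0 _ (part_mem (eospGrading q) 0 x)).add (key 1 _ (part_mem (eospGrading q) 1 x))
  rw [← adE_add, ofCoord_add] at k
  simpa using k

/-- If `ad z` is some `d_{S,0}`, it kills the grading element, so `z` has degree zero in the
`3`-grading, and comparing the action on both outer pieces shows that `z` has no scalar part. -/
theorem exists_of_isOuter_adE (h2 : IsUnit (2 : A)) (he : IsHypPair q e e')
    {S : AddMonoid.End M} (hS : S ∈ sE f q (eosp q)) {z : eosp (qInf q)}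
    (h : IsOuter q S (adE (qInf q) z)) : ∃ x : eosp q, z = ofCoord q (0, 0, 0, x) := by
  have key : ∀ α, ∀ S ∈ sPiece f q (eosp q) α, ∀ z ∈ eospGrading (qInf q) α,
      IsOuter q S (adE (qInf q) z) → ∃ x : eosp q, z = ofCoord q (0, 0, 0, x) := by
    intro α S hS z hz h
    obtain ⟨-, D, hD⟩ := (mem_sPiece_iff f he).mp hS
    rw [isOuter_iff he hD.normalizes] at h
    obtain ⟨a, ha, m, hm, n, hn, x, hx, rfl⟩ := exists_hom_ofCoord q hz
    have k1 := DFunLike.congr_fun h (gradingElement q)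
    have hD1 : D 1 = 0 := by
      have hD2 := hD.coeff_mul he SetLike.GradedOne.one_mem 1
      simpa using hD2
    rw [adE_apply, gradingElement, eospBr_ofCoord q ha hm hn hx SetLike.GradedOne.one_mem
      (zero_mem (ℳ 0)) (zero_mem (ℳ 0)) (zero_mem (eospGrading q 0)), outerMap_ofCoord,
      ofCoord_eq_iff] at k1
    have hm0 : m = 0 := by simpa using k1.2.1
    have hn0 : n = 0 := by simpa using k1.2.2.1
    subst hm0 hn0
    have k2 := DFunLike.congr_fun h (ofCoord q (0, e, e, 0))
    rw [adE_apply, eospBr_ofCoord_zero ha hx (zero_mem (𝒜 0)) he.left_mem he.left_mem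
      (zero_mem (eospGrading q 0)), outerMap_ofCoord, ofCoord_eq_iff] at k2
    have k3 := k2.2.1.trans k2.2.2.1.symm
    have k4 : a • e = 0 := eq_zero_of_eq_neg h2 (add_right_cancel k3)
    have k5 : a = 0 := by rw [← he.symm.form_smul a, k4, map_zero]
    exact ⟨x, by rw [k5]⟩
  have hparts : ∀ α, ∃ x : eosp q, part (eospGrading (qInf q)) α z = ofCoord q (0, 0, 0, x) := by
    intro α
    refine key α _ ((mem_sup_pieces ℳ (D := sPiece f q (eosp q))
      (fun _ _ h => And.left h)).mp hS α) _ (part_mem _ α z) ?_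
    rw [← adE_part]
    exact h.endPart_of_mem_sE f he hS α
  obtain ⟨x, hx⟩ := hparts 0
  obtain ⟨y, hy⟩ := hparts 1
  refine ⟨x + y, ?_⟩
  rw [← part_add (eospGrading (qInf q)) z, hx, hy, ofCoord_add]
  simp

theorem ad_inf_outer (h2 : IsUnit (2 : A)) (he : IsHypPair q e e') :
    adOf (eospBr (qInf q)) ⊤ ⊓ outer q (sE f q (eosp q)) =
      adOf (eospBr (qInf q)) (eospIn q) := by
  apply le_antisymm
  · rintro d ⟨hd, S, hS, hSd⟩
    obtain ⟨z, -, rfl⟩ := (mem_adOf _).mp hd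
    obtain ⟨x, rfl⟩ := exists_of_isOuter_adE f h2 he hS hSd
    exact (mem_adOf _).mpr ⟨_, ⟨x, x.2, rfl⟩, rfl⟩
  · intro d hd
    obtain ⟨z, ⟨x, hx, hz⟩, rfl⟩ := (mem_adOf _).mp hd
    have h1 : z = ofCoord q (0, 0, 0, ⟨x, hx⟩) := Subtype.ext hz
    rw [h1]
    exact ⟨adE_mem_adOf _ _, x, eosp_le_sE f he hx, isOuter_adE_coe he ⟨x, hx⟩⟩

/-- A complement of `eosp q` in `S_E` yields a complement of the inner derivations, since
`d_{x,0} = ad x` for `x` in `eosp q` and `S` is determined by `d_{S,0}`. -/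
theorem isSemidirect_of_complement (h2 : IsUnit (2 : A)) {n₀ : M} (h : IsLarge q e e' n₀)
    {S₀ : AddSubgroup (AddMonoid.End M)}
    (hS₀ : IsSemidirect ℳ (fun c => mulL M (f c)) (sE f q (eosp q)) (eosp q) S₀) :
    IsSemidirect (eospGrading (qInf q)) (fun c => eospL (qInf q) (f c))
      (derEosp f (qInf q)) (adOf (eospBr (qInf q)) ⊤) (outer q S₀) := by
  have he := h.toIsHypPair
  have hle : S₀ ≤ sE f q (eosp q) := by
    rw [← hS₀.sup_eq]
    exact le_sup_right
  refine ⟨isSubalgebra_derEosp f _, isSubalgebra_ad f _,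
    isSubalgebra_outer f he hle hS₀.isSubalgebra_right, fun d hd g hg => sbr_mem_ad f _ hd hg,
    ?_, ?_⟩
  · rw [eq_bot_iff]
    rintro d ⟨hd, S, hS, hSd⟩
    obtain ⟨z, -, rfl⟩ := (mem_adOf _).mp hd
    obtain ⟨x, rfl⟩ := exists_of_isOuter_adE f h2 he (hle hS) hSd
    have hSx : S = x := hSd.injective (isOuter_adE_coe he x)
    have h0 : S ∈ eosp q ⊓ S₀ := ⟨by rw [hSx]; exact x.2, hS⟩
    rw [hS₀.inf_eq, AddSubgroup.mem_bot] at h0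
    have hx0 : x = 0 := Subtype.ext (hSx.symm.trans h0)
    rw [hx0, ofCoord_zero]
    exact map_zero (eospBr (qInf q))
  · rw [derEosp_eq f h2 h]
    refine le_antisymm (sup_le_sup_left (outer_mono hle) _) (sup_le le_sup_left ?_)
    rintro d ⟨S, hS, hSd⟩
    rw [← hS₀.sup_eq] at hS
    obtain ⟨x, hx, s, hs, rfl⟩ := AddSubgroup.mem_sup.mp hS
    obtain ⟨D, hD⟩ := exists_normalizes f he (hle hs)
    have h1 := (isOuter_adE_coe he ⟨x, hx⟩).add (isOuter_outerMap he hD)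
    have h3 : x + s ∈ sE f q (eosp q) := add_mem (eosp_le_sE f he hx) (hle hs)
    rw [(existsUnique_isOuter f he h3).unique hSd h1]
    exact AddSubgroup.add_mem_sup (adE_mem_adOf _ _) ⟨s, hs, isOuter_outerMap he hD⟩

end Structure

/-! ### Homogeneous bases adapted to a quadratic form -/

section AdaptedBasis

variable {A M τ : Type*} [Ring A] [AddCommGroup M] [Module A M] [Module Aᵐᵒᵖ M]
  {𝒜 : ZMod 2 → AddSubgroup A} {ℳ : ZMod 2 → AddSubgroup M} [GradedRing 𝒜]
  [IsSupercommutative 𝒜] [DirectSum.Decomposition ℳ] [SMulCommClass A Aᵐᵒᵖ M]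
  [IsSupermodule 𝒜 ℳ]

/-- The basis `B` of `M` is homogeneous, with degrees `deg`, and adapted to the form `q`: the
vectors `B s` with `s ∉ X` lie in the radical, and `B s` with `s ∈ X` is paired nontrivially
with `B (bar s)` alone, the value `u s` being invertible with inverse `v s`. For `s ∉ X` the element
`u s` is an arbitrary even unit. -/
structure IsAdapted (q : QuadForm 𝒜 ℳ) (B : Module.Basis τ A M) (X : Set τ) (bar : τ → τ)
    (deg : τ → ZMod 2) (u v : τ → A) : Prop where
  basis_mem : ∀ s, B s ∈ ℳ (deg s)
  unit_mem : ∀ s, u s ∈ 𝒜 0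
  inv_mem : ∀ s, v s ∈ 𝒜 0
  unit_mul_inv : ∀ s, u s * v s = 1
  bar_mem : ∀ s ∈ X, bar s ∈ X
  bar_bar : ∀ s ∈ X, bar (bar s) = s
  deg_bar : ∀ s ∈ X, deg (bar s) = deg s
  unit_bar : ∀ s ∈ X, u (bar s) = sgn (deg s) • u s
  form_bar : ∀ s ∈ X, q.form (B s) (B (bar s)) = u s
  form_ne : ∀ s ∈ X, ∀ t, t ≠ bar s → q.form (B s) (B t) = 0
  form_radical : ∀ s ∉ X, ∀ m, q.form (B s) m = 0

theorem mul_comm_of_even {a : A} (ha : a ∈ 𝒜 0) (b : A) : a * b = b * a := by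
  refine hom_induction 𝒜 (p := fun b => a * b = b * a) ?_ ?_ b
  · intro β b hb
    rw [IsSupercommutative.mul_comm ha hb, zero_mul, sgn_zero, one_smul]
  · intro b c hb hc
    rw [mul_add, add_mul, hb, hc]

theorem smul_eq_op_smul_of_even (ℳ : ZMod 2 → AddSubgroup M) [DirectSum.Decomposition ℳ]
    [IsSupermodule 𝒜 ℳ] {a : A} (ha : a ∈ 𝒜 0) (m : M) : a • m = op a • m := by
  refine hom_induction ℳ (p := fun m => a • m = op a • m) ?_ ?_ m
  · intro β m hm
    rw [IsSupermodule.smul_eq ha hm, zero_mul, sgn_zero, one_smul]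
  · intro m n hm hn
    rw [smul_add, smul_add, hm, hn]

variable (𝒜) in
/-- A statement about the elements of a free module that is preserved by sums holds as soon as it
holds for the homogeneous multiples of the basis vectors. -/
theorem basis_induction (B : Module.Basis τ A M) {p : M → Prop} (h0 : p 0)
    (hadd : ∀ m n, p m → p n → p (m + n)) (h : ∀ α, ∀ a ∈ 𝒜 α, ∀ s, p (a • B s)) (m : M) : p m := by
  rw [← B.linearCombination_repr m, Finsupp.linearCombination_apply, Finsupp.sum]
  refine Finset.sum_induction _ p (fun a b => hadd a b) h0 (fun s _ => ?_)
  exact hom_induction 𝒜 (p := fun a => p (a • B s)) (fun α a ha => h α a ha s)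
    (fun a b ha hb => by rw [add_smul]; exact hadd _ _ ha hb) _

/-- The version of `basis_induction` for the homogeneous elements of one degree. -/
theorem hom_basis_induction {B : Module.Basis τ A M} {deg : τ → ZMod 2}
    (hB : ∀ s, B s ∈ ℳ (deg s)) {γ : ZMod 2} {p : M → Prop} (h0 : p 0)
    (hadd : ∀ m n, p m → p n → p (m + n))
    (h : ∀ α, ∀ a ∈ 𝒜 α, ∀ s, α + deg s = γ → p (a • B s)) {m : M} (hm : m ∈ ℳ γ) : p m := by
  have key : ∀ m, p (part ℳ γ m) := by
    refine basis_induction 𝒜 B (p := fun m => p (part ℳ γ m)) ?_ ?_ ?_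
    · rwa [map_zero]
    · intro m n hm hn
      rw [map_add]
      exact hadd _ _ hm hn
    · intro α a ha s
      have k := IsSupermodule.smul_mem (𝒜 := 𝒜) (ℳ := ℳ) ha (hB s)
      by_cases hs : α + deg s = γ
      · rw [hs] at k
        rw [part_same ℳ k]
        exact h α a ha s hs
      · rwa [part_ne ℳ k hs]
  have k := key m
  rwa [part_same ℳ hm] at k

variable (𝒜) in
theorem end_ext_basis (B : Module.Basis τ A M) {S T : AddMonoid.End M}
    (h : ∀ α, ∀ a ∈ 𝒜 α, ∀ s, S (a • B s) = T (a • B s)) : S = T := by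
  apply end_ext
  refine basis_induction 𝒜 B (p := fun m => S m = T m) ?_ ?_ h
  · rw [map_zero, map_zero]
  · intro m n hm hn
    rw [map_add, map_add, hm, hn]

theorem mem_endGrading_of_basis {B : Module.Basis τ A M} {deg : τ → ZMod 2}
    (hB : ∀ s, B s ∈ ℳ (deg s)) {δ : ZMod 2} {S : AddMonoid.End M}
    (h : ∀ α, ∀ a ∈ 𝒜 α, ∀ s, S (a • B s) ∈ ℳ (α + deg s + δ)) : S ∈ endGrading ℳ δ := by
  intro γ m hm
  refine hom_basis_induction (𝒜 := 𝒜) hB (p := fun m => S m ∈ ℳ (γ + δ)) ?_ ?_ ?_ hm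
  · rw [map_zero]
    exact zero_mem _
  · intro m n hm hn
    rw [map_add]
    exact add_mem hm hn
  · rintro α a ha s rfl
    exact h α a ha s

/-- Right linear maps are determined by their values on a homogeneous basis. -/
theorem eq_of_linear_of_support (𝒜 : ZMod 2 → AddSubgroup A) [GradedRing 𝒜] [IsSupermodule 𝒜 ℳ]
    {B : Module.Basis τ A M} {deg : τ → ZMod 2}
    (hB : ∀ s, B s ∈ ℳ (deg s)) {S T : AddMonoid.End M}
    (hS : ∀ (a : A) m, S (op a • m) = op a • S m) (hT : ∀ (a : A) m, T (op a • m) = op a • T m)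
    {m : M} (h : ∀ s, B.repr m s ≠ 0 → S (B s) = T (B s)) : S m = T m := by
  have key : ∀ s (a : A), S (B s) = T (B s) → S (a • B s) = T (a • B s) := by
    intro s a hs
    refine hom_induction 𝒜 (p := fun a => S (a • B s) = T (a • B s)) ?_ ?_ a
    · intro α a ha
      rw [IsSupermodule.smul_eq ha (hB s), map_zsmul, map_zsmul, hS, hT, hs]
    · intro a b ha hb
      rw [add_smul, map_add, map_add, ha, hb]
  rw [← B.linearCombination_repr m, Finsupp.linearCombination_apply, Finsupp.sum, map_sum, map_sum]
  exact Finset.sum_congr rfl fun s hs => key s _ (h s (Finsupp.mem_support_iff.mp hs))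

variable {q : QuadForm 𝒜 ℳ} {B : Module.Basis τ A M} {X : Set τ} {bar : τ → τ}
  {deg : τ → ZMod 2} {u v : τ → A}

theorem IsAdapted.inv_bar (h : IsAdapted q B X bar deg u v) {s : τ} (hs : s ∈ X) :
    v (bar s) = sgn (deg s) • v s := by
  have h1 : v s * u s = 1 := by rw [← mul_comm_of_even (h.unit_mem s), h.unit_mul_inv]
  have h2 := h.unit_mul_inv (bar s)
  rw [h.unit_bar s hs, smul_mul_assoc] at h2
  calc v (bar s) = v s * u s * v (bar s) := by rw [h1, one_mul]
    _ = sgn (deg s) • (v s * (sgn (deg s) • (u s * v (bar s)))) := by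
      rw [mul_smul_comm, sgn_smul_sgn_smul, mul_assoc]
    _ = _ := by rw [h2, mul_one]

/-- The vector `v (bar s) B (bar s)` dual to the basis vector `B s`. -/
def dualVec (B : Module.Basis τ A M) (bar : τ → τ) (v : τ → A) (s : τ) : M :=
  v (bar s) • B (bar s)

theorem IsAdapted.dualVec_mem (h : IsAdapted q B X bar deg u v) {s : τ} (hs : s ∈ X) :
    dualVec B bar v s ∈ ℳ (deg s) := by
  have k := IsSupermodule.smul_mem (𝒜 := 𝒜) (ℳ := ℳ) (h.inv_mem (bar s)) (h.basis_mem (bar s))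
  rwa [zero_add, h.deg_bar s hs] at k

theorem IsAdapted.form_dualVec_self (h : IsAdapted q B X bar deg u v) {s : τ} (hs : s ∈ X) :
    q.form (dualVec B bar v s) (B s) = 1 := by
  have k := h.form_bar (bar s) (h.bar_mem s hs)
  rw [h.bar_bar s hs] at k
  rw [dualVec, form_smul_left, k, ← mul_comm_of_even (h.unit_mem _), h.unit_mul_inv]

theorem IsAdapted.form_dualVec_ne (h : IsAdapted q B X bar deg u v) {s : τ} (hs : s ∈ X) {t : τ}
    (ht : t ≠ s) : q.form (dualVec B bar v s) (B t) = 0 := by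
  rw [dualVec, form_smul_left, h.form_ne (bar s) (h.bar_mem s hs), mul_zero]
  rwa [h.bar_bar s hs]

/-- The homogeneous components of a vector of the radical belong to the radical. -/
theorem form_part_eq_zero {m : M} (hm : ∀ n, q.form m n = 0) (γ : ZMod 2) (n : M) :
    q.form (part ℳ γ m) n = 0 := by
  refine hom_induction ℳ (p := fun n => q.form (part ℳ γ m) n = 0) ?_ ?_ n
  · intro β n hn
    have key : part 𝒜 (γ + β) (q.form m n) = q.form (part ℳ γ m) n := by
      rw [← part_add ℳ m, map_add, map_add, AddMonoidHom.add_apply, map_add, map_add]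
      have h0 := q.degree (part_mem ℳ 0 m) hn
      have h1 := q.degree (part_mem ℳ 1 m) hn
      have e : (1 : ZMod 2) ≠ 0 := by decide
      rcases parity_cases γ with rfl | rfl
      · rw [part_same 𝒜 h0, part_ne 𝒜 h1 (fun k => e (add_right_cancel k)),
          part_same ℳ (part_mem ℳ 0 m), part_ne ℳ (part_mem ℳ 1 m) e, map_zero, add_zero, add_zero]
      · rw [part_same 𝒜 h1, part_ne 𝒜 h0 (fun k => e.symm (add_right_cancel k)),
          part_same ℳ (part_mem ℳ 1 m), part_ne ℳ (part_mem ℳ 0 m) e.symm, map_zero, zero_add, zero_add]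
    rw [← key, hm, map_zero]
  · intro n r hn hr
    rw [map_add, hn, hr, add_zero]

theorem form_comm_eq_zero {m : M} (hm : ∀ n, q.form m n = 0) (n : M) : q.form n m = 0 := by
  refine hom_induction ℳ (p := fun n => q.form n m = 0) ?_ ?_ n
  · intro β n hn
    rw [← part_add ℳ m, map_add, q.symm hn (part_mem ℳ 0 m), q.symm hn (part_mem ℳ 1 m),
      form_part_eq_zero hm, form_part_eq_zero hm, smul_zero, smul_zero, add_zero]
  · intro n r hn hr
    rw [map_add, AddMonoidHom.add_apply, hn, hr, add_zero]

/-- A homogeneous linear map that is skew for `q` agrees with an element of `eosp q` on the basis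
vectors of the radical and on any given finite set of the others. With `π p` the sum of the
`± s* q(s, p)`, one takes the sum of the `E (S s - 1/2 π S s) s*`. -/
theorem IsAdapted.exists_mem_eosp (h2 : IsUnit (2 : A)) (h : IsAdapted q B X bar deg u v)
    {δ : ZMod 2} {S : AddMonoid.End M} (hS : IsLift q δ S 0) (hX : ∀ s ∉ X, S (B s) = 0)
    (G : Finset τ) (hG : ∀ s ∈ G, s ∈ X) :
    ∃ x ∈ eosp q, x ∈ endGrading ℳ δ ∧ (∀ s ∉ X, x (B s) = S (B s)) ∧
      ∀ s ∈ G, x (B s) = S (B s) := by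
  classical
  obtain ⟨r, hr, hrr⟩ := exists_half 𝒜 h2
  -- `π` is the projection onto the span of the `s*` with `s ∈ G`; `q(π p, t) = q(p, t)` for `t ∈ G`
  let π : M → M := fun p => ∑ s ∈ G, sgn (deg s) • (op (q.form (B s) p) • dualVec B bar v s)
  have hπ : ∀ γ, ∀ p ∈ ℳ γ, π p ∈ ℳ γ := by
    intro γ p hp
    refine sum_mem fun s hs => zsmul_mem ?_ _
    have k := op_smul_mem (q.degree (h.basis_mem s) hp) (h.dualVec_mem (hG s hs))
    have e : deg s + γ + deg s = γ := by
      rw [add_right_comm, CharTwo.add_self_eq_zero, zero_add]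
    rwa [e] at k
  have hπ1 : ∀ γ, ∀ p ∈ ℳ γ, ∀ t ∈ G, q.form (π p) (B t) = q.form p (B t) := by
    intro γ p hp t ht
    have e : ∀ s ∈ G, q.form (sgn (deg s) • (op (q.form (B s) p) • dualVec B bar v s)) (B t) =
        if s = t then q.form p (B t) else 0 := by
      intro s hs
      rw [map_zsmul, AddMonoidHom.smul_apply, q.balanced,
        IsSupermodule.smul_eq (q.degree (h.basis_mem s) hp) (h.basis_mem t), map_zsmul, q.linear]
      split_ifs with hst
      · subst hst
        rw [h.form_dualVec_self (hG s hs), one_mul, q.symm hp (h.basis_mem s), smul_smul]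
        congr 1
        rcases parity_cases (deg s) with k | k <;> rcases parity_cases γ with rfl | rfl <;>
          rw [k] <;> simp
      · rw [h.form_dualVec_ne (hG s hs) (Ne.symm hst), zero_mul, smul_zero, smul_zero]
    rw [map_sum, AddMonoidHom.finsetSum_apply, Finset.sum_congr rfl e, Finset.sum_ite_eq' G t,
      if_pos ht]
  let U : τ → M := fun s => S (B s) - r • π (S (B s))
  have hSB : ∀ s, S (B s) ∈ ℳ (deg s + δ) := fun s => hS.mem _ _ (h.basis_mem s)
  have hU : ∀ s, U s ∈ ℳ (deg s + δ) := by
    intro s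
    have k := IsSupermodule.smul_mem (𝒜 := 𝒜) (ℳ := ℳ) hr (hπ _ _ (hSB s))
    rw [zero_add] at k
    exact sub_mem (hSB s) k
  have hE : ∀ s ∈ G, ∀ p, opE q (U s) (dualVec B bar v s) p =
      op (q.form (dualVec B bar v s) p) • U s -
        sgn ((deg s + δ) * deg s) • (op (q.form (U s) p) • dualVec B bar v s) :=
    fun s hs p => opE_apply q (hU s) (h.dualVec_mem (hG s hs)) p
  refine ⟨∑ s ∈ G, opE q (U s) (dualVec B bar v s), sum_mem fun s _ => opE_mem q _ _,
    sum_mem fun s hs => ?_, fun s hs => ?_, fun t ht => ?_⟩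
  · have k := opE_mem_grading q (hU s) (h.dualVec_mem (hG s hs))
    have e : deg s + δ + deg s = δ := by
      rw [add_right_comm, CharTwo.add_self_eq_zero, zero_add]
    rwa [e] at k
  · rw [hX s hs]
    refine (AddMonoidHom.finsetSum_apply _ _ _).trans (Finset.sum_eq_zero fun t ht => ?_)
    have k := form_comm_eq_zero (h.form_radical s hs)
    refine (hE t ht _).trans ?_
    rw [k, k, op_zero, zero_smul, zero_smul, smul_zero, sub_zero]
  -- by skewness of `S` the second halves of the operators add up to `1/2 π S t`, which makes up for
  -- the correction in `U t`
  · have e : ∀ s ∈ G, opE q (U s) (dualVec B bar v s) (B t) =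
        (if s = t then U t else 0) +
          r • (sgn (deg s) • (op (q.form (B s) (S (B t))) • dualVec B bar v s)) := by
      intro s hs
      have k : q.form (U s) (B t) = -(sgn (δ * deg s) • (r * q.form (B s) (S (B t)))) := by
        have k1 := hS.map_form _ _ (h.basis_mem s) (B t)
        have k2 : q.form (U s) (B t) = r * q.form (S (B s)) (B t) := by
          change q.form (S (B s) - r • π (S (B s))) (B t) = _
          rw [map_sub, AddMonoidHom.sub_apply, form_smul_left, hπ1 _ _ (hSB s) t ht]
          nth_rewrite 1 [← one_mul (q.form (S (B s)) (B t))]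
          rw [← hrr]
          noncomm_ring
        rw [k2, eq_neg_of_add_eq_zero_left (k1.symm.trans rfl), mul_neg, mul_smul_comm]
      have k3 : ∀ a : A, op (r * a) • dualVec B bar v s = r • (op a • dualVec B bar v s) := by
        intro a
        rw [mul_comm_of_even hr, op_mul, mul_smul, ← smul_eq_op_smul_of_even ℳ hr]
      rw [hE s hs, k, op_neg, neg_smul, op_smul, smul_assoc, k3, smul_neg, sub_neg_eq_add,
        smul_smul, smul_comm r (sgn _)]
      congr 1
      · split_ifs with hst
        · subst hst
          rw [h.form_dualVec_self (hG s hs), op_one, one_smul]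
        · rw [h.form_dualVec_ne (hG s hs) (Ne.symm hst), op_zero, zero_smul]
      · congr 1
        rcases parity_cases (deg s) with k' | k' <;> rcases parity_cases δ with rfl | rfl <;>
          rw [k'] <;> simp
    refine (AddMonoidHom.finsetSum_apply _ _ _).trans ?_
    refine (Finset.sum_congr rfl e).trans ?_
    rw [Finset.sum_add_distrib, Finset.sum_ite_eq' G t, if_pos ht, ← Finset.smul_sum]
    exact sub_add_cancel _ _

end AdaptedBasis

/-! ### Finite approximation and locally inner derivations -/

section LocallyInner

variable {K A M τ : Type*} [Ring K] [Ring A] [AddCommGroup M] [Module A M] [Module Aᵐᵒᵖ M]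
  {𝒜 : ZMod 2 → AddSubgroup A} {ℳ : ZMod 2 → AddSubgroup M} [GradedRing 𝒜]
  [IsSupercommutative 𝒜] [DirectSum.Decomposition ℳ] [SMulCommClass A Aᵐᵒᵖ M]
  [IsSupermodule 𝒜 ℳ] {q : QuadForm 𝒜 ℳ} {e e' : M} {δ : ZMod 2}

theorem IsLift.linear {S : AddMonoid.End M} (h : IsLift q δ S 0) (a : A) (m : M) :
    S (op a • m) = op a • S m := by
  refine hom_induction ℳ (p := fun m => S (op a • m) = op a • S m) ?_ ?_ m
  · intro β m hm
    rw [h.map_op_smul a hm, AddMonoid.End.zero_apply, op_zero, zero_smul, smul_zero, add_zero]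
  · intro m n hm hn
    rw [smul_add, map_add, map_add, smul_add, hm, hn]

theorem IsLift.sub {S T : AddMonoid.End M} {D E : AddMonoid.End A} (h : IsLift q δ S D)
    (h' : IsLift q δ T E) : IsLift q δ (S - T) (D - E) where
  mem := sub_mem h.mem h'.mem
  coeff_mem := sub_mem h.coeff_mem h'.coeff_mem
  map_smul := fun α a ha m => by
    rw [end_sub_apply, end_sub_apply, end_sub_apply, h.map_smul α a ha, h'.map_smul α a ha,
      smul_sub, smul_sub, sub_smul]
    abel
  map_form := fun β m hm n => by
    rw [end_sub_apply, end_sub_apply, end_sub_apply, h.map_form β m hm, h'.map_form β m hm,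
      map_sub, map_sub, AddMonoidHom.sub_apply, smul_sub]
    abel

/-- The bracket with a given element of `eosp q` depends only on finitely many values. -/
theorem exists_finset_sbr_eq {x : AddMonoid.End M} (hx : x ∈ eosp q) : ∃ F : Finset M,
    ∀ S T, IsLift q δ S 0 → IsLift q δ T 0 → (∀ m ∈ F, S m = T m) → sbr ℳ S x = sbr ℳ T x := by
  classical
  refine eosp_induction q (p := fun x => ∃ F : Finset M,
    ∀ S T, IsLift q δ S 0 → IsLift q δ T 0 → (∀ m ∈ F, S m = T m) → sbr ℳ S x = sbr ℳ T x)
    ⟨∅, fun S T _ _ _ => by rw [map_zero, map_zero]⟩ ?_ ?_ ?_ hx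
  · rintro x y ⟨F, hF⟩ ⟨G, hG⟩
    refine ⟨F ∪ G, fun S T hS hT h => ?_⟩
    rw [map_add, map_add, hF S T hS hT (fun m hm => h m (Finset.mem_union_left _ hm)),
      hG S T hS hT (fun m hm => h m (Finset.mem_union_right _ hm))]
  · rintro x ⟨F, hF⟩
    refine ⟨F, fun S T hS hT h => ?_⟩
    rw [map_neg, map_neg, hF S T hS hT h]
  · intro α β m hm n hn
    refine ⟨{m, n}, fun S T hS hT h => ?_⟩
    rw [hS.sbr_opE hm hn, hT.sbr_opE hm hn, h m (by simp), h n (by simp)]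

variable (f : K →+* A)

/-- If `S` agrees with elements of `eosp q` on finite sets, then `d_{S,0}` is locally inner. -/
theorem mem_adLoc_of_agree (he : IsHypPair q e e') {S : AddMonoid.End M} (hS : IsLift q δ S 0)
    (hF : ∀ F : Finset M, ∃ x ∈ eosp q, x ∈ endGrading ℳ δ ∧ ∀ m ∈ F, x m = S m)
    {d : AddMonoid.End (eosp (qInf q))} (hd : IsOuter q S d) : d ∈ adLocEosp f (qInf q) := by
  classical
  have hd1 := (isOuter_iff he hS.normalizes).mp hd
  constructor
  · rw [hd1]
    exact mem_sup_of_mem_piece (D := derPiece (eospGrading (qInf q)) _ _)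
      (outerMap_mem_derPiece f he hS fun c m => hS.linear (f c) m)
  · intro F
    -- the values of `S` on these vectors determine the values of the derivation on `F`
    have h1 : ∀ y : eosp (qInf q), ∃ G : Finset M, ∀ x (hx : x ∈ eosp q), x ∈ endGrading ℳ δ →
        (∀ m ∈ G, x m = S m) →
          d y = eospBr (qInf q) (ofCoord q (0, 0, 0, ⟨x, hx⟩)) y := by
      intro y
      obtain ⟨a, m, n, y, rfl⟩ := exists_ofCoord q y
      obtain ⟨G, hG⟩ := exists_finset_sbr_eq (δ := δ) y.2
      refine ⟨G ∪ {m, n}, fun x hx hxδ h => ?_⟩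
      have hx1 := isLift_of_mem_eosp hx hxδ
      have k := (isOuter_iff he hx1.normalizes).mp (isOuter_adE_coe he ⟨x, hx⟩)
      rw [← adE_apply, k, hd1, outerMap_ofCoord, outerMap_ofCoord, ofCoord_eq_iff]
      refine ⟨rfl, (h m (by simp)).symm, (h n (by simp)).symm, Subtype.ext ?_⟩
      exact (hG x S hx1 hS fun m hm => h m (Finset.mem_union_left _ hm)).symm
    choose G hG using h1
    obtain ⟨x, hx, hxδ, hxF⟩ := hF (F.biUnion G)
    exact ⟨_, fun y hy => hG y x hx hxδ fun m hm =>
      hxF m (Finset.mem_biUnion.mpr ⟨y, hy, hm⟩)⟩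

/-- If `d_{S,0}` is locally inner, then `S` agrees with elements of `eosp q` on finite sets. -/
theorem exists_agree_of_mem_adLoc (h2 : IsUnit (2 : A)) (he : IsHypPair q e e')
    {S : AddMonoid.End M} (hS : S ∈ sE f q (eosp q)) {d : AddMonoid.End (eosp (qInf q))}
    (hd : IsOuter q S d) (hloc : d ∈ adLocEosp f (qInf q)) (F : Finset M) :
    ∃ x ∈ eosp q, ∀ m ∈ F, S m = x m := by
  classical
  have key : ∀ α, ∃ x ∈ eosp q, ∀ m ∈ F, endPart ℳ α S m = x m := by
    intro α
    obtain ⟨-, D, hD⟩ := (mem_sPiece_iff f he).mp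
      ((mem_sup_pieces ℳ (D := sPiece f q (eosp q)) (fun _ _ h => And.left h)).mp hS α)
    have k0 := (isOuter_iff he hD.normalizes).mp (hd.endPart_of_mem_sE f he hS α)
    have hD1 : D 1 = 0 := by
      have hD2 := hD.coeff_mul he SetLike.GradedOne.one_mem 1
      simpa using hD2
    obtain ⟨z, hz, hzF⟩ := exists_hom_of_mem_adLoc (β := α) f (qInf q) hloc
      ({gradingElement q} ∪ (F.biUnion fun m => Finset.univ.image fun γ =>
        ofCoord q (0, part ℳ γ m, part ℳ γ m, 0)))
    obtain ⟨a, ha, m, hm, n, hn, x, hx, rfl⟩ := exists_hom_ofCoord q hz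
    have k1 := hzF (gradingElement q) (by simp)
    rw [k0, gradingElement, eospBr_ofCoord q ha hm hn hx SetLike.GradedOne.one_mem
      (zero_mem (ℳ 0)) (zero_mem (ℳ 0)) (zero_mem (eospGrading q 0)), outerMap_ofCoord,
      ofCoord_eq_iff] at k1
    have hm0 : m = 0 := by simpa using k1.2.1
    have hn0 : n = 0 := by simpa using k1.2.2.1.symm
    subst hm0 hn0
    refine ⟨x, x.2, fun p hp => ?_⟩
    have k2 : ∀ γ, endPart ℳ α S (part ℳ γ p) = (x : AddMonoid.End M) (part ℳ γ p) := by
      intro γ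
      have k3 := hzF (ofCoord q (0, part ℳ γ p, part ℳ γ p, 0)) (by
        refine Finset.mem_union_right _ (Finset.mem_biUnion.mpr ⟨p, hp, ?_⟩)
        exact Finset.mem_image_of_mem _ (Finset.mem_univ γ))
      rw [k0, eospBr_ofCoord_zero ha hx (zero_mem (𝒜 γ)) (part_mem ℳ γ p) (part_mem ℳ γ p)
        (zero_mem (eospGrading q γ)), outerMap_ofCoord, ofCoord_eq_iff] at k3
      have k4 := k3.2.1.symm.trans k3.2.2.1
      have k5 : a • part ℳ γ p = 0 := eq_zero_of_eq_neg h2 (add_right_cancel k4)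
      rw [k3.2.1, k5, zero_add]
    rw [← part_add ℳ p, map_add, map_add, k2, k2]
  obtain ⟨x, hx, hxF⟩ := key 0
  obtain ⟨y, hy, hyF⟩ := key 1
  refine ⟨x + y, add_mem hx hy, fun m hm => ?_⟩
  rw [end_add_apply, ← hxF m hm, ← hyF m hm, ← end_add_apply, endPart_add]

variable {B : Module.Basis τ A M} {X : Set τ} {bar : τ → τ} {deg : τ → ZMod 2} {u v : τ → A}

theorem IsAdapted.exists_agree (h2 : IsUnit (2 : A)) (h : IsAdapted q B X bar deg u v)
    {S : AddMonoid.End M} (hS : IsLift q δ S 0) (hX : ∀ s ∉ X, S (B s) = 0) (F : Finset M) :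
    ∃ x ∈ eosp q, x ∈ endGrading ℳ δ ∧ ∀ m ∈ F, x m = S m := by
  classical
  obtain ⟨x, hx, hxδ, h1, h3⟩ := h.exists_mem_eosp h2 hS hX
    ((F.biUnion fun m => (B.repr m).support).filter fun s => s ∈ X)
    (fun s hs => (Finset.mem_filter.mp hs).2)
  refine ⟨x, hx, hxδ, fun m hm => eq_of_linear_of_support 𝒜 h.basis_mem (eosp_linear q hx)
    hS.linear fun s hs => ?_⟩
  by_cases hsX : s ∈ X
  · exact h3 s (Finset.mem_filter.mpr ⟨Finset.mem_biUnion.mpr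
      ⟨m, hm, Finsupp.mem_support_iff.mpr hs⟩, hsX⟩)
  · exact h1 s hsX

theorem IsAdapted.mem_eosp_of_finite [Finite τ] (h2 : IsUnit (2 : A))
    (h : IsAdapted q B X bar deg u v) {S : AddMonoid.End M} (hS : IsLift q δ S 0)
    (hX : ∀ s ∉ X, S (B s) = 0) : S ∈ eosp q := by
  classical
  have := Fintype.ofFinite τ
  obtain ⟨x, hx, -, h1⟩ := h.exists_agree h2 hS hX (Finset.univ.image B)
  have k : S = x := end_ext fun m => eq_of_linear_of_support 𝒜 h.basis_mem hS.linear
    (eosp_linear q hx) fun s _ => (h1 _ (Finset.mem_image_of_mem _ (Finset.mem_univ s))).symm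
  rwa [k]

end LocallyInner

/-! ### Extending derivations of the coordinate algebra -/

section Extension

variable {K A M τ : Type*} [Ring K] [Ring A] [AddCommGroup M] [Module A M] [Module Aᵐᵒᵖ M]
  {𝒜 : ZMod 2 → AddSubgroup A} {ℳ : ZMod 2 → AddSubgroup M} [GradedRing 𝒜]
  [IsSupercommutative 𝒜] [DirectSum.Decomposition ℳ] [SMulCommClass A Aᵐᵒᵖ M]
  [IsSupermodule 𝒜 ℳ] {q : QuadForm 𝒜 ℳ} {B : Module.Basis τ A M} {X : Set τ} {bar : τ → τ}
  {deg : τ → ZMod 2} {u v : τ → A} {f : K →+* A}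

theorem inverse_two_mem (h2 : IsUnit (2 : A)) : Ring.inverse (2 : A) ∈ 𝒜 0 := by
  obtain ⟨r, hr, hrr⟩ := exists_half 𝒜 h2
  have k : Ring.inverse (2 : A) = r := by
    rw [← mul_one (Ring.inverse (2 : A)), ← hrr, ← two_mul, ← mul_assoc,
      Ring.inverse_mul_cancel _ h2, one_mul]
  rwa [k]

/-- The coefficient `1/2 Δ(u s) (u s)⁻¹`. -/
def liftCoeff (u v : τ → A) (Δ : AddMonoid.End A) (s : τ) : A :=
  Ring.inverse 2 * Δ (u s) * v s

/-- The derivations of `A` of degree `δ` that are linear over `K`. -/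
abbrev ringDerPiece (𝒜 : ZMod 2 → AddSubgroup A) (f : K →+* A) (δ : ZMod 2) :
    AddSubgroup (AddMonoid.End A) := derPiece 𝒜 (fun c => mulR A (f c)) AddMonoidHom.mul δ

theorem ringDer_mul {δ : ZMod 2} {Δ : AddMonoid.End A} (hΔ : Δ ∈ ringDerPiece 𝒜 f δ) {α : ZMod 2}
    {a : A} (ha : a ∈ 𝒜 α) (b : A) : Δ (a * b) = Δ a * b + sgn (δ * α) • (a * Δ b) :=
  hΔ.2.2 α a ha b

theorem ringDer_one {δ : ZMod 2} {Δ : AddMonoid.End A} (hΔ : Δ ∈ ringDerPiece 𝒜 f δ) :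
    Δ 1 = 0 := by
  have k := ringDer_mul hΔ SetLike.GradedOne.one_mem 1
  simpa using k

theorem ringDer_map {δ : ZMod 2} {Δ : AddMonoid.End A} (hΔ : Δ ∈ ringDerPiece 𝒜 f δ) (c : K) :
    Δ (f c) = 0 := by
  have k := hΔ.2.1 c 1
  rw [ringDer_one hΔ, map_zero] at k
  have k1 : mulR A (f c) 1 = f c := one_mul _
  rwa [k1] at k

theorem liftCoeff_add_self (h2 : IsUnit (2 : A)) (h : IsAdapted q B X bar deg u v)
    (Δ : AddMonoid.End A) (s : τ) :
    (liftCoeff u v Δ s + liftCoeff u v Δ s) * u s = Δ (u s) := by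
  rw [liftCoeff, ← two_mul, ← mul_assoc, ← mul_assoc, Ring.mul_inverse_cancel _ h2, one_mul,
    mul_assoc, ← mul_comm_of_even (h.unit_mem s), h.unit_mul_inv, mul_one]

theorem liftCoeff_unique (h2 : IsUnit (2 : A)) (h : IsAdapted q B X bar deg u v)
    {Δ : AddMonoid.End A} {s : τ} {l : A} (hl : (l + l) * u s = Δ (u s)) :
    l = liftCoeff u v Δ s := by
  rw [liftCoeff, ← hl, mul_assoc, mul_assoc, h.unit_mul_inv, mul_one, ← two_mul, ← mul_assoc,
    Ring.inverse_mul_cancel _ h2, one_mul]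

theorem liftCoeff_mem (h2 : IsUnit (2 : A)) (h : IsAdapted q B X bar deg u v) {δ : ZMod 2}
    {Δ : AddMonoid.End A} (hΔ : Δ ∈ endGrading 𝒜 δ) (s : τ) : liftCoeff u v Δ s ∈ 𝒜 δ := by
  have k := SetLike.GradedMul.mul_mem (SetLike.GradedMul.mul_mem (inverse_two_mem (𝒜 := 𝒜) h2)
    (hΔ 0 _ (h.unit_mem s))) (h.inv_mem s)
  rwa [zero_add, zero_add, add_zero] at k

theorem liftCoeff_bar (h : IsAdapted q B X bar deg u v) (Δ : AddMonoid.End A) {s : τ}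
    (hs : s ∈ X) : liftCoeff u v Δ (bar s) = liftCoeff u v Δ s := by
  rw [liftCoeff, liftCoeff, h.unit_bar s hs, h.inv_bar hs, map_zsmul, mul_smul_comm, mul_smul_comm,
    smul_mul_assoc, sgn_smul_sgn_smul]

/-- `Φ` sends each derivation `Δ` of `A` to the endomorphism
`a B s ↦ (1/2 Δ(u s) (u s)⁻¹ a + Δ(a)) B s`. -/
def IsExtension (𝒜 : ZMod 2 → AddSubgroup A) (f : K →+* A) (B : Module.Basis τ A M) (u v : τ → A)
    (Φ : AddMonoid.End A →+ AddMonoid.End M) : Prop :=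
  ∀ Δ ∈ derRing 𝒜 f, ∀ a s, Φ Δ (a • B s) = (liftCoeff u v Δ s * a + Δ a) • B s

variable {Φ : AddMonoid.End A →+ AddMonoid.End M} (h2 : IsUnit (2 : A))
  (h : IsAdapted q B X bar deg u v) (hΦ : IsExtension 𝒜 f B u v Φ)

theorem mem_derRing_of_piece {δ : ZMod 2} {Δ : AddMonoid.End A} (hΔ : Δ ∈ ringDerPiece 𝒜 f δ) :
    Δ ∈ derRing 𝒜 f :=
  mem_sup_of_mem_piece (D := ringDerPiece 𝒜 f) hΔ

include h2 h hΦ in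
/-- The form condition reads `Δ(u s) = 2 c (u s)` on `B s` and its partner, with `c` the coefficient
of both. -/
theorem isLift_extension {δ : ZMod 2} {Δ : AddMonoid.End A} (hΔ : Δ ∈ ringDerPiece 𝒜 f δ) :
    IsLift q δ (Φ Δ) Δ := by
  have hΔ' := mem_derRing_of_piece hΔ
  have hl := liftCoeff_mem h2 h hΔ.1
  have hmem : Φ Δ ∈ endGrading ℳ δ := by
    refine mem_endGrading_of_basis (𝒜 := 𝒜) h.basis_mem fun α a ha s => ?_
    rw [hΦ Δ hΔ', add_right_comm]
    refine IsSupermodule.smul_mem (𝒜 := 𝒜) (add_mem ?_ (hΔ.1 α a ha)) (h.basis_mem s)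
    rw [add_comm α]
    exact SetLike.GradedMul.mul_mem (hl s) ha
  refine ⟨hmem, hΔ.1, fun α a ha m => ?_, fun β m hm n => ?_⟩
  · refine basis_induction 𝒜 B (p := fun m => Φ Δ (a • m) =
      Δ a • m + sgn (δ * α) • (a • Φ Δ m)) ?_ ?_ ?_ m
    · simp
    · intro m n hm hn
      rw [smul_add, map_add, hm, hn, map_add, smul_add, smul_add, smul_add]
      abel
    · intro γ c _ s
      rw [smul_smul, hΦ Δ hΔ', hΦ Δ hΔ', smul_smul, smul_smul, ← smul_assoc, ← add_smul,
        ringDer_mul hΔ ha, ← mul_assoc, IsSupercommutative.mul_comm (hl s) ha, mul_add, smul_add,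
        smul_mul_assoc, mul_assoc]
      congr 1
      abel
  · refine hom_basis_induction (𝒜 := 𝒜) h.basis_mem (p := fun m => Δ (q.form m n) =
      q.form (Φ Δ m) n + sgn (δ * β) • q.form m (Φ Δ n)) ?_ ?_ ?_ hm
    · simp
    · intro m p hm hp
      rw [map_add, AddMonoidHom.add_apply, map_add, hm, hp, map_add, map_add,
        AddMonoidHom.add_apply, AddMonoidHom.add_apply, smul_add]
      abel
    · rintro α a ha s rfl
      refine basis_induction 𝒜 B (p := fun n => Δ (q.form (a • B s) n) =
        q.form (Φ Δ (a • B s)) n + sgn (δ * (α + deg s)) • q.form (a • B s) (Φ Δ n)) ?_ ?_ ?_ n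
      · simp
      · intro n p hn hp
        rw [map_add, map_add, hn, hp, map_add, map_add, map_add, smul_add]
        abel
      · intro γ c hc t
        have hc1 : ∀ {ε : ZMod 2} {b : A}, b ∈ 𝒜 ε → q.form (B s) (b • B t) =
            sgn (ε * deg t) • (q.form (B s) (B t) * b) := by
          intro ε b hb
          rw [IsSupermodule.smul_eq hb (h.basis_mem t), map_zsmul, q.linear]
        have hlt : liftCoeff u v Δ t * c + Δ c ∈ 𝒜 (δ + γ) := by
          refine add_mem (SetLike.GradedMul.mul_mem (hl t) hc) ?_
          rw [add_comm]
          exact hΔ.1 γ c hc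
        rw [hΦ Δ hΔ', hΦ Δ hΔ', form_smul_left, form_smul_left, form_smul_left, hc1 hc, hc1 hlt]
        by_cases hs : s ∈ X
        · by_cases ht : t = bar s
          · subst ht
            have k1 := liftCoeff_add_self h2 h Δ s
            have k2 := IsSupercommutative.mul_comm (hl s) ha
            have k3 : Δ (u s * c) = (liftCoeff u v Δ s + liftCoeff u v Δ s) * u s * c +
                u s * Δ c := by
              rw [ringDer_mul hΔ (h.unit_mem s), mul_zero, sgn_zero, one_smul, k1]
            rw [h.form_bar s hs, liftCoeff_bar h Δ hs, h.deg_bar s hs, mul_smul_comm, map_zsmul,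
              ringDer_mul hΔ ha, k3, add_mul (liftCoeff u v Δ s * a), k2, mul_smul_comm,
              mul_smul_comm, mul_add (u s), ← mul_assoc (u s) (liftCoeff u v Δ s),
              mul_comm_of_even (h.unit_mem s) (liftCoeff u v Δ s)]
            rcases parity_cases δ with rfl | rfl <;> rcases parity_cases α with rfl | rfl <;>
              rcases parity_cases (deg s) with k | k <;> rcases parity_cases γ with rfl | rfl <;>
              rw [k] <;> simp <;> noncomm_ring
          · rw [h.form_ne s hs t ht]
            simp
        · rw [h.form_radical s hs]
          simp

include h2 h hΦ in
theorem extension_linear {δ : ZMod 2} {Δ : AddMonoid.End A} (hΔ : Δ ∈ ringDerPiece 𝒜 f δ) (c : K)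
    (m : M) : Φ Δ (op (f c) • m) = op (f c) • Φ Δ m := by
  refine hom_induction ℳ (p := fun m => Φ Δ (op (f c) • m) = op (f c) • Φ Δ m) ?_ ?_ m
  · intro β m hm
    rw [(isLift_extension h2 h hΦ hΔ).map_op_smul _ hm, ringDer_map hΔ, op_zero, zero_smul,
      smul_zero, add_zero]
  · intro m n hm hn
    rw [smul_add, map_add, map_add, smul_add, hm, hn]

end Extension

/-! ### The complement spanned by `End R` and the extended derivations -/

section Complement

variable {K A M τ : Type*} [Ring K] [Ring A] [AddCommGroup M] [Module A M] [Module Aᵐᵒᵖ M]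
  {𝒜 : ZMod 2 → AddSubgroup A} {ℳ : ZMod 2 → AddSubgroup M} [GradedRing 𝒜]
  [IsSupercommutative 𝒜] [DirectSum.Decomposition ℳ] [SMulCommClass A Aᵐᵒᵖ M]
  [IsSupermodule 𝒜 ℳ] {q : QuadForm 𝒜 ℳ} {B : Module.Basis τ A M} {X : Set τ} {bar : τ → τ}
  {deg : τ → ZMod 2} {u v : τ → A} {f : K →+* A}

/-- The linear endomorphisms of the radical, extended by zero: the linear endomorphisms of `M` that
kill the basis vectors `B s` with `s ∈ X` and have values in the radical. -/
def radEnd (q : QuadForm 𝒜 ℳ) (B : Module.Basis τ A M) (X : Set τ) :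
    AddSubgroup (AddMonoid.End M) where
  carrier := {S | (∀ (a : A) m, S (op a • m) = op a • S m) ∧ (∀ s ∈ X, S (B s) = 0) ∧
    ∀ m n, q.form (S m) n = 0}
  zero_mem' := ⟨fun a m => by simp, fun s _ => rfl, fun m n => by simp⟩
  add_mem' := by
    rintro S T ⟨hS, hS1, hS2⟩ ⟨hT, hT1, hT2⟩
    refine ⟨fun a m => ?_, fun s hs => ?_, fun m n => ?_⟩
    · rw [end_add_apply, end_add_apply, hS, hT, smul_add]
    · rw [end_add_apply, hS1 s hs, hT1 s hs, add_zero]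
    · rw [end_add_apply, map_add, AddMonoidHom.add_apply, hS2, hT2, add_zero]
  neg_mem' := by
    rintro S ⟨hS, hS1, hS2⟩
    refine ⟨fun a m => ?_, fun s hs => ?_, fun m n => ?_⟩
    · rw [end_neg_apply, end_neg_apply, hS, smul_neg]
    · rw [end_neg_apply, hS1 s hs, neg_zero]
    · rw [end_neg_apply, map_neg, AddMonoidHom.neg_apply, hS2, neg_zero]

theorem isLift_of_mem_radEnd {T : AddMonoid.End M} (hT : T ∈ radEnd q B X) {δ : ZMod 2}
    (hδ : T ∈ endGrading ℳ δ) : IsLift q δ T 0 where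
  mem := hδ
  coeff_mem := zero_mem _
  map_smul := fun α a ha m => by
    rw [map_smul_of_linear hδ hT.1 ha, AddMonoid.End.zero_apply, zero_smul, zero_add]
  map_form := fun β m _ n => by
    rw [hT.2.2, form_comm_eq_zero (hT.2.2 n), AddMonoid.End.zero_apply, smul_zero, add_zero]

theorem mulL_mul_mem_radEnd {T : AddMonoid.End M} (hT : T ∈ radEnd q B X) (c : A) :
    mulL M c * T ∈ radEnd q B X := by
  refine ⟨fun a m => ?_, fun s hs => ?_, fun m n => ?_⟩
  · rw [end_mul_apply, end_mul_apply, hT.1, mulL_apply, mulL_apply, smul_comm]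
  · rw [end_mul_apply, hT.2.1 s hs, map_zero]
  · rw [end_mul_apply, mulL_apply, form_smul_left, hT.2.2, mul_zero]

/-- The bracket of a map over a derivation `D` with a linear map is linear, as the terms with `D`
cancel. -/
theorem sbr_mem_of_linear_right {S T : AddMonoid.End M} {δ ε : ZMod 2} {D : AddMonoid.End A}
    (hS : IsLift q δ S D) (hT : T ∈ endGrading ℳ ε)
    (hT1 : ∀ (a : A) m, T (op a • m) = op a • T m) (a : A) (m : M) :
    sbr ℳ S T (op a • m) = op a • sbr ℳ S T m := by
  refine hom_induction ℳ (p := fun m => sbr ℳ S T (op a • m) = op a • sbr ℳ S T m) ?_ ?_ m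
  · intro β m hm
    rw [sbr_apply_hom ℳ hS.mem hT, sbr_apply_hom ℳ hS.mem hT, hT1, hS.map_op_smul a hm,
      hS.map_op_smul a (hT β m hm), map_add, map_zsmul, hT1, hT1, smul_sub, smul_add,
      op_smul_zsmul, smul_smul]
    rcases parity_cases δ with rfl | rfl <;> rcases parity_cases ε with rfl | rfl <;>
      rcases parity_cases β with rfl | rfl <;> simp
  · intro m n hm hn
    rw [smul_add, map_add, map_add, smul_add, hm, hn]

section

variable (h : IsAdapted q B X bar deg u v)

include h

theorem endPart_mem_radEnd (α : ZMod 2) {T : AddMonoid.End M} (hT : T ∈ radEnd q B X) :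
    endPart ℳ α T ∈ radEnd q B X := by
  refine ⟨endPart_linear (𝒜 := 𝒜) hT.1 α, fun s hs => ?_, fun m n => ?_⟩
  · rw [endPart_apply_hom ℳ (h.basis_mem s), hT.2.1 s hs, map_zero]
  · refine hom_induction ℳ (p := fun m => q.form (endPart ℳ α T m) n = 0) ?_ ?_ m
    · intro γ m hm
      rw [endPart_apply_hom ℳ hm, form_part_eq_zero (hT.2.2 m)]
    · intro m r hm hr
      rw [map_add, map_add, AddMonoidHom.add_apply, hm, hr, add_zero]

theorem sbr_mem_radEnd : ∀ S ∈ radEnd q B X, ∀ T ∈ radEnd q B X, sbr ℳ S T ∈ radEnd q B X := by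
  refine sbr_mem_of_hom ℳ (fun α _ => endPart_mem_radEnd h α) (fun α _ => endPart_mem_radEnd h α) ?_
  intro α β S hS hSα T hT hTβ
  refine ⟨sbr_mem_of_linear_right (isLift_of_mem_radEnd hS hSα) hTβ hT.1, fun s hs => ?_,
    fun m n => ?_⟩
  · rw [sbr_apply_hom ℳ hSα hTβ, hS.2.1 s hs, hT.2.1 s hs, map_zero, map_zero, smul_zero, sub_zero]
  · rw [sbr_apply_hom ℳ hSα hTβ, map_sub, map_zsmul, AddMonoidHom.sub_apply,
      AddMonoidHom.smul_apply, hS.2.2, hT.2.2, smul_zero, sub_zero]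

end

variable {Φ : AddMonoid.End A →+ AddMonoid.End M} (h2 : IsUnit (2 : A))
  (h : IsAdapted q B X bar deg u v) (hΦ : IsExtension 𝒜 f B u v Φ)

theorem mulL_mul_mem_ringDerPiece {γ δ : ZMod 2} {c : A} (hc : c ∈ 𝒜 γ) {Δ : AddMonoid.End A}
    (hΔ : Δ ∈ ringDerPiece 𝒜 f δ) : mulL A c * Δ ∈ ringDerPiece 𝒜 f (γ + δ) := by
  refine ⟨fun α a ha => ?_, fun b a => ?_, fun α a ha b => ?_⟩
  · have k := SetLike.GradedMul.mul_mem hc (hΔ.1 α a ha)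
    have e : γ + (α + δ) = α + (γ + δ) := by ring
    rwa [e] at k
  · rw [end_mul_apply, hΔ.2.1, end_mul_apply]
    exact (mul_assoc c (Δ a) (f b)).symm
  · have k1 : c * a = sgn (γ * α) • (a * c) := IsSupercommutative.mul_comm hc ha
    change c * Δ (a * b) = c * Δ a * b + sgn ((γ + δ) * α) • (a * (c * Δ b))
    rw [ringDer_mul hΔ ha, mul_add, mul_smul_comm, ← mul_assoc c a, k1, smul_mul_assoc, smul_smul,
      ← sgn_add, ← mul_assoc, ← mul_assoc, add_mul, add_comm (δ * α)]

theorem mulL_mul_mem_derRing (c : A) {Δ : AddMonoid.End A} (hΔ : Δ ∈ derRing 𝒜 f) :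
    mulL A c * Δ ∈ derRing 𝒜 f := by
  have key : ∀ δ, ∀ Δ ∈ ringDerPiece 𝒜 f δ, mulL A c * Δ ∈ derRing 𝒜 f := by
    intro δ Δ hΔ
    refine hom_induction 𝒜 (p := fun c => mulL A c * Δ ∈ derRing 𝒜 f) ?_ ?_ c
    · intro γ c hc
      exact mem_derRing_of_piece (mulL_mul_mem_ringDerPiece hc hΔ)
    · intro b c hb hc
      rw [mulL_add, add_mul]
      exact add_mem hb hc
  have k := (mem_der_iff _ _ _).mp hΔ
  rw [← endPart_add 𝒜 Δ, mul_add]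
  exact add_mem (key 0 _ (k 0)) (key 1 _ (k 1))

include h2 h hΦ in
theorem extension_mem_sE {Δ : AddMonoid.End A} (hΔ : Δ ∈ derRing 𝒜 f) {e e' : M}
    (he : IsHypPair q e e') : Φ Δ ∈ sE f q (eosp q) := by
  have k := (mem_der_iff _ _ _).mp hΔ
  have key : ∀ δ, Φ (endPart 𝒜 δ Δ) ∈ sE f q (eosp q) := fun δ =>
    mem_sup_of_mem_piece (D := sPiece f q (eosp q)) ((mem_sPiece_iff f he).mpr
      ⟨extension_linear h2 h hΦ (k δ), _, isLift_extension h2 h hΦ (k δ)⟩)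
  rw [← endPart_add 𝒜 Δ, map_add]
  exact add_mem (key 0) (key 1)

include h2 h hΦ in
theorem endPart_extension {Δ : AddMonoid.End A} (hΔ : Δ ∈ derRing 𝒜 f) (α : ZMod 2) :
    endPart ℳ α (Φ Δ) = Φ (endPart 𝒜 α Δ) := by
  have k := (mem_der_iff _ _ _).mp hΔ
  have k0 := (isLift_extension h2 h hΦ (k 0)).mem
  have k1 := (isLift_extension h2 h hΦ (k 1)).mem
  have e : (0 : ZMod 2) ≠ 1 := by decide
  nth_rewrite 1 [← endPart_add 𝒜 Δ]
  rw [map_add, map_add]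
  rcases parity_cases α with rfl | rfl
  · rw [endPart_same ℳ k0, endPart_ne ℳ k1 e.symm, add_zero]
  · rw [endPart_same ℳ k1, endPart_ne ℳ k0 e, zero_add]

include h2 hΦ in
theorem mulL_mul_extension {Δ : AddMonoid.End A} (hΔ : Δ ∈ derRing 𝒜 f) (c : A) :
    mulL M c * Φ Δ = Φ (mulL A c * Δ) := by
  refine end_ext_basis 𝒜 B fun α a _ s => ?_
  rw [end_mul_apply, hΦ Δ hΔ, hΦ _ (mulL_mul_mem_derRing c hΔ), mulL_apply, smul_smul]
  congr 1
  have k : liftCoeff u v (mulL A c * Δ) s = c * liftCoeff u v Δ s := by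
    change Ring.inverse 2 * (c * Δ (u s)) * v s = c * (Ring.inverse 2 * Δ (u s) * v s)
    rw [← mul_assoc (Ring.inverse 2) c, mul_comm_of_even (inverse_two_mem (𝒜 := 𝒜) h2) c]
    simp only [mul_assoc]
  rw [k, mul_add, mul_assoc]
  rfl

include h2 h hΦ in
/-- The coefficients of `[Δ, Γ]` are obtained from those of `Δ` and `Γ`, as they are half the
logarithmic derivatives of the even units `u s`. -/
theorem sbr_extension {δ γ : ZMod 2} {Δ Γ : AddMonoid.End A} (hΔ : Δ ∈ ringDerPiece 𝒜 f δ)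
    (hΓ : Γ ∈ ringDerPiece 𝒜 f γ) : sbr ℳ (Φ Δ) (Φ Γ) = Φ (sbr 𝒜 Δ Γ) := by
  have hΔ' := mem_derRing_of_piece hΔ
  have hΓ' := mem_derRing_of_piece hΓ
  refine end_ext_basis 𝒜 B fun α a ha s => ?_
  have hl := liftCoeff_mem h2 h hΔ.1 s
  have hk := liftCoeff_mem h2 h hΓ.1 s
  have hlk := IsSupercommutative.mul_comm hl hk
  have c : liftCoeff u v (sbr 𝒜 Δ Γ) s =
      Δ (liftCoeff u v Γ s) - sgn (δ * γ) • Γ (liftCoeff u v Δ s) := by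
    symm
    refine liftCoeff_unique h2 h ?_
    have k1 := liftCoeff_add_self h2 h Δ s
    have k2 := liftCoeff_add_self h2 h Γ s
    rw [sbr_apply_hom 𝒜 hΔ.1 hΓ.1, ← k1, ← k2, ringDer_mul hΔ (add_mem hk hk),
      ringDer_mul hΓ (add_mem hl hl), ← k1, ← k2, map_add, map_add, ← mul_assoc, ← mul_assoc]
    simp only [mul_add, add_mul, hlk, mul_comm γ δ]
    rcases parity_cases (δ * γ) with k | k <;> rw [k] <;> simp <;> noncomm_ring
  rw [sbr_apply_hom ℳ (isLift_extension h2 h hΦ hΔ).mem (isLift_extension h2 h hΦ hΓ).mem,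
    hΦ _ hΔ', hΦ _ hΓ', hΦ _ hΔ', hΦ _ hΓ', hΦ _ (sbr_mem_der _ _ _ hΔ' hΓ'), c,
    sbr_apply_hom 𝒜 hΔ.1 hΓ.1, ← smul_assoc, ← sub_smul, map_add, map_add, ringDer_mul hΔ hk,
    ringDer_mul hΓ hl]
  congr 1
  simp only [mul_add, ← mul_assoc, hlk, mul_comm γ δ]
  rcases parity_cases (δ * γ) with k | k <;> rw [k] <;> simp <;> noncomm_ring

include h2 h hΦ in
/-- Brackets of extended derivations with endomorphisms of the radical. -/
theorem sbr_extension_mem_radEnd : ∀ S ∈ (derRing 𝒜 f).map Φ, ∀ T ∈ radEnd q B X,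
    sbr ℳ S T ∈ radEnd q B X := by
  refine sbr_mem_of_hom ℳ ?_ (fun α _ => endPart_mem_radEnd h α) ?_
  · rintro α _ ⟨Δ, hΔ, rfl⟩
    exact ⟨_, endPart_mem_der _ _ _ α hΔ, (endPart_extension h2 h hΦ hΔ α).symm⟩
  · rintro α β _ ⟨Δ, hΔ, rfl⟩ hα T hT hβ
    have k := endPart_extension h2 h hΦ hΔ α
    rw [endPart_same ℳ hα] at k
    have hL := isLift_extension h2 h hΦ ((mem_der_iff _ _ _).mp hΔ α)
    rw [← k] at hL
    refine ⟨sbr_mem_of_linear_right hL hβ hT.1, fun s hs => ?_, fun m n => ?_⟩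
    · have k1 := hΦ Δ hΔ 1 s
      rw [one_smul] at k1
      have k2 : ∀ c : A, T (c • B s) = 0 := by
        intro c
        refine hom_induction 𝒜 (p := fun c => T (c • B s) = 0) ?_ ?_ c
        · intro γ c hc
          rw [map_smul_of_linear hβ hT.1 hc, hT.2.1 s hs, smul_zero, smul_zero]
        · intro b c hb hc
          rw [add_smul, map_add, hb, hc, add_zero]
      rw [sbr_apply_hom ℳ hα hβ, hT.2.1 s hs, k1, k2, map_zero, smul_zero, sub_zero]
    · rw [sbr_apply_hom ℳ hα hβ, map_sub, map_zsmul, AddMonoidHom.sub_apply,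
        AddMonoidHom.smul_apply, hT.2.2, smul_zero, sub_zero]
      refine hom_induction ℳ (p := fun m => q.form (Φ Δ (T m)) n = 0) ?_ ?_ m
      · intro γ m hm
        have k3 := hL.map_form _ _ (hβ γ m hm) n
        rw [hT.2.2, hT.2.2, map_zero, smul_zero, add_zero] at k3
        exact k3.symm
      · intro m r hm hr
        rw [map_add, map_add, map_add, AddMonoidHom.add_apply, hm, hr, add_zero]

include h2 h hΦ in
theorem isSubalgebra_complement :
    IsSubalgebra ℳ (fun c => mulL M (f c)) (radEnd q B X ⊔ (derRing 𝒜 f).map Φ) where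
  part_mem := by
    intro α S hS
    obtain ⟨T, hT, _, ⟨Δ, hΔ, rfl⟩, rfl⟩ := AddSubgroup.mem_sup.mp hS
    rw [map_add, endPart_extension h2 h hΦ hΔ]
    exact AddSubgroup.add_mem_sup (endPart_mem_radEnd h α hT) ⟨_, endPart_mem_der _ _ _ α hΔ, rfl⟩
  smul_mem := by
    intro c S hS
    obtain ⟨T, hT, _, ⟨Δ, hΔ, rfl⟩, rfl⟩ := AddSubgroup.mem_sup.mp hS
    rw [mul_add, mulL_mul_extension h2 hΦ hΔ]
    exact AddSubgroup.add_mem_sup (mulL_mul_mem_radEnd hT _) ⟨_, mulL_mul_mem_derRing _ hΔ, rfl⟩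
  bracket_mem := by
    have hpart : ∀ α, ∀ S ∈ (derRing 𝒜 f).map Φ, endPart ℳ α S ∈ (derRing 𝒜 f).map Φ := by
      rintro α _ ⟨Δ, hΔ, rfl⟩
      exact ⟨_, endPart_mem_der _ _ _ α hΔ, (endPart_extension h2 h hΦ hΔ α).symm⟩
    have hrad : ∀ α, ∀ S ∈ radEnd q B X, endPart ℳ α S ∈ radEnd q B X :=
      fun α _ => endPart_mem_radEnd h α
    have h1 := sbr_extension_mem_radEnd h2 h hΦ
    have h3 : ∀ S ∈ radEnd q B X, ∀ T ∈ (derRing 𝒜 f).map Φ, sbr ℳ S T ∈ radEnd q B X := by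
      refine sbr_mem_of_hom ℳ hrad hpart fun α β S hS hα T hT hβ => ?_
      have k : sbr ℳ S T = -(sgn (α * β) • sbr ℳ T S) := by
        rw [sbr_hom ℳ hα hβ, sbr_hom ℳ hβ hα, zsmul_sub, mul_comm β α, smul_smul, sgn_mul_self,
          one_smul, neg_sub]
      rw [k]
      exact neg_mem (zsmul_mem (h1 T hT S hS) _)
    have h4 : ∀ S ∈ (derRing 𝒜 f).map Φ, ∀ T ∈ (derRing 𝒜 f).map Φ,
        sbr ℳ S T ∈ (derRing 𝒜 f).map Φ := by
      refine sbr_mem_of_hom ℳ hpart hpart ?_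
      rintro α β _ ⟨Δ, hΔ, rfl⟩ hα _ ⟨Γ, hΓ, rfl⟩ hβ
      have k1 := endPart_extension h2 h hΦ hΔ α
      have k2 := endPart_extension h2 h hΦ hΓ β
      rw [endPart_same ℳ hα] at k1
      rw [endPart_same ℳ hβ] at k2
      rw [k1, k2, sbr_extension h2 h hΦ ((mem_der_iff _ _ _).mp hΔ α) ((mem_der_iff _ _ _).mp hΓ β)]
      exact ⟨_, sbr_mem_der _ _ _ (endPart_mem_der _ _ _ α hΔ) (endPart_mem_der _ _ _ β hΓ), rfl⟩
    intro S hS T hT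
    obtain ⟨S₁, hS₁, S₂, hS₂, rfl⟩ := AddSubgroup.mem_sup.mp hS
    obtain ⟨T₁, hT₁, T₂, hT₂, rfl⟩ := AddSubgroup.mem_sup.mp hT
    have k : sbr ℳ (S₁ + S₂) (T₁ + T₂) =
        (sbr ℳ S₁ T₁ + sbr ℳ S₁ T₂ + sbr ℳ S₂ T₁) + sbr ℳ S₂ T₂ := by
      simp only [map_add, AddMonoidHom.add_apply]
      abel
    rw [k]
    exact AddSubgroup.add_mem_sup (add_mem (add_mem (sbr_mem_radEnd h _ hS₁ _ hT₁)
      (h3 _ hS₁ _ hT₂)) (h1 _ hS₂ _ hT₁)) (h4 _ hS₂ _ hT₂)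

include h2 h hΦ in
theorem complement_le_sE {e e' : M} (he : IsHypPair q e e') :
    radEnd q B X ⊔ (derRing 𝒜 f).map Φ ≤ sE f q (eosp q) := by
  refine sup_le (fun T hT => ?_) ?_
  · refine (mem_sup_pieces ℳ (D := sPiece f q (eosp q)) (fun _ _ h => And.left h)).mpr fun α => ?_
    have k := endPart_mem_radEnd h α hT
    exact (mem_sPiece_iff f he).mpr ⟨fun c m => k.1 _ _, 0,
      isLift_of_mem_radEnd k (endPart_mem ℳ α T)⟩
  · rintro _ ⟨Δ, hΔ, rfl⟩
    exact extension_mem_sE h2 h hΦ hΔ he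

end Complement

/-! ### Derivations in the presence of an adapted basis -/

section FreeCase

variable {K A M τ : Type*} [Ring K] [Ring A] [AddCommGroup M] [Module A M] [Module Aᵐᵒᵖ M]
  {𝒜 : ZMod 2 → AddSubgroup A} {ℳ : ZMod 2 → AddSubgroup M} [GradedRing 𝒜]
  [IsSupercommutative 𝒜] [DirectSum.Decomposition ℳ] [SMulCommClass A Aᵐᵒᵖ M]
  [IsSupermodule 𝒜 ℳ] {q : QuadForm 𝒜 ℳ} {B : Module.Basis τ A M} {X : Set τ} {bar : τ → τ}
  {deg : τ → ZMod 2} {u v : τ → A} {f : K →+* A} {Φ : AddMonoid.End A →+ AddMonoid.End M}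

/-- The coefficient map of an element of `S_E` is a derivation of `A`. -/
theorem IsLift.coeff_mem_ringDerPiece {δ : ZMod 2} {S : AddMonoid.End M} {D : AddMonoid.End A}
    (hS : IsLift q δ S D) {e e' : M} (he : IsHypPair q e e')
    (hK : ∀ c m, S (op (f c) • m) = op (f c) • S m) : D ∈ ringDerPiece 𝒜 f δ := by
  refine ⟨hS.coeff_mem, fun c a => ?_, fun α a ha b => hS.coeff_mul he ha b⟩
  change D (a * f c) = D a * f c
  refine hom_induction 𝒜 (p := fun a => D (a * f c) = D a * f c) ?_ ?_ a
  · intro α a ha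
    rw [hS.coeff_mul he ha, hS.coeff_map_eq_zero he f hK, mul_zero, smul_zero, add_zero]
  · intro a b ha hb
    rw [add_mul, map_add, map_add, add_mul, ha, hb]

/-- The projection onto the span of the basis vectors `B s` with `s ∉ X`. -/
def radProj (B : Module.Basis τ A M) (X : Set τ) : AddMonoid.End M :=
  haveI := Classical.decPred (· ∈ X)
  (B.constr ℕ fun s => if s ∈ X then 0 else B s).toAddMonoidHom

theorem radProj_smul (a : A) (m : M) : radProj B X (a • m) = a • radProj B X m := by
  classical
  exact LinearMap.map_smul (B.constr ℕ fun s => if s ∈ X then 0 else B s) a m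

theorem radProj_of_mem {s : τ} (hs : s ∈ X) : radProj B X (B s) = 0 := by
  classical
  exact (B.constr_basis ℕ _ s).trans (if_pos hs)

theorem radProj_of_notMem {s : τ} (hs : s ∉ X) : radProj B X (B s) = B s := by
  classical
  exact (B.constr_basis ℕ _ s).trans (if_neg hs)

include 𝒜 in
theorem radProj_mem_endGrading (hB : ∀ s, B s ∈ ℳ (deg s)) : radProj B X ∈ endGrading ℳ 0 := by
  refine mem_endGrading_of_basis (𝒜 := 𝒜) hB fun α a ha s => ?_
  rw [radProj_smul, add_zero]
  refine IsSupermodule.smul_mem ha ?_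
  by_cases hs : s ∈ X
  · rw [radProj_of_mem hs]
    exact zero_mem _
  · rw [radProj_of_notMem hs]
    exact hB s

include 𝒜 in
theorem radProj_linear (hB : ∀ s, B s ∈ ℳ (deg s)) (a : A) (m : M) :
    radProj B X (op a • m) = op a • radProj B X m := by
  refine op_smul_of_map_smul (𝒜 := 𝒜) (radProj_mem_endGrading (𝒜 := 𝒜) hB) (fun α a _ m => ?_) a m
  rw [radProj_smul, zero_mul, sgn_zero, one_smul]

theorem form_radProj (h : IsAdapted q B X bar deg u v) (m n : M) :
    q.form (radProj B X m) n = 0 := by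
  refine basis_induction 𝒜 B (p := fun m => q.form (radProj B X m) n = 0) ?_ ?_ ?_ m
  · rw [map_zero, map_zero, AddMonoidHom.zero_apply]
  · intro m r hm hr
    rw [map_add, map_add, AddMonoidHom.add_apply, hm, hr, add_zero]
  · intro α a _ s
    rw [radProj_smul, form_smul_left]
    by_cases hs : s ∈ X
    · rw [radProj_of_mem hs, map_zero, AddMonoidHom.zero_apply, mul_zero]
    · rw [radProj_of_notMem hs, h.form_radical s hs, mul_zero]

variable (h2 : IsUnit (2 : A)) (h : IsAdapted q B X bar deg u v) (hΦ : IsExtension 𝒜 f B u v Φ)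
  {e e' : M}

include h2 h hΦ in
/-- Subtracting an extended derivation makes an element of `S_E` linear; as a skew map preserves the
radical, subtracting an endomorphism of the radical makes it vanish there. -/
theorem exists_decomposition (he : IsHypPair q e e') {δ : ZMod 2} {S : AddMonoid.End M}
    (hS : S ∈ sPiece f q (eosp q) δ) : ∃ C ∈ radEnd q B X ⊔ (derRing 𝒜 f).map Φ,
      ∃ U, IsLift q δ U 0 ∧ (∀ s ∉ X, U (B s) = 0) ∧ S = C + U := by
  obtain ⟨hK, D, hD⟩ := (mem_sPiece_iff f he).mp hS
  have hD1 := hD.coeff_mem_ringDerPiece he hK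
  have hV := hD.sub (isLift_extension h2 h hΦ hD1)
  rw [sub_self] at hV
  have hP := radProj_mem_endGrading (𝒜 := 𝒜) (X := X) h.basis_mem
  have hT : (S - Φ D) * radProj B X ∈ radEnd q B X := by
    refine ⟨fun a m => ?_, fun s hs => ?_, fun m n => ?_⟩
    · rw [end_mul_apply, end_mul_apply, radProj_linear (𝒜 := 𝒜) h.basis_mem, hV.linear]
    · rw [end_mul_apply, radProj_of_mem hs, map_zero]
    · refine hom_induction ℳ (p := fun m => q.form (((S - Φ D) * radProj B X) m) n = 0) ?_ ?_ m
      · intro γ m hm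
        have k := hV.map_form _ _ (hP γ m hm) n
        rw [form_radProj h, form_radProj h, map_zero, smul_zero, add_zero] at k
        exact k.symm
      · intro m r hm hr
        rw [map_add, map_add, AddMonoidHom.add_apply, hm, hr, add_zero]
  have hTδ : (S - Φ D) * radProj B X ∈ endGrading ℳ δ := by
    have k := mul_mem_endGrading ℳ hV.mem hP
    rwa [add_zero] at k
  have hU := hV.sub (isLift_of_mem_radEnd hT hTδ)
  rw [sub_self] at hU
  refine ⟨(S - Φ D) * radProj B X + Φ D, AddSubgroup.add_mem_sup hT
    ⟨D, mem_derRing_of_piece hD1, rfl⟩, _, hU, fun s hs => ?_, by abel⟩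
  rw [end_sub_apply, end_mul_apply, radProj_of_notMem hs, sub_self]

include h2 h hΦ in
/-- If `J` contains the inner derivations and all `d_{S,0}` for linear `S` vanishing on the radical,
then the derivations `d_{S,0}` with `S` in the complement complete `J` to the whole of `Der L`. -/
theorem sup_outer_eq_derEosp {n₀ : M} (hL : IsLarge q e e' n₀)
    {J : AddSubgroup (AddMonoid.End (eosp (qInf q)))} (hJ : adOf (eospBr (qInf q)) ⊤ ≤ J)
    (hJ' : J ≤ derEosp f (qInf q))
    (hU : ∀ δ U, IsLift q δ U 0 → (∀ s ∉ X, U (B s) = 0) → ∀ d, IsOuter q U d → d ∈ J) :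
    J ⊔ outer q (radEnd q B X ⊔ (derRing 𝒜 f).map Φ) = derEosp f (qInf q) := by
  have he := hL.toIsHypPair
  have hC := complement_le_sE h2 h hΦ he
  apply le_antisymm
  · exact sup_le hJ' ((outer_mono hC).trans (outer_le_derEosp f he))
  · rw [derEosp_eq f h2 hL]
    refine sup_le (hJ.trans le_sup_left) ?_
    rintro d ⟨S, hS, hd⟩
    have key : ∀ α, endPart (eospGrading (qInf q)) α d ∈
        J ⊔ outer q (radEnd q B X ⊔ (derRing 𝒜 f).map Φ) := by
      intro α
      have hd' := hd.endPart_of_mem_sE f he hS α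
      have hS' := (mem_sup_pieces ℳ (D := sPiece f q (eosp q)) (fun _ _ h => And.left h)).mp hS α
      obtain ⟨C, hCC, U, hU1, hU2, hCU⟩ := exists_decomposition h2 h hΦ he hS'
      obtain ⟨c, hc, -⟩ := existsUnique_isOuter f he (hC hCC)
      have hu := isOuter_outerMap he hU1.normalizes
      have k := hu.add hc
      rw [add_comm, ← hCU] at k
      rw [(existsUnique_isOuter f he (mem_sup_of_mem_piece (D := sPiece f q (eosp q)) hS')).unique
        hd' k]
      exact AddSubgroup.add_mem_sup (hU _ U hU1 hU2 _ hu) ⟨C, hCC, hc⟩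
    rw [← endPart_add (eospGrading (qInf q)) d]
    exact add_mem (key 0) (key 1)

theorem smul_basis_injective (s : τ) {a b : A} (hab : a • B s = b • B s) : a = b := by
  have k := congrArg (fun m => B.repr m s) hab
  simpa using k

include hΦ in
theorem extension_apply_of_unit_one {s₀ : τ} (hu : u s₀ = 1) {Δ : AddMonoid.End A}
    (hΔ : Δ ∈ derRing 𝒜 f) (a : A) : Φ Δ (a • B s₀) = Δ a • B s₀ := by
  have k := (mem_der_iff _ _ _).mp hΔ
  have k1 : Δ 1 = 0 := by
    rw [← endPart_add 𝒜 Δ, end_add_apply, ringDer_one (k 0), ringDer_one (k 1), add_zero]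
  rw [hΦ Δ hΔ, liftCoeff, hu, k1, mul_zero, zero_mul, zero_mul, zero_add]

include hΦ in
theorem extension_injective {s₀ : τ} (hu : u s₀ = 1) {Δ Γ : AddMonoid.End A}
    (hΔ : Δ ∈ derRing 𝒜 f) (hΓ : Γ ∈ derRing 𝒜 f) (hΔΓ : Φ Δ = Φ Γ) : Δ = Γ := by
  apply end_ext
  intro a
  refine smul_basis_injective (B := B) s₀ ?_
  rw [← extension_apply_of_unit_one hΦ hu hΔ, ← extension_apply_of_unit_one hΦ hu hΓ, hΔΓ]

/-- Elements of `eosp q` vanish on the radical. -/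
theorem eosp_map_radical {m : M} (hm : ∀ n, q.form m n = 0) {x : AddMonoid.End M}
    (hx : x ∈ eosp q) : x m = 0 := by
  refine eosp_induction q (p := fun x => x m = 0) rfl ?_ ?_ ?_ hx
  · intro x y hx hy
    rw [end_add_apply, hx, hy, add_zero]
  · intro x hx
    rw [end_neg_apply, hx, neg_zero]
  · intro α β p hp r hr
    rw [opE_apply q hp hr, form_comm_eq_zero hm, form_comm_eq_zero hm]
    simp

include h hΦ in
/-- No nonzero element of the complement agrees with elements of `eosp q` on finite sets: these are
linear, which excludes a derivation, and they vanish on the radical. -/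
theorem eq_zero_of_agree {s₀ : τ} (hs₀ : s₀ ∈ X) (hdeg : deg s₀ = 0) (hu : u s₀ = 1)
    {S : AddMonoid.End M} (hS : S ∈ radEnd q B X ⊔ (derRing 𝒜 f).map Φ)
    (hF : ∀ F : Finset M, ∃ x ∈ eosp q, ∀ m ∈ F, S m = x m) : S = 0 := by
  classical
  obtain ⟨T, hT, _, ⟨Δ, hΔ, rfl⟩, rfl⟩ := AddSubgroup.mem_sup.mp hS
  have hB0 : B s₀ ∈ ℳ 0 := by
    rw [← hdeg]
    exact h.basis_mem s₀
  have hS0 : ∀ a, (T + Φ Δ) (a • B s₀) = Δ a • B s₀ := by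
    intro a
    rw [end_add_apply, extension_apply_of_unit_one hΦ hu hΔ, smul_eq_op_smul (𝒜 := 𝒜) hB0, hT.1,
      hT.2.1 s₀ hs₀, smul_zero, zero_add]
  have hΔ1 : Δ 1 = 0 := by
    have k := (mem_der_iff _ _ _).mp hΔ
    rw [← endPart_add 𝒜 Δ, end_add_apply, ringDer_one (k 0), ringDer_one (k 1), add_zero]
  have hΔ0 : Δ = 0 := by
    apply end_ext
    intro a
    obtain ⟨x, hx, hxF⟩ := hF {B s₀, a • B s₀}
    have k1 := hxF (B s₀) (by simp)
    have k2 := hxF (a • B s₀) (by simp)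
    have k3 := hS0 1
    rw [one_smul, hΔ1, zero_smul, k1] at k3
    rw [hS0, smul_eq_op_smul (𝒜 := 𝒜) hB0, smul_eq_op_smul (𝒜 := 𝒜) hB0, eosp_linear q hx, k3,
      smul_zero, ← smul_eq_op_smul (𝒜 := 𝒜) hB0] at k2
    exact smul_basis_injective (B := B) s₀ (k2.trans (zero_smul A (B s₀)).symm)
  subst hΔ0
  rw [map_zero, add_zero] at hF ⊢
  refine end_ext fun m => eq_of_linear_of_support 𝒜 h.basis_mem hT.1
    (fun a m => (smul_zero (op a)).symm) fun s _ => ?_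
  by_cases hs : s ∈ X
  · exact hT.2.1 s hs
  · obtain ⟨x, hx, hxF⟩ := hF {B s}
    rw [hxF (B s) (by simp), eosp_map_radical (h.form_radical s hs) hx]
    rfl

include hΦ in
theorem radEnd_inf_extension (hB : ∀ s, B s ∈ ℳ (deg s)) {s₀ : τ} (hs₀ : s₀ ∈ X)
    (hdeg : deg s₀ = 0) (hu : u s₀ = 1) : radEnd q B X ⊓ (derRing 𝒜 f).map Φ = ⊥ := by
  rw [eq_bot_iff]
  rintro _ ⟨hT, Δ, hΔ, rfl⟩
  have hB0 : B s₀ ∈ ℳ 0 := by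
    rw [← hdeg]
    exact hB s₀
  have k : Δ = 0 := by
    apply end_ext
    intro a
    refine smul_basis_injective (B := B) s₀ ?_
    rw [← extension_apply_of_unit_one hΦ hu hΔ, smul_eq_op_smul (𝒜 := 𝒜) hB0]
    refine (hT.1 a _).trans ?_
    rw [hT.2.1 s₀ hs₀, smul_zero]
    exact (zero_smul A (B s₀)).symm
  rw [k, map_zero]
  exact zero_mem _

include h2 h hΦ in
/-- If `d_{S,0}` is locally inner, `S` agrees with elements of `eosp q` on finite sets. The index `s₀`
is that of a vector of the hyperbolic part, on which extended derivations act by `a ↦ Δ a`. -/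
theorem adLoc_inf_outer (he : IsHypPair q e e') {s₀ : τ} (hs₀ : s₀ ∈ X) (hdeg : deg s₀ = 0)
    (hu : u s₀ = 1) :
    adLocEosp f (qInf q) ⊓ outer q (radEnd q B X ⊔ (derRing 𝒜 f).map Φ) = ⊥ := by
  rw [eq_bot_iff]
  rintro d ⟨hd, S, hS, hSd⟩
  have hSE := complement_le_sE h2 h hΦ he hS
  have hS0 := eq_zero_of_agree h hΦ hs₀ hdeg hu hS
    fun F => exists_agree_of_mem_adLoc f h2 he hSE hSd hd F
  subst hS0
  exact (existsUnique_isOuter f he hSE).unique hSd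
    ((outer q (⊥ : AddSubgroup (AddMonoid.End M))).zero_mem.elim fun T hT => by
      rw [AddSubgroup.mem_bot.mp hT.1] at hT
      exact hT.2)

include h2 h hΦ in
theorem isSemidirect_adLoc {n₀ : M} (hL : IsLarge q e e' n₀) {s₀ : τ} (hs₀ : s₀ ∈ X)
    (hdeg : deg s₀ = 0) (hu : u s₀ = 1) :
    IsSemidirect (eospGrading (qInf q)) (fun c => eospL (qInf q) (f c)) (derEosp f (qInf q))
      (adLocEosp f (qInf q)) (outer q (radEnd q B X ⊔ (derRing 𝒜 f).map Φ)) where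
  isSubalgebra_total := isSubalgebra_derEosp f (qInf q)
  isSubalgebra_left := isSubalgebra_adLoc f (qInf q)
  isSubalgebra_right := isSubalgebra_outer f hL.toIsHypPair
    (complement_le_sE h2 h hΦ hL.toIsHypPair) (isSubalgebra_complement h2 h hΦ)
  ideal := sbr_mem_adLoc f (qInf q)
  inf_eq := adLoc_inf_outer h2 h hΦ hL.toIsHypPair hs₀ hdeg hu
  sup_eq := sup_outer_eq_derEosp h2 h hΦ hL (adOf_le_adLoc f (qInf q)) (fun _ hd => hd.1)
    fun _ _ hU hUX _ hd => mem_adLoc_of_agree f hL.toIsHypPair hU (h.exists_agree h2 hU hUX) hd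

include h2 h hΦ in
theorem isSemidirect_ad_of_finite [Finite τ] {n₀ : M} (hL : IsLarge q e e' n₀) {s₀ : τ}
    (hs₀ : s₀ ∈ X) (hdeg : deg s₀ = 0) (hu : u s₀ = 1) :
    IsSemidirect (eospGrading (qInf q)) (fun c => eospL (qInf q) (f c)) (derEosp f (qInf q))
      (adOf (eospBr (qInf q)) ⊤) (outer q (radEnd q B X ⊔ (derRing 𝒜 f).map Φ)) where
  isSubalgebra_total := isSubalgebra_derEosp f (qInf q)
  isSubalgebra_left := isSubalgebra_ad f (qInf q)
  isSubalgebra_right := (isSemidirect_adLoc h2 h hΦ hL hs₀ hdeg hu).isSubalgebra_right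
  ideal := fun _ hd _ hg => sbr_mem_ad f (qInf q) hd hg
  inf_eq := by
    rw [eq_bot_iff, ← adLoc_inf_outer h2 h hΦ hL.toIsHypPair hs₀ hdeg hu]
    exact inf_le_inf_right _ (adOf_le_adLoc f (qInf q))
  sup_eq := by
    refine sup_outer_eq_derEosp h2 h hΦ hL le_rfl
      ((adOf_le_adLoc f (qInf q)).trans fun _ hd => hd.1) fun δ U hU hUX d hd => ?_
    -- for a finite basis `U` itself belongs to `eosp q`, and `d_{U,0}` is inner
    have hx := h.mem_eosp_of_finite h2 hU hUX
    have k := (isOuter_iff hL.toIsHypPair hU.normalizes).mp hd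
    rw [k, ← (isOuter_iff hL.toIsHypPair hU.normalizes).mp
      (isOuter_adE_coe hL.toIsHypPair ⟨U, hx⟩)]
    exact adE_mem_adOf _ _

include h2 h hΦ in
theorem isSemidirect_ad_of_generated {n₀ : M} (hL : IsLarge q e e' n₀) {s₀ : τ}
    (hs₀ : s₀ ∈ X) (hdeg : deg s₀ = 0) (hu : u s₀ = 1) (F : Finset (eosp (qInf q)))
    (hF : AddSubgroup.closure {y | ∃ a, ∃ x ∈ F, y = eospL (qInf q) a x} = ⊤) :
    IsSemidirect (eospGrading (qInf q)) (fun c => eospL (qInf q) (f c)) (derEosp f (qInf q))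
      (adOf (eospBr (qInf q)) ⊤) (outer q (radEnd q B X ⊔ (derRing 𝒜 f).map Φ)) := by
  rw [le_antisymm (adOf_le_adLoc f (qInf q)) (adLoc_le_ad_of_finite f (qInf q) F hF)]
  exact isSemidirect_adLoc h2 h hΦ hL hs₀ hdeg hu

/-! ### The copy of `Der A` -/

include h2 h hΦ in
theorem normalizes_extension {Δ : AddMonoid.End A} (hΔ : Δ ∈ derRing 𝒜 f) :
    Normalizes q (Φ Δ) Δ := by
  have k := (mem_der_iff _ _ _).mp hΔ
  have k1 := (isLift_extension h2 h hΦ (k 0)).normalizes.add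
    (isLift_extension h2 h hΦ (k 1)).normalizes
  rwa [← map_add, endPart_add] at k1

theorem sbr_eq_sum_parts {V : Type*} [AddCommGroup V] (𝒱 : ZMod 2 → AddSubgroup V)
    [DirectSum.Decomposition 𝒱] (S T : AddMonoid.End V) : sbr 𝒱 S T =
      sbr 𝒱 (endPart 𝒱 0 S) (endPart 𝒱 0 T) + sbr 𝒱 (endPart 𝒱 0 S) (endPart 𝒱 1 T) +
        (sbr 𝒱 (endPart 𝒱 1 S) (endPart 𝒱 0 T) + sbr 𝒱 (endPart 𝒱 1 S) (endPart 𝒱 1 T)) := by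
  conv_lhs => rw [← endPart_add 𝒱 S, ← endPart_add 𝒱 T]
  simp only [map_add, AddMonoidHom.add_apply]
  exact add_add_add_comm _ _ _ _

theorem isOuter_sbr (he : IsHypPair q e e') {S T : AddMonoid.End M} (hS : S ∈ sE f q (eosp q))
    (hT : T ∈ sE f q (eosp q)) {d d' : AddMonoid.End (eosp (qInf q))} (hd : IsOuter q S d)
    (hd' : IsOuter q T d') : IsOuter q (sbr ℳ S T) (sbr (eospGrading (qInf q)) d d') := by
  have key : ∀ α β, IsOuter q (sbr ℳ (endPart ℳ α S) (endPart ℳ β T))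
      (sbr (eospGrading (qInf q)) (endPart (eospGrading (qInf q)) α d)
        (endPart (eospGrading (qInf q)) β d')) := by
    intro α β
    obtain ⟨D, hD⟩ := exists_isLift_of_mem_sE f he hS α
    obtain ⟨D', hD'⟩ := exists_isLift_of_mem_sE f he hT β
    exact IsOuter.sbr_hom he hD hD' (hd.endPart_of_mem_sE f he hS α)
      (hd'.endPart_of_mem_sE f he hT β)
  rw [sbr_eq_sum_parts ℳ S T, sbr_eq_sum_parts (eospGrading (qInf q)) d d']
  exact ((key 0 0).add (key 0 1)).add ((key 1 0).add (key 1 1))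

include h2 h hΦ in
/-- `Δ ↦ d_{Δ_M,0}` is an isomorphism from `Der A` onto its image. -/
theorem exists_isLieIso (he : IsHypPair q e e') {s₀ : τ} (hu : u s₀ = 1) :
    ∃ φ : derRing 𝒜 f →+ outer q ((derRing 𝒜 f).map Φ),
      IsLieIso 𝒜 (eospGrading (qInf q)) (fun c => mulL A (f c)) (fun c => eospL (qInf q) (f c))
        (derRing 𝒜 f) (outer q ((derRing 𝒜 f).map Φ)) φ ∧
      ∀ Δ : derRing 𝒜 f, IsOuter q (Φ Δ) (φ Δ) := by
  have hN := fun Δ : derRing 𝒜 f => normalizes_extension h2 h hΦ Δ.2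
  have hE := fun Δ : derRing 𝒜 f => extension_mem_sE h2 h hΦ Δ.2 he
  have hO := fun Δ : derRing 𝒜 f => isOuter_outerMap he (hN Δ)
  have hun : ∀ (Δ : derRing 𝒜 f) d, IsOuter q (Φ Δ) d → outerMap q (hN Δ) = d := fun Δ d hd =>
    (existsUnique_isOuter f he (hE Δ)).unique (hO Δ) hd
  refine ⟨AddMonoidHom.mk' (fun Δ => ⟨outerMap q (hN Δ), Φ Δ, ⟨Δ, Δ.2, rfl⟩, hO Δ⟩) ?_,
    ⟨⟨?_, ?_⟩, ?_, ?_, ?_⟩, hO⟩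
  · intro Δ Γ
    refine Subtype.ext (hun _ _ ?_)
    have k := (hO Δ).add (hO Γ)
    rwa [← map_add] at k
  · intro Δ Γ hΔΓ
    have k := hO Γ
    have hk : outerMap q (hN Δ) = outerMap q (hN Γ) := congrArg Subtype.val hΔΓ
    rw [← hk] at k
    exact Subtype.ext (extension_injective hΦ hu Δ.2 Γ.2 ((hO Δ).injective k))
  · rintro ⟨d, _, ⟨Δ, hΔ, rfl⟩, hd⟩
    exact ⟨⟨Δ, hΔ⟩, Subtype.ext (hun ⟨Δ, hΔ⟩ d hd)⟩
  · intro α Δ hΔ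
    exact outerMap_mem_endGrading (isLift_extension h2 h hΦ (mem_derPiece_of_mem_der _ _ _ Δ.2 hΔ))
  · intro c Δ Γ hΓ
    refine hun Γ _ ?_
    rw [hΓ, ← mulL_mul_extension h2 hΦ Δ.2]
    exact (hO Δ).mulL_mul (f c)
  · intro Δ Γ Ψ hΨ
    refine hun Ψ _ ?_
    have k : Φ Ψ = sbr ℳ (Φ Δ) (Φ Γ) := by
      have k1 := (mem_der_iff _ _ _).mp Δ.2
      have k2 := (mem_der_iff _ _ _).mp Γ.2
      rw [hΨ, sbr_eq_sum_parts 𝒜, sbr_eq_sum_parts ℳ]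
      simp only [map_add, endPart_extension h2 h hΦ Δ.2, endPart_extension h2 h hΦ Γ.2,
        sbr_extension h2 h hΦ (k1 _) (k2 _)]
    rw [k]
    exact isOuter_sbr he (hE Δ) (hE Γ) (hO Δ) (hO Γ)

end FreeCase

/-! ### The sum of a hyperbolic space and an almost diagonalizable one -/

section Concrete

variable {A : Type*} [Ring A] {𝒜 : ZMod 2 → AddSubgroup A} [GradedRing 𝒜] [IsSupercommutative 𝒜]

theorem not_isUnit_of_odd [Nontrivial A] (h2 : IsUnit (2 : A)) {a : A} (ha : a ∈ 𝒜 1) :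
    ¬IsUnit a := by
  intro hu
  have k := IsSupercommutative.mul_comm ha ha
  rw [mul_one, sgn_one, neg_smul, one_smul] at k
  exact not_isUnit_zero (eq_zero_of_eq_neg h2 k ▸ hu.mul hu)

theorem inverse_mem_of_even {a : A} (ha : a ∈ 𝒜 0) (hu : IsUnit a) : Ring.inverse a ∈ 𝒜 0 := by
  have k : a * part 𝒜 1 (Ring.inverse a) = 0 := by
    have k1 : part 𝒜 1 (a * Ring.inverse a) = a * part 𝒜 1 (Ring.inverse a) := by
      nth_rewrite 1 [← part_add 𝒜 (Ring.inverse a)]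
      have m0 := SetLike.GradedMul.mul_mem ha (part_mem 𝒜 0 (Ring.inverse a))
      have m1 := SetLike.GradedMul.mul_mem ha (part_mem 𝒜 1 (Ring.inverse a))
      rw [zero_add] at m0 m1
      rw [mul_add, map_add, part_same 𝒜 m1, part_ne 𝒜 m0 (by decide), zero_add]
    rw [← k1, Ring.mul_inverse_cancel _ hu]
    exact part_ne 𝒜 SetLike.GradedOne.one_mem (by decide)
  have k2 : part 𝒜 1 (Ring.inverse a) = 0 := by
    rw [← one_mul (part 𝒜 1 (Ring.inverse a)), ← Ring.inverse_mul_cancel _ hu, mul_assoc, k,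
      mul_zero]
  rw [← part_add 𝒜 (Ring.inverse a), k2, add_zero]
  exact part_mem 𝒜 0 _

variable {K P I ι κ : Type*} [Ring K] [AddCommGroup P] [Module A P] [Module Aᵐᵒᵖ P]
  [SMulCommClass A Aᵐᵒᵖ P] {𝒢 : ZMod 2 → AddSubgroup P} [DirectSum.Decomposition 𝒢]
  [IsSupermodule 𝒜 𝒢] {qP : QuadForm 𝒜 𝒢} {f : K →+* A}

theorem hypForm_single (s t : I ⊕ I) (a c : A) [Decidable (t = s.swap)] :
    (hypForm 𝒜 I).form (Finsupp.single s a) (Finsupp.single t c) =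
      if t = s.swap then a * c else 0 := by
  classical
  change (Finsupp.single s a).sum (fun s a => a * Finsupp.single t c s.swap) = _
  rw [Finsupp.sum_single_index (zero_mul _), Finsupp.single_apply]
  split_ifs
  · rfl
  · rw [mul_zero]

theorem orthSum_form (v w : Hyp I A × P) : (orthSum (hypForm 𝒜 I) qP).form v w =
    (hypForm 𝒜 I).form v.1 w.1 + qP.form v.2 w.2 := rfl

theorem isHypPair_single (i : I) : IsHypPair (orthSum (hypForm 𝒜 I) qP)
    ((Finsupp.single (Sum.inl i) 1, 0) : Hyp I A × P) (Finsupp.single (Sum.inr i) 1, 0) := by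
  classical
  have k : ∀ s : I ⊕ I, ((Finsupp.single s 1, 0) : Hyp I A × P) ∈
      prodGrading (hypGrading 𝒜 I) 𝒢 0 := by
    refine fun s => ⟨fun t => ?_, zero_mem _⟩
    change Finsupp.single s (1 : A) t ∈ 𝒜 0
    rw [Finsupp.single_apply]
    split_ifs
    · exact SetLike.GradedOne.one_mem
    · exact zero_mem _
  refine ⟨k _, k _, ?_, ?_, ?_⟩ <;> rw [orthSum_form, hypForm_single] <;> simp

variable (I) in
/-- A hyperbolic pair together with a second basis vector of `H(I; A)`, or with a vector of `P` whose
annihilator is zero. -/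
theorem exists_isLarge (i : I) (hI : Nontrivial I ∨ ∃ p : P, ∀ a : A, a • p = 0 → a = 0) :
    ∃ n, IsLarge (orthSum (hypForm 𝒜 I) qP)
      ((Finsupp.single (Sum.inl i) 1, 0) : Hyp I A × P) (Finsupp.single (Sum.inr i) 1, 0) n := by
  classical
  rcases hI with hI | ⟨p, hp⟩
  · obtain ⟨j, hj⟩ := exists_ne i
    refine ⟨(Finsupp.single (Sum.inl j) 1, 0), isHypPair_single i, ?_, ?_, fun a ha => ?_⟩
    · rw [orthSum_form, hypForm_single]
      simp
    · rw [orthSum_form, hypForm_single]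
      simp [hj]
    · have k := DFunLike.congr_fun (congrArg Prod.fst ha) (Sum.inl j)
      simpa using k
  · refine ⟨(0, p), isHypPair_single i, ?_, ?_, fun a ha => hp a (congrArg Prod.snd ha)⟩ <;>
      rw [orthSum_form] <;> simp

variable (I) in
/-- The basis of `H(I; A) ⊕ P` given by a basis of `P`. -/
def fullBasis (b : Module.Basis (ι ⊕ κ) A P) :
    Module.Basis ((I ⊕ I) ⊕ (ι ⊕ κ)) A (Hyp I A × P) :=
  (Finsupp.basisSingleOne : Module.Basis (I ⊕ I) A (Hyp I A)).prod b

variable {b : Module.Basis (ι ⊕ κ) A P}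

theorem fullBasis_inl (s : I ⊕ I) : fullBasis I b (Sum.inl s) = (Finsupp.single s 1, 0) := by
  refine Prod.ext ?_ ?_
  · simp [fullBasis]
  · simp [fullBasis]

theorem fullBasis_inr (s : ι ⊕ κ) : fullBasis I b (Sum.inr s) = (0, b s) := by
  refine Prod.ext ?_ ?_
  · simp [fullBasis]
  · simp [fullBasis]

variable (I ι κ) in
/-- The indices of the basis vectors of `H(I; A) ⊕ P` outside `R`. -/
def regularIndex : Set ((I ⊕ I) ⊕ (ι ⊕ κ)) := {s | ∀ j, s ≠ Sum.inr (Sum.inr j)}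

/-- The family `u`, extended by `1` to all basis vectors of `H(I; A) ⊕ P`. -/
def fullUnit (u : ι → A) : (I ⊕ I) ⊕ (ι ⊕ κ) → A :=
  Sum.elim (fun _ => 1) (Sum.elim u fun _ => 1)

variable {bar : ι → ι} {u : ι → A}

/-- The map `extend` is given on the basis of `H(I; A) ⊕ P` by the coefficients `liftCoeff`, which
vanish where the unit is `1`. -/
theorem isExtension_extend : IsExtension 𝒜 f (fullBasis I b) (fullUnit u)
    (fullUnit fun i => Ring.inverse (u i)) (extend I b u) := by
  classical
  intro Δ hΔ a s
  have hΔ1 : Δ 1 = 0 := by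
    have k := (mem_der_iff _ _ _).mp hΔ
    rw [← endPart_add 𝒜 Δ, end_add_apply, ringDer_one (k 0), ringDer_one (k 1), add_zero]
  have k : ∀ v : Hyp I A × P, extend I b u Δ v = (Finsupp.mapRange Δ (map_zero Δ) v.1,
      (b.repr v.2).sum fun s a => (extendCoeff u Δ s * a + Δ a) • b s) := fun _ => rfl
  rw [k]
  rcases s with s | s
  · have hc : liftCoeff (fullUnit u) (fullUnit fun i => Ring.inverse (u i)) Δ
        (Sum.inl s : (I ⊕ I) ⊕ (ι ⊕ κ)) = 0 := by
      rw [liftCoeff, fullUnit, Sum.elim_inl, hΔ1, mul_zero, zero_mul]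
    rw [hc, fullBasis_inl, zero_mul, zero_add]
    refine Prod.ext ?_ ?_
    · simp
    · simp
  · have hc : liftCoeff (fullUnit u) (fullUnit fun i => Ring.inverse (u i)) Δ
        (Sum.inr s : (I ⊕ I) ⊕ (ι ⊕ κ)) = extendCoeff u Δ s := by
      rcases s with i | j
      · rfl
      · rw [liftCoeff, fullUnit, Sum.elim_inr, Sum.elim_inr, hΔ1, mul_zero, zero_mul]
        rfl
    rw [hc, fullBasis_inr]
    refine Prod.ext ?_ ?_
    · simp
    · rw [Prod.smul_snd, Prod.smul_snd, map_smul, b.repr_self, Finsupp.smul_single, smul_eq_mul,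
        mul_one, Finsupp.sum_single_index]
      rw [mul_zero, map_zero, add_zero, zero_smul]

theorem form_radical_right (hb : ∀ s, ∃ α, b s ∈ 𝒢 α)
    (hNR : ∀ i j, qP.form (b (Sum.inl i)) (b (Sum.inr j)) = 0)
    (hR : ∀ j l, qP.form (b (Sum.inr j)) (b (Sum.inr l)) = 0) (j : κ) (p : P) :
    qP.form (b (Sum.inr j)) p = 0 := by
  obtain ⟨β, hβ⟩ := hb (Sum.inr j)
  refine basis_induction 𝒜 b (p := fun p => qP.form (b (Sum.inr j)) p = 0) (map_zero _) ?_ ?_ p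
  · intro m n hm hn
    rw [map_add, hm, hn, add_zero]
  · intro α a ha s
    obtain ⟨γ, hγ⟩ := hb s
    have k : qP.form (b (Sum.inr j)) (b s) = 0 := by
      rcases s with i | l
      · rw [qP.symm hβ hγ, hNR, smul_zero]
      · exact hR j l
    rw [IsSupermodule.smul_eq ha hγ, map_zsmul, qP.linear, k, zero_mul, smul_zero]

/-- Over a nontrivial ring the values `u i` are even, as no odd element is invertible, and `bar` is
an involution preserving degrees. Over the zero ring all conditions are void. -/
theorem exists_isAdapted (h2 : IsUnit (2 : A)) (hb : ∀ s, ∃ α, b s ∈ 𝒢 α)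
    (hN : IsAlmostDiagonal qP (fun i => b (Sum.inl i)) bar)
    (hNR : ∀ i j, qP.form (b (Sum.inl i)) (b (Sum.inr j)) = 0)
    (hR : ∀ j l, qP.form (b (Sum.inr j)) (b (Sum.inr l)) = 0)
    (hu : ∀ i, u i = qP.form (b (Sum.inl i)) (b (Sum.inl (bar i)))) :
    ∃ (bar' : (I ⊕ I) ⊕ (ι ⊕ κ) → (I ⊕ I) ⊕ (ι ⊕ κ)) (deg : (I ⊕ I) ⊕ (ι ⊕ κ) → ZMod 2),
      IsAdapted (orthSum (hypForm 𝒜 I) qP) (fullBasis I b) (regularIndex I ι κ) bar' deg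
        (fullUnit u) (fullUnit fun i => Ring.inverse (u i)) ∧ ∀ s, deg (Sum.inl s) = 0 := by
  classical
  rcases subsingleton_or_nontrivial A with hA | hA
  · have hM : Subsingleton (Hyp I A × P) := Module.subsingleton A _
    have h0 : ∀ a : A, a = 0 := fun a => Subsingleton.elim a 0
    have hmem : ∀ a : A, a ∈ 𝒜 0 := fun a => h0 a ▸ zero_mem _
    refine ⟨Sum.map Sum.swap id, fun _ => 0, ⟨fun s => ?_, fun s => hmem _, fun s => hmem _,
      fun s => Subsingleton.elim _ _, ?_, ?_, fun s _ => rfl, fun s _ => Subsingleton.elim _ _,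
      fun s _ => Subsingleton.elim _ _, fun s _ t _ => h0 _, fun s _ m => h0 _⟩, fun s => rfl⟩
    · rw [Subsingleton.elim (fullBasis I b s) 0]
      exact zero_mem _
    · rintro (s | s) hs
      · exact fun j => Sum.inl_ne_inr
      · exact hs
    · rintro (s | s) hs
      · simp
      · simp
  · choose d hd using hb
    have hunit : ∀ i, IsUnit (u i) := fun i => by
      rw [hu]
      exact (hN i).1
    have hud : ∀ i, u i ∈ 𝒜 (d (Sum.inl i) + d (Sum.inl (bar i))) := fun i => by
      rw [hu]
      exact qP.degree (hd _) (hd _)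
    have hdeg : ∀ i, d (Sum.inl (bar i)) = d (Sum.inl i) := by
      intro i
      rcases parity_cases (d (Sum.inl i) + d (Sum.inl (bar i))) with k | k
      · exact (CharTwo.add_eq_zero.mp k).symm
      · exact absurd (hunit i) (not_isUnit_of_odd (𝒜 := 𝒜) h2 (k ▸ hud i))
    have hu0 : ∀ i, u i ∈ 𝒜 0 := by
      intro i
      have k := hud i
      rwa [hdeg, CharTwo.add_self_eq_zero] at k
    have hsymm : ∀ i, qP.form (b (Sum.inl (bar i))) (b (Sum.inl i)) =
        sgn (d (Sum.inl i)) • u i := by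
      intro i
      rw [qP.symm (hd _) (hd _), hdeg, ← hu]
      rcases parity_cases (d (Sum.inl i)) with k | k <;> rw [k] <;> simp
    have hbar : ∀ i, bar (bar i) = i := by
      intro i
      by_contra k
      have k1 := (hN (bar i)).2 i (Ne.symm k)
      rw [hsymm] at k1
      have k2 := sgn_smul_sgn_smul (d (Sum.inl i)) (u i)
      rw [k1, smul_zero] at k2
      exact not_isUnit_zero (k2 ▸ hunit i)
    refine ⟨Sum.map Sum.swap (Sum.map bar id), Sum.elim (fun _ => 0) d, ⟨?_, ?_, ?_, ?_, ?_, ?_, ?_,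
      ?_, ?_, ?_, ?_⟩, fun s => rfl⟩
    · rintro (s | s)
      · rw [fullBasis_inl]
        rcases s with i | i
        · exact (isHypPair_single (qP := qP) i).left_mem
        · exact (isHypPair_single (qP := qP) i).right_mem
      · rw [fullBasis_inr]
        exact ⟨zero_mem _, hd s⟩
    · rintro (s | i | j)
      · exact SetLike.GradedOne.one_mem
      · exact hu0 i
      · exact SetLike.GradedOne.one_mem
    · rintro (s | i | j)
      · exact SetLike.GradedOne.one_mem
      · exact inverse_mem_of_even (hu0 i) (hunit i)
      · exact SetLike.GradedOne.one_mem
    · rintro (s | i | j)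
      · exact mul_one 1
      · exact Ring.mul_inverse_cancel _ (hunit i)
      · exact mul_one 1
    · rintro (s | i | j) hs k
      · exact Sum.inl_ne_inr
      · exact fun h => Sum.inl_ne_inr (Sum.inr_injective h)
      · exact absurd rfl (hs j)
    · rintro (s | i | j) hs
      · simp
      · simp [hbar]
      · exact absurd rfl (hs j)
    · rintro (s | i | j) hs
      · rfl
      · exact hdeg i
      · rfl
    · rintro (s | i | j) hs
      · simp [fullUnit]
      · change u (bar i) = sgn (d (Sum.inl i)) • u i
        rw [hu (bar i), hbar, hsymm]
      · exact absurd rfl (hs j)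
    · rintro (s | i | j) hs
      · rw [Sum.map_inl, fullBasis_inl, fullBasis_inl, orthSum_form, hypForm_single]
        simp [fullUnit]
      · rw [Sum.map_inr, Sum.map_inl, fullBasis_inr, fullBasis_inr, orthSum_form]
        simp [fullUnit, hu]
      · exact absurd rfl (hs j)
    · rintro (s | i | j) hs t ht
      · rcases t with t | t
        · rw [fullBasis_inl, fullBasis_inl, orthSum_form, hypForm_single, if_neg]
          · simp
          · exact fun k => ht (congrArg Sum.inl k)
        · rw [fullBasis_inl, fullBasis_inr, orthSum_form]
          simp
      · rcases t with t | i' | j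
        · rw [fullBasis_inl, fullBasis_inr, orthSum_form]
          simp
        · rw [fullBasis_inr, fullBasis_inr, orthSum_form]
          have k := (hN i).2 i' (fun k => ht (by rw [k]; rfl))
          simpa using k
        · rw [fullBasis_inr, fullBasis_inr, orthSum_form]
          simp [hNR]
      · exact absurd rfl (hs j)
    · rintro (s | i | j) hs m
      · exact absurd (fun j => Sum.inl_ne_inr) hs
      · exact absurd (fun j h => Sum.inl_ne_inr (Sum.inr_injective h)) hs
      · rw [fullBasis_inr, orthSum_form, form_radical_right (fun s => ⟨d s, hd s⟩) hNR hR]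
        simp

theorem repr_of_mem_span_inl {p : P}
    (hp : p ∈ Submodule.span A (Set.range fun i => b (Sum.inl i))) (j : κ) :
    b.repr p (Sum.inr j) = 0 := by
  refine Submodule.span_induction (p := fun p _ => b.repr p (Sum.inr j) = 0) ?_ ?_ ?_ ?_ hp
  · rintro _ ⟨i, rfl⟩
    simp
  · simp
  · intro x y _ _ hx hy
    rw [map_add, Finsupp.add_apply, hx, hy, add_zero]
  · intro a x _ hx
    rw [map_smul, Finsupp.smul_apply, hx, smul_zero]

theorem mem_span_inr_of_repr {p : P} (hp : ∀ i, b.repr p (Sum.inl i) = 0) :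
    p ∈ Submodule.span A (Set.range fun j => b (Sum.inr j)) := by
  rw [← b.linearCombination_repr p, Finsupp.linearCombination_apply]
  refine Submodule.sum_mem _ fun s _ => ?_
  rcases s with i | j
  · change b.repr p (Sum.inl i) • b (Sum.inl i) ∈ _
    rw [hp, zero_smul]
    exact zero_mem _
  · exact Submodule.smul_mem _ _ (Submodule.subset_span ⟨j, rfl⟩)

/-- A vector orthogonal to all others has no component along the `B s` with `s ∈ X`. -/
theorem IsAdapted.repr_eq_zero {M τ : Type*} [AddCommGroup M] [Module A M] [Module Aᵐᵒᵖ M]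
    {ℳ : ZMod 2 → AddSubgroup M} [DirectSum.Decomposition ℳ] [SMulCommClass A Aᵐᵒᵖ M]
    [IsSupermodule 𝒜 ℳ] {q : QuadForm 𝒜 ℳ} {B : Module.Basis τ A M} {X : Set τ} {bar : τ → τ}
    {deg : τ → ZMod 2} {u v : τ → A} (h : IsAdapted q B X bar deg u v) {m : M}
    (hm : ∀ n, q.form m n = 0) {s : τ} (hs : s ∈ X) : B.repr m s = 0 := by
  have k := hm (B (bar s))
  have k1 : ∀ t, t ≠ s → q.form (B t) (B (bar s)) = 0 := by
    intro t hts
    by_cases ht : t ∈ X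
    · refine h.form_ne t ht _ fun k => hts ?_
      rw [← h.bar_bar t ht, ← k, h.bar_bar s hs]
    · exact h.form_radical t ht _
  rw [← B.linearCombination_repr m, Finsupp.linearCombination_apply, Finsupp.sum, map_sum,
    AddMonoidHom.finsetSum_apply, Finset.sum_eq_single s
    (fun t _ hts => by rw [form_smul_left, k1 t hts, mul_zero]) (fun hs' => by
      rw [Finsupp.notMem_support_iff.mp hs', zero_smul, map_zero, AddMonoidHom.zero_apply]),
    form_smul_left, h.form_bar s hs] at k
  rw [← mul_one (B.repr m s), ← h.unit_mul_inv s, ← mul_assoc, k, zero_mul]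

/-- The endomorphisms of `R` are the linear endomorphisms of `H(I; A) ⊕ P` that kill
`H(I; A) ⊕ N` and have values in the radical. -/
theorem endOn_eq_radEnd {bar' : (I ⊕ I) ⊕ (ι ⊕ κ) → (I ⊕ I) ⊕ (ι ⊕ κ)}
    {deg : (I ⊕ I) ⊕ (ι ⊕ κ) → ZMod 2} {u' v' : (I ⊕ I) ⊕ (ι ⊕ κ) → A}
    (h : IsAdapted (orthSum (hypForm 𝒜 I) qP) (fullBasis I b) (regularIndex I ι κ) bar' deg u' v') :
    endOn I (Submodule.span A (Set.range fun i => b (Sum.inl i)))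
      (Submodule.span A (Set.range fun j => b (Sum.inr j))) =
      radEnd (orthSum (hypForm 𝒜 I) qP) (fullBasis I b) (regularIndex I ι κ) := by
  have hinl : ∀ s : I ⊕ I, (Sum.inl s : (I ⊕ I) ⊕ (ι ⊕ κ)) ∈ regularIndex I ι κ :=
    fun s j => Sum.inl_ne_inr
  have hinr : ∀ i : ι, (Sum.inr (Sum.inl i) : (I ⊕ I) ⊕ (ι ⊕ κ)) ∈ regularIndex I ι κ :=
    fun i j k => Sum.inl_ne_inr (Sum.inr_injective k)
  have hrad : ∀ r ∈ Submodule.span A (Set.range fun j => b (Sum.inr j)), ∀ n : Hyp I A × P,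
      (orthSum (hypForm 𝒜 I) qP).form ((0, r) : Hyp I A × P) n = 0 := by
    intro r hr n
    refine Submodule.span_induction
      (p := fun r _ => (orthSum (hypForm 𝒜 I) qP).form ((0, r) : Hyp I A × P) n = 0) ?_ ?_ ?_ ?_ hr
    · rintro _ ⟨j, rfl⟩
      have k := h.form_radical (Sum.inr (Sum.inr j)) (fun k => k j rfl) n
      rwa [fullBasis_inr] at k
    · exact DFunLike.congr_fun (map_zero (orthSum (hypForm 𝒜 I) qP).form) n
    · intro x y _ _ hx hy
      have k : ((0, x + y) : Hyp I A × P) = (0, x) + (0, y) := by simp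
      rw [k, map_add, AddMonoidHom.add_apply, hx, hy, add_zero]
    · intro a x _ hx
      have k : ((0, a • x) : Hyp I A × P) = a • ((0, x) : Hyp I A × P) := by simp
      rw [k, form_smul_left, hx, mul_zero]
  ext S
  constructor
  · rintro ⟨h1, h3, h4⟩
    refine ⟨h1, ?_, fun m n => ?_⟩
    · rintro (s | i | j) hs
      · rw [fullBasis_inl]
        exact h3 _ _ (zero_mem _)
      · rw [fullBasis_inr]
        exact h3 _ _ (Submodule.subset_span ⟨i, rfl⟩)
      · exact absurd rfl (hs j)
    · refine basis_induction 𝒜 (fullBasis I b)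
        (p := fun m => (orthSum (hypForm 𝒜 I) qP).form (S m) n = 0) ?_ ?_ ?_ m
      · rw [map_zero, map_zero, AddMonoidHom.zero_apply]
      · intro m r hm hr
        rw [map_add, map_add, AddMonoidHom.add_apply, hm, hr, add_zero]
      · rintro α a - (s | i | j)
        · have k : a • ((Finsupp.single s 1, 0) : Hyp I A × P) = (Finsupp.single s a, 0) := by simp
          rw [fullBasis_inl, k, h3 _ _ (zero_mem _), map_zero, AddMonoidHom.zero_apply]
        · have k : a • ((0, b (Sum.inl i)) : Hyp I A × P) = (0, a • b (Sum.inl i)) := by simp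
          rw [fullBasis_inr, k, h3 _ _ (Submodule.smul_mem _ _ (Submodule.subset_span ⟨i, rfl⟩)),
            map_zero, AddMonoidHom.zero_apply]
        · have k : a • ((0, b (Sum.inr j)) : Hyp I A × P) = (0, a • b (Sum.inr j)) := by simp
          obtain ⟨r, hr, hSr⟩ :=
            h4 _ (Submodule.smul_mem _ a (Submodule.subset_span ⟨j, rfl⟩))
          rw [fullBasis_inr, k, hSr, hrad r hr]
  · rintro ⟨h1, h3, h4⟩
    refine ⟨h1, fun g p hp => ?_, fun p _ => ?_⟩
    · refine eq_of_linear_of_support 𝒜 h.basis_mem (T := 0) h1 (fun a m => (smul_zero (op a)).symm)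
        fun s hs => ?_
      rcases s with s | i | j
      · exact h3 _ (hinl s)
      · exact h3 _ (hinr i)
      · exact absurd (by simpa [fullBasis] using repr_of_mem_span_inl hp j) hs
    · refine ⟨(S (0, p)).2, mem_span_inr_of_repr fun i => ?_, Prod.ext ?_ rfl⟩
      · have k := h.repr_eq_zero (h4 (0, p)) (hinr i)
        simpa [fullBasis] using k
      · ext s
        have k := h.repr_eq_zero (h4 (0, p)) (hinl s)
        simpa [fullBasis] using k

end Concrete

end SuperLie

end

theorem mainTheorem3 {K A P I : Type*} [Ring K] [Ring A] [AddCommGroup P] [Module A P]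
    [Module Aᵐᵒᵖ P] [SMulCommClass A Aᵐᵒᵖ P]
    (𝒦 : ZMod 2 → AddSubgroup K) (𝒜 : ZMod 2 → AddSubgroup A) (𝒢 : ZMod 2 → AddSubgroup P)
    [GradedRing 𝒦] [IsSupercommutative 𝒦] [GradedRing 𝒜] [IsSupercommutative 𝒜]
    [DirectSum.Decomposition 𝒢] [IsSupermodule 𝒜 𝒢]
    (h2 : IsUnit (2 : K)) (f : K →+* A) (hf : IsSuperextension 𝒦 𝒜 f)
    (hI : Nontrivial I ∨ (Nonempty I ∧ ∃ p : P, ∀ a : A, a • p = 0 → a = 0))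
    (qP : QuadForm 𝒜 𝒢) (q : QuadForm 𝒜 (prodGrading (hypGrading 𝒜 I) 𝒢))
    (hq : q = orthSum (hypForm 𝒜 I) qP) :
    -- `L = eosp q_∞` consists of the 4-tuples `(a, m, n, x)` with `x` in `E = eosp q`
    (∀ y, y ∈ eosp (qInf q) ↔ ∃ a m n, ∃ x ∈ eosp q, y = coord q (a, m, n, x)) ∧
    Function.Injective (coord q) ∧
    -- the bracket of `L` in terms of the 4-tuples
    (∀ α β,
      ∀ a ∈ 𝒜 α, ∀ m ∈ prodGrading (hypGrading 𝒜 I) 𝒢 α,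
      ∀ n ∈ prodGrading (hypGrading 𝒜 I) 𝒢 α,
      ∀ x ∈ eosp q, x ∈ endGrading (prodGrading (hypGrading 𝒜 I) 𝒢) α →
      ∀ a' ∈ 𝒜 β, ∀ m' ∈ prodGrading (hypGrading 𝒜 I) 𝒢 β,
      ∀ n' ∈ prodGrading (hypGrading 𝒜 I) 𝒢 β,
      ∀ x' ∈ eosp q, x' ∈ endGrading (prodGrading (hypGrading 𝒜 I) 𝒢) β →
        sbr (prodGrading (hypGrading 𝒜 Unit) (prodGrading (hypGrading 𝒜 I) 𝒢))
            (coord q (a, m, n, x)) (coord q (a', m', n', x')) =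
          coord q
            (q.form m n' - q.form n m',
              a • m' + x m' - MulOpposite.op a' • m - sgn (α * β) • x' m,
              -(a • n') + x n' + MulOpposite.op a' • n - sgn (α * β) • x' n,
              opE q m n' + opE q n m' + sbr (prodGrading (hypGrading 𝒜 I) 𝒢) x x')) ∧
    -- the endomorphism `d_{S,0}` exists and is unique
    (∀ S ∈ sE f q (eosp q), ∃! d, IsOuter q S d) ∧
    -- `Der L = ad L + {d_{S,0}}`
    derEosp f (qInf q) =
      adOf (eospBr (qInf q)) ⊤ ⊔ outer q (sE f q (eosp q)) ∧
    -- `ad L ∩ {d_{S,0}} = ad E`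
    adOf (eospBr (qInf q)) ⊤ ⊓ outer q (sE f q (eosp q)) =
      adOf (eospBr (qInf q)) (eospIn q) ∧
    -- a complement of `E` in `S_E` gives a complement of `ad L` in `Der L`
    (∀ S₀ : AddSubgroup (AddMonoid.End (Hyp I A × P)),
      IsSemidirect (prodGrading (hypGrading 𝒜 I) 𝒢) (fun c => mulL (Hyp I A × P) (f c))
        (sE f q (eosp q)) (eosp q) S₀ →
      IsSemidirect (eospGrading (qInf q)) (fun c => eospL (qInf q) (f c))
        (derEosp f (qInf q)) (adOf (eospBr (qInf q)) ⊤) (outer q S₀)) ∧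
    -- the case `P = N ⊕ R`
    (∀ {ι κ : Type*} (b : Module.Basis (ι ⊕ κ) A P) (bar : ι → ι)
      (N R : Submodule A P) (u : ι → A)
      (derM endR : AddSubgroup (AddMonoid.End (Hyp I A × P))),
      (∀ s, ∃ α, b s ∈ 𝒢 α) →
      IsAlmostDiagonal qP (fun i => b (Sum.inl i)) bar →
      (∀ i j, qP.form (b (Sum.inl i)) (b (Sum.inr j)) = 0) →
      (∀ j l, qP.form (b (Sum.inr j)) (b (Sum.inr l)) = 0) →
      N = Submodule.span A (Set.range fun i => b (Sum.inl i)) →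
      R = Submodule.span A (Set.range fun j => b (Sum.inr j)) →
      (∀ i, u i = qP.form (b (Sum.inl i)) (b (Sum.inl (bar i)))) →
      derM = (derRing 𝒜 f).map (extend I b u) →
      endR = endOn I N R →
      -- the sum of `End_A R` and `(Der A)_M` is direct and contained in `S_E`
      endR ⊔ derM ≤ sE f q (eosp q) ∧
      endR ⊓ derM = ⊥ ∧
      IsSemidirect (eospGrading (qInf q)) (fun c => eospL (qInf q) (f c))
        (derEosp f (qInf q)) (adLocEosp f (qInf q)) (outer q (endR ⊔ derM)) ∧
      -- the derivations `d_{S,0}`, with `S` in `(Der A)_M`, form a copy of `Der A`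
      (∃ φ : derRing 𝒜 f →+ outer q derM,
        IsLieIso 𝒜 (eospGrading (qInf q)) (fun c => mulL A (f c))
          (fun c => eospL (qInf q) (f c)) (derRing 𝒜 f) (outer q derM) φ ∧
        ∀ Δ : derRing 𝒜 f, IsOuter q (extend I b u Δ) (φ Δ)) ∧
      -- finite rank
      ((Finite I ∧ Finite ι ∧ Finite κ) ∨
        (∃ F : Finset (eosp (qInf q)),
          AddSubgroup.closure {y | ∃ a, ∃ x ∈ F, y = eospL (qInf q) a x} = ⊤) →
        IsSemidirect (eospGrading (qInf q)) (fun c => eospL (qInf q) (f c))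
          (derEosp f (qInf q)) (adOf (eospBr (qInf q)) ⊤) (outer q (endR ⊔ derM)))) := by
  subst hq
  have h2A : IsUnit (2 : A) := by
    have k := h2.map f
    rwa [map_ofNat] at k
  obtain ⟨i⟩ : Nonempty I := hI.elim (fun _ => inferInstance) And.left
  obtain ⟨n₀, hL⟩ := exists_isLarge (𝒜 := 𝒜) (qP := qP) I i (hI.imp_right And.right)
  have he := hL.toIsHypPair
  refine ⟨mem_eosp_qInf _, coord_injective _, ?_, fun S hS => existsUnique_isOuter f he hS,
    derEosp_eq f h2A hL, ad_inf_outer f h2A he,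
    fun S₀ hS₀ => isSemidirect_of_complement f h2A hL hS₀, ?_⟩
  · intro α β a ha m hm n hn x hx hxα a' ha' m' hm' n' hn' x' hx' hxβ
    exact sbr_coord _ ha hm hn hx hxα ha' hm' hn' hx' hxβ
  · intro ι κ b bar N R u derM endR hb hN hNR hR hNs hRs hu hderM hendR
    subst hNs hRs hderM hendR
    obtain ⟨bar', deg, h, hdeg⟩ := exists_isAdapted (I := I) h2A hb hN hNR hR hu
    have hΦ : IsExtension 𝒜 f (fullBasis I b) (fullUnit u) (fullUnit fun i => Ring.inverse (u i))
        (extend I b u) := isExtension_extend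
    have hi : (Sum.inl (Sum.inl i) : (I ⊕ I) ⊕ (ι ⊕ κ)) ∈ regularIndex I ι κ :=
      fun j => Sum.inl_ne_inr
    rw [endOn_eq_radEnd h]
    refine ⟨complement_le_sE h2A h hΦ he, radEnd_inf_extension hΦ h.basis_mem hi (hdeg _) rfl,
      isSemidirect_adLoc h2A h hΦ hL hi (hdeg _) rfl, exists_isLieIso h2A h hΦ he (s₀ := Sum.inl
      (Sum.inl i)) rfl, ?_⟩
    rintro (⟨_, _, _⟩ | ⟨F, hF⟩)
    · exact isSemidirect_ad_of_finite h2A h hΦ hL hi (hdeg _) rfl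
    · exact isSemidirect_ad_of_generated h2A h hΦ hL hi (hdeg _) rfl F hF
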